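/- **Setting.** Let $p\ge 1$, $q\ge 0$ be integers, $Q=\{1,\dots,q\}$, and let $\nu>p$ be real. Let $\mathbb B^p=\{z\in\mathbb C^p:|z|^2=\sum_k|z_k|^2<1\}$ and $\tau(\mathbb B^p)=\{r\in\mathbb R^p: r_k\ge 0,\ r^2=\sum_k r_k^2<1\}$. Let $\Lambda_q^{\mathbb C}$ be the complex Grassmann algebra with anticommuting generators $\xi_1,\dots,\xi_q,\bar\xi_1,\dots,\bar\xi_q$; for $I=\{i_1<\dots<i_k\}\subset Q$ put $\xi_I=\xi_{i_1}\cdots\xi_{i_k}$ and $\xi_I^*=\bar\xi_{i_k}\cdots\bar\xi_{i_1}$. A super function is $F=\sum_{I,J\subset Q}F_{I,J}(z)\,\xi_I\xi_J^*$ with complex functions $F_{I,J}$ on $\mathbb B^p$; it is bounded measurable if all $F_{I,J}$ are. The Berezin integral $\int_{\mathbb B^{p|q}}dz\,d\xi$ integrates over $\mathbb B^p$ the coefficient of $\xi_Q^*\xi_Q$, and $\xi\bar\xi=\sum_k\xi_k\bar\xi_k$. The super Bergman space $H^2_\nu(\mathbb B^{p|q})$ consists of the $\Psi=\sum_{M\subset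 Q}\psi_M\xi_M$ with $\psi_M$ holomorphic on $\mathbb B^p$ and $(\Psi|\Psi)<\infty$, where, with $\Theta^*=\sum_M\overline{\theta_M}\,\xi_M^*$ for $\Theta=\sum_M\theta_M\xi_M$, $$(\Theta|G)=\frac{\Gamma(\nu)}{\pi^p\,\Gamma(\nu+q-p)}\int_{\mathbb B^{p|q}}dz\,d\xi\,(1-z\bar z-\xi\bar\xi)^{\nu+q-p-1}\,\Theta^*G .$$ The super Toeplitz operator $T_F^\nu$ sends $\Psi\in H^2_\nu(\mathbb B^{p|q})$ to the orthogonal projection of $F\Psi$, i.e. to the element of $H^2_\nu(\mathbb B^{p|q})$ with $(\Theta|T_F^\nu\Psi)=(\Theta|F\Psi)$ for all $\Theta\in H^2_\nu(\mathbb B^{p|q})$. The super function $F$ is called quasi-elliptic if it is invariant under $(z,\xi)\mapsto(tz,s\xi)$ for all $(t,s)\in\mathbb T^p\times\mathbb T^q$ (with $\bar\xi_k\mapsto\bar s_k\bar\xi_k$); equivalently, $F=\sum_{I\subset Q}F_I(r)\,\xi_I\xi_I^*$ with $r=(|z_1|,\dots,|z_p|)$. On $(\ell_2(\mathbb Z_+^p))^{2^q}$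 use the inner product $\langle a,b\rangle=\sum_{M\subset Q}\frac{\Gamma(\nu)}{\Gamma(\nu+|M|)}\sum_{n}a_{M,n}\overline{b_{M,n}}$. The super Bargmann transform is $$\bigl(R_{\nu,(p|q)}\Psi\bigr)_{M,n}=(2\pi)^{-p/2}\Bigl(\frac{(2\pi)^p\,\Gamma(|n|+\nu+|M|)}{n!\,\Gamma(\nu+|M|)}\Bigr)^{1/2}\int_{\mathbb B^p}\psi_M\,\overline{z^n}\,d\mu_{\nu+|M|}(z),$$ $$d\mu_\lambda(z)=\frac{\Gamma(\lambda)}{\pi^p\,\Gamma(\lambda-p)}(1-|z|^2)^{\lambda-p-1}dz .$$ **Theorem.** $H^2_\nu(\mathbb B^{p|q})$ is a Hilbert space and $R_{\nu,(p|q)}$ is a unitary operator from it onto $(\ell_2(\mathbb Z_+^p))^{2^q}$. If $F=\sum_I F_I(r)\xi_I\xi_I^*$ is a bounded measurable quasi-elliptic super function, then $T_F^\nu$ is a well-defined bounded operator on $H^2_\nu(\mathbb B^{p|q})$, and $R_{\nu,(p|q)}T_F^\nu R_{\nu,(p|q)}^*$ is the operator of multiplication by $$\gamma_{F,\nu}(n,M)=\frac{2^p\,\Gamma(|n|+\nu+|M|)}{n!}\sum_{M\subset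 K\subset Q}\frac{(-1)^{|K\setminus M|}}{\Gamma(\nu+|K|-p)}\int_{\tau(\mathbb B^p)}F_{K\setminus M}(r)\,r^{2n}(1-r^2)^{\nu+|K|-p-1}\,r\,dr,$$ where $n\in\mathbb Z_+^p$, $M\subset Q$, $r^{2n}=\prod_k r_k^{2n_k}$ and $r\,dr=\prod_k r_k\,dr_k$. Consequently the $C^*$-algebra generated by all $T_F^\nu$ with $F$ bounded measurable and quasi-elliptic is commutative. -/

import Mathlib

open MeasureTheory

namespace SuperBall

section Algebra

variable {q : ℕ}

/-- The complex Grassmann algebra with `2q` anticommuting generators; the index `Sum.inl i`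
stands for `ξ_i` and `Sum.inr i` for its conjugate. -/
abbrev Grassmann (q : ℕ) : Type := ExteriorAlgebra ℂ (Fin q ⊕ Fin q → ℂ)

/-- The generators of the Grassmann algebra. -/
noncomputable def gen (j : Fin q ⊕ Fin q) : Grassmann q :=
  ExteriorAlgebra.ι ℂ (Pi.single j 1)

/-- The generator `ξ_i`. -/
noncomputable def xi (i : Fin q) : Grassmann q := gen (Sum.inl i)

/-- The generator `ξ̄_i`. -/
noncomputable def xiBar (i : Fin q) : Grassmann q := gen (Sum.inr i)

/-- `ξ_I = ξ_{i_1} ⋯ ξ_{i_k}` for `I = {i_1 < ⋯ < i_k}`. -/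
noncomputable def xiProd (I : Finset (Fin q)) : Grassmann q :=
  ((I.sort (· ≤ ·)).map xi).prod

/-- `ξ_I^* = ξ̄_{i_k} ⋯ ξ̄_{i_1}` for `I = {i_1 < ⋯ < i_k}`. -/
noncomputable def xiStar (I : Finset (Fin q)) : Grassmann q :=
  ((I.sort (· ≤ ·)).reverse.map xiBar).prod

/-- The left derivative with respect to a generator. -/
noncomputable def pd (j : Fin q ⊕ Fin q) : Module.End ℂ (Grassmann q) :=
  CliffordAlgebra.contractLeft (LinearMap.proj j : (Fin q ⊕ Fin q → ℂ) →ₗ[ℂ] ℂ)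

/-- The Berezin integral `∫ dξ` on the Grassmann algebra: differentiate once with respect to each
generator and keep the scalar part.  It is normalized by `∫ dξ ξ_Q^* ξ_Q = 1`
(see `berezin_top`). -/
noncomputable def berezin (q : ℕ) : Grassmann q →ₗ[ℂ] ℂ :=
  (ExteriorAlgebra.algebraMapInv (R := ℂ) (M := Fin q ⊕ Fin q → ℂ)).toLinearMap ∘ₗ
    ((List.finRange q).map fun i => pd (Sum.inl i) * pd (Sum.inr i)).prod

/-- The even nilpotent element `- ξ ξ̄ = - (ξ_1 ξ̄_1 + ⋯ + ξ_q ξ̄_q)`. -/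
noncomputable def negXiXiBar (q : ℕ) : Grassmann q := -∑ i : Fin q, xi i * xiBar i

/-- The real power `(x - ξ ξ̄)^a` for `x > 0`, by its finite binomial (Taylor) expansion
`∑_k (a (a-1) ⋯ (a-k+1) / k!) x^(a-k) (-ξ ξ̄)^k`. -/
noncomputable def superPow (q : ℕ) (x a : ℝ) : Grassmann q :=
  ∑ k ∈ Finset.range (q + 1),
    (((descPochhammer ℝ k).eval a / (k.factorial : ℝ) * x ^ (a - (k : ℝ)) : ℝ) : ℂ) •
      negXiXiBar q ^ k

/-- The product of the generators listed in `w`. -/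
noncomputable def word (w : List (Fin q ⊕ Fin q)) : Grassmann q := (w.map gen).prod

theorem pd_gen_mul (j k : Fin q ⊕ Fin q) (x : Grassmann q) :
    pd j (gen k * x) = (if j = k then x else 0) - gen k * pd j x := by
  have h := CliffordAlgebra.contractLeft_ι_mul (Q := (0 : QuadraticForm ℂ (Fin q ⊕ Fin q → ℂ)))
    (LinearMap.proj j) (Pi.single k 1) x
  refine h.trans ?_
  simp only [LinearMap.proj_apply, Pi.single_apply]
  split_ifs <;> simp [gen, pd, ExteriorAlgebra.ι]

theorem pd_one (j : Fin q ⊕ Fin q) : pd j (1 : Grassmann q) = 0 :=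
  CliffordAlgebra.contractLeft_one (Q := (0 : QuadraticForm ℂ (Fin q ⊕ Fin q → ℂ))) _

theorem pd_gen (j k : Fin q ⊕ Fin q) : pd j (gen k) = if j = k then 1 else 0 := by
  have := pd_gen_mul j k 1
  simpa [pd_one] using this

theorem pd_comm (j k : Fin q ⊕ Fin q) (x : Grassmann q) : pd j (pd k x) = -pd k (pd j x) :=
  CliffordAlgebra.contractLeft_comm _ _ x

theorem pd_word (j : Fin q ⊕ Fin q) (w : List (Fin q ⊕ Fin q)) (h : j ∉ w) :
    pd j (word w) = 0 := by
  induction w with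
  | nil => exact pd_one j
  | cons k w ih =>
    simp only [List.mem_cons, not_or] at h
    have : word (k :: w) = gen k * word w := by simp [word]
    rw [this, pd_gen_mul, if_neg h.1, ih h.2]; simp

theorem word_eq_zero (w : List (Fin q ⊕ Fin q)) (h : ¬ w.Nodup) : word w = 0 := by
  have : word w = ExteriorAlgebra.ιMulti ℂ w.length
      (fun i => (Pi.single (w.get i) 1 : Fin q ⊕ Fin q → ℂ)) := by
    rw [ExteriorAlgebra.ιMulti_apply, word]
    congr 1
    apply List.ext_getElem <;> simp [gen]
  rw [this]
  apply AlternatingMap.map_eq_zero_of_not_injective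
  intro hi
  exact h (List.nodup_iff_injective_get.2 fun a b hab => hi (by simp only [hab]))

theorem word_append (v w : List (Fin q ⊕ Fin q)) : word (v ++ w) = word v * word w := by
  simp [word]

theorem pd_prod_eq_zero (j : Fin q ⊕ Fin q) (l : List (Fin q)) (x : Grassmann q)
    (h : pd j x = 0) :
    pd j ((l.map fun i => pd (Sum.inl i) * pd (Sum.inr i)).prod x) = 0 := by
  induction l with
  | nil => simpa using h
  | cons i l ih =>
    simp only [List.map_cons, List.prod_cons, Module.End.mul_apply]
    rw [pd_comm j, pd_comm j, ih]; simp

theorem prod_pd_eq_zero (j : Fin q ⊕ Fin q) (l : List (Fin q)) (x : Grassmann q)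
    (h : pd j x = 0) (hj : Sum.elim id id j ∈ l) :
    (l.map fun i => pd (Sum.inl i) * pd (Sum.inr i)).prod x = 0 := by
  induction l with
  | nil => simp at hj
  | cons i l ih =>
    simp only [List.map_cons, List.prod_cons, Module.End.mul_apply]
    by_cases hl : Sum.elim id id j ∈ l
    · rw [ih hl]; simp
    · have h0 := pd_prod_eq_zero j l x h
      have : Sum.elim id id j = i := by simpa [hl] using hj
      rcases j with j | j
      · obtain rfl : j = i := this
        rw [pd_comm, h0]; simp
      · obtain rfl : j = i := this
        rw [h0]; simp

theorem berezin_eq_zero (j : Fin q ⊕ Fin q) (x : Grassmann q) (h : pd j x = 0) :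
    berezin q x = 0 := by
  simp only [berezin, LinearMap.comp_apply]
  rw [prod_pd_eq_zero j _ x h (List.mem_finRange _)]
  simp

/-- `ξ̄_i ξ_i`. -/
noncomputable def pr (i : Fin q) : Grassmann q := xiBar i * xi i

theorem pr_commute (i : Fin q) (x : Grassmann q) : Commute (pr i) x := by
  induction x using ExteriorAlgebra.induction with
  | algebraMap r => exact (Algebra.commutes r _).symm
  | ι m =>
    have h1 := ExteriorAlgebra.ι_add_mul_swap (R := ℂ)
      (Pi.single (Sum.inl i) 1 : Fin q ⊕ Fin q → ℂ) m
    have h2 := ExteriorAlgebra.ι_add_mul_swap (R := ℂ)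
      (Pi.single (Sum.inr i) 1 : Fin q ⊕ Fin q → ℂ) m
    simp only [Commute, SemiconjBy, pr, xi, xiBar, gen]
    rw [mul_assoc, eq_neg_of_add_eq_zero_left h1, mul_neg, ← mul_assoc,
      eq_neg_of_add_eq_zero_left h2, neg_mul, neg_neg, mul_assoc]
  | mul a b ha hb => exact ha.mul_right hb
  | add a b ha hb => exact ha.add_right hb

theorem neg_xi_mul (i : Fin q) : -(xi i * xiBar i) = pr i := by
  have := ExteriorAlgebra.ι_add_mul_swap (R := ℂ)
      (Pi.single (Sum.inl i) 1 : Fin q ⊕ Fin q → ℂ) (Pi.single (Sum.inr i) 1)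
  simp only [pr, xi, xiBar, gen]
  rw [eq_neg_of_add_eq_zero_left this, neg_neg]

theorem negXiXiBar_eq : negXiXiBar q = ∑ i : Fin q, pr i := by
  simp only [negXiXiBar, ← Finset.sum_neg_distrib, neg_xi_mul]

theorem pr_prod_eq_word (l : List (Fin q)) :
    (l.map pr).prod = word (l.flatMap fun i => [Sum.inr i, Sum.inl i]) := by
  induction l with
  | nil => simp [word]
  | cons i l ih =>
    rw [List.map_cons, List.prod_cons, ih, List.flatMap_cons, word_append]
    simp [word, pr, xi, xiBar]

theorem xiStar_mul_xiProd_list (l : List (Fin q)) :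
    (l.reverse.map xiBar).prod * (l.map xi).prod = (l.map pr).prod := by
  induction l with
  | nil => simp
  | cons i l ih =>
    simp only [List.reverse_cons, List.map_append, List.prod_append, List.map_cons, List.map_nil,
      List.prod_cons, List.prod_nil, mul_one]
    rw [mul_assoc, ← mul_assoc (xiBar i), ← ih]
    change _ * (pr i * _) = _
    rw [← mul_assoc, ← mul_assoc, (pr_commute i _).eq]

theorem xiStar_mul_xiProd (M : Finset (Fin q)) :
    xiStar M * xiProd M = ((M.sort (· ≤ ·)).map pr).prod :=
  xiStar_mul_xiProd_list _

theorem pd_pd_pr_mul (i : Fin q) (j : Fin q) (x : Grassmann q) (h : i ≠ j) :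
    pd (Sum.inl i) (pd (Sum.inr i) (pr j * x)) =
      pr j * pd (Sum.inl i) (pd (Sum.inr i) x) := by
  simp [pr, xi, xiBar, mul_assoc, pd_gen_mul, h]

theorem pd_pr_prod_comm (l : List (Fin q)) (j : Fin q) (h : j ∉ l) (x : Grassmann q) :
    (l.map fun i => pd (Sum.inl i) * pd (Sum.inr i)).prod (pr j * x) =
      pr j * (l.map fun i => pd (Sum.inl i) * pd (Sum.inr i)).prod x := by
  induction l with
  | nil => simp
  | cons i l ih =>
    simp only [List.mem_cons, not_or] at h
    simp only [List.map_cons, List.prod_cons, Module.End.mul_apply]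
    rw [ih h.2, pd_pd_pr_mul _ _ _ (Ne.symm h.1)]

theorem pd_prod_pr_prod (l : List (Fin q)) (h : l.Nodup) :
    (l.map fun i => pd (Sum.inl i) * pd (Sum.inr i)).prod ((l.map pr).prod : Grassmann q) = 1 := by
  induction l with
  | nil => simp
  | cons i l ih =>
    simp only [List.nodup_cons] at h
    simp only [List.map_cons, List.prod_cons, Module.End.mul_apply]
    rw [pd_pr_prod_comm _ _ h.1, ih h.2]
    simp [pr, xi, xiBar, pd_gen_mul, pd_gen]

theorem berezin_pr_prod (l : List (Fin q)) (h : l.Nodup) :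
    berezin q (l.map pr).prod = if l.length = q then 1 else 0 := by
  split_ifs with hl
  · have hmem : ∀ i, i ∈ l := by
      have : l.toFinset = Finset.univ := by
        apply Finset.eq_univ_of_card
        rw [List.toFinset_card_of_nodup h, hl, Fintype.card_fin]
      intro i
      have := this ▸ Finset.mem_univ i
      simpa using this
    have hp : l.Perm (List.finRange q) :=
      (List.perm_ext_iff_of_nodup h (List.nodup_finRange q)).2 fun a => by simp [hmem]
    have : (l.map pr).prod = ((List.finRange q).map (pr (q := q))).prod := by
      apply (hp.map _).prod_eq'
      rw [List.pairwise_map]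
      exact List.pairwise_iff_getElem.2 fun _ _ _ _ _ => pr_commute _ _
    rw [this, berezin, LinearMap.comp_apply, pd_prod_pr_prod _ (List.nodup_finRange q)]
    simp
  · have : ∃ i, i ∉ l := by
      by_contra! hc
      apply hl
      rw [← List.toFinset_card_of_nodup h]
      have : l.toFinset = Finset.univ := by ext i; simp [hc]
      rw [this]; simp
    obtain ⟨i, hi⟩ := this
    rw [pr_prod_eq_word]
    apply berezin_eq_zero (Sum.inl i)
    apply pd_word
    simpa using hi

theorem berezin_pow_pr_prod (k : ℕ) (l : List (Fin q)) (h : l.Nodup) :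
    berezin q (negXiXiBar q ^ k * (l.map pr).prod) =
      if k + l.length = q then (k.factorial : ℂ) else 0 := by
  induction k generalizing l with
  | zero => simpa using berezin_pr_prod l h
  | succ k ih =>
    have h1 : ∀ i : Fin q, berezin q (negXiXiBar q ^ k * (pr i * (l.map pr).prod)) =
        if i ∈ l then 0 else if k + 1 + l.length = q then (k.factorial : ℂ) else 0 := by
      intro i
      have e : pr i * (l.map pr).prod = ((i :: l).map pr).prod := by simp
      rw [e]
      by_cases hi : i ∈ l
      · rw [if_pos hi, pr_prod_eq_word, word_eq_zero, mul_zero, map_zero]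
        intro hn
        simp [List.flatMap_cons, hi] at hn
      · rw [if_neg hi, ih (i :: l) (List.nodup_cons.2 ⟨hi, h⟩)]
        simp only [List.length_cons]
        congr 1
        simp only [eq_iff_iff]; omega
    rw [pow_succ, mul_assoc]
    nth_rewrite 2 [negXiXiBar_eq]
    rw [Finset.sum_mul, Finset.mul_sum, map_sum, Finset.sum_congr rfl fun i _ => h1 i]
    split_ifs with hq
    · have e : ∀ i : Fin q, (if i ∈ l then (0 : ℂ) else (k.factorial : ℂ)) =
          if i ∉ l then (k.factorial : ℂ) else 0 := fun i => by split_ifs <;> simp_all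
      rw [Finset.sum_congr rfl fun i _ => e i, ← Finset.sum_filter, Finset.sum_const,
        nsmul_eq_mul, Nat.factorial_succ]
      push_cast
      congr 1
      have : (Finset.univ.filter fun i => i ∉ l) = l.toFinsetᶜ := by ext i; simp
      rw [this, Finset.card_compl, List.toFinset_card_of_nodup h, Fintype.card_fin]
      have : q - l.length = k + 1 := by omega
      rw [this]; push_cast; rfl
    · simp

theorem xiProd_eq_word (M : Finset (Fin q)) :
    xiProd M = word ((M.sort (· ≤ ·)).map Sum.inl) := by
  rw [xiProd, word, List.map_map]; rfl

theorem xiStar_eq_word (M : Finset (Fin q)) :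
    xiStar M = word ((M.sort (· ≤ ·)).reverse.map Sum.inr) := by
  rw [xiStar, word, List.map_map]; rfl

theorem berezin_pow_off (k : ℕ) (l : List (Fin q)) (M N : Finset (Fin q)) (h : M ≠ N) :
    berezin q (negXiXiBar q ^ k * ((l.map pr).prod * (xiStar M * xiProd N))) = 0 := by
  induction k generalizing l with
  | zero =>
    rw [pow_zero, one_mul, pr_prod_eq_word, xiStar_eq_word, xiProd_eq_word, ← word_append,
      ← word_append]
    have : ∃ i, (i ∈ M ∧ i ∉ N) ∨ (i ∈ N ∧ i ∉ M) := by
      by_contra! hc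
      exact h (Finset.ext fun i => ⟨fun a => (hc i).1 a, fun a => (hc i).2 a⟩)
    obtain ⟨i, hi⟩ := this
    by_cases hl : i ∈ l
    · rw [word_eq_zero, map_zero]
      intro hn
      rw [List.nodup_append] at hn
      have h3 := hn.2.2
      rcases hi with hi | hi
      · exact h3 (Sum.inr i) (by simpa using hl) (Sum.inr i) (by simp [hi.1]) rfl
      · exact h3 (Sum.inl i) (by simpa using hl) (Sum.inl i) (by simp [hi.1]) rfl
    · rcases hi with hi | hi
      · exact berezin_eq_zero (Sum.inl i) _ (pd_word _ _ (by simp [hl, hi.2]))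
      · exact berezin_eq_zero (Sum.inr i) _ (pd_word _ _ (by simp [hl, hi.2]))
  | succ k ih =>
    rw [pow_succ, mul_assoc]
    nth_rewrite 2 [negXiXiBar_eq]
    rw [Finset.sum_mul, Finset.mul_sum, map_sum]
    apply Finset.sum_eq_zero
    intro i _
    have := ih (i :: l)
    rwa [List.map_cons, List.prod_cons, mul_assoc] at this

/-- The normalization of the Berezin integral. -/
theorem berezin_top : berezin q (xiStar Finset.univ * xiProd Finset.univ) = 1 := by
  rw [xiStar_mul_xiProd, berezin_pr_prod _ (Finset.sort_nodup _ _)]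
  simp

theorem berezin_superPow (x a : ℝ) (M N : Finset (Fin q)) :
    berezin q (superPow q x a * (xiStar M * xiProd N)) =
      if M = N then
        (((descPochhammer ℝ (q - M.card)).eval a * x ^ (a - ((q - M.card : ℕ) : ℝ)) : ℝ) : ℂ)
      else 0 := by
  rw [superPow, Finset.sum_mul, map_sum]
  split_ifs with h
  · subst h
    have hM : M.card ≤ q := by simpa using Finset.card_le_univ M
    rw [Finset.sum_eq_single (q - M.card)]
    · rw [smul_mul_assoc, map_smul, xiStar_mul_xiProd,
        berezin_pow_pr_prod _ _ (Finset.sort_nodup _ _), if_pos (by simp; omega), smul_eq_mul]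
      have : ((q - M.card).factorial : ℂ) ≠ 0 := by exact_mod_cast Nat.factorial_ne_zero _
      push_cast
      field_simp
    · intro k _ hk
      rw [smul_mul_assoc, map_smul, xiStar_mul_xiProd,
        berezin_pow_pr_prod _ _ (Finset.sort_nodup _ _), if_neg (by simp; omega), smul_zero]
    · intro hn
      exact absurd (Finset.mem_range.2 (by omega)) hn
  · apply Finset.sum_eq_zero
    intro k _
    have := berezin_pow_off k [] M N h
    rw [List.map_nil, List.prod_nil, one_mul] at this
    rw [smul_mul_assoc, map_smul, this, smul_zero]

end Algebra

section Space

variable {p q : ℕ}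

/-- The open unit ball of `ℂ^p`. -/
def unitBall (p : ℕ) : Set (Fin p → ℂ) := {z | ∑ k, ‖z k‖ ^ 2 < 1}

/-- The base `τ(𝔹^p)` of the unit ball, viewed as a Reinhardt domain. -/
def ballBase (p : ℕ) : Set (Fin p → ℝ) := {r | (∀ k, 0 ≤ r k) ∧ ∑ k, r k ^ 2 < 1}

/-- Coefficients `Ψ_M` of `Ψ = ∑_M Ψ_M ξ_M`. -/
abbrev SuperHol (p q : ℕ) : Type := Finset (Fin q) → (Fin p → ℂ) → ℂ

/-- Coefficients `F_{I,J}` of `F = ∑_{I,J} F_{I,J} ξ_I ξ_J^*`. -/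
abbrev SuperFunction (p q : ℕ) : Type :=
  Finset (Fin q) → Finset (Fin q) → (Fin p → ℂ) → ℂ

/-- The Grassmann-valued function `∑_M Ψ_M ξ_M`. -/
noncomputable def SuperHol.val (Ψ : SuperHol p q) (z : Fin p → ℂ) : Grassmann q :=
  ∑ M, Ψ M z • xiProd M

/-- The conjugate `Ψ^* = ∑_M conj(Ψ_M) ξ_M^*`. -/
noncomputable def SuperHol.starVal (Ψ : SuperHol p q) (z : Fin p → ℂ) : Grassmann q :=
  ∑ M, (starRingEnd ℂ) (Ψ M z) • xiStar M

/-- The Grassmann-valued function `∑_{I,J} F_{I,J} ξ_I ξ_J^*`. -/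
noncomputable def SuperFunction.val (F : SuperFunction p q) (z : Fin p → ℂ) : Grassmann q :=
  ∑ I, ∑ J, F I J z • (xiProd I * xiStar J)

/-- The weight `(1 - z z̄ - ξ ξ̄)^(ν + q - p - 1)`. -/
noncomputable def superWeight (p q : ℕ) (ν : ℝ) (z : Fin p → ℂ) : Grassmann q :=
  superPow q (1 - ∑ k, ‖z k‖ ^ 2) (ν + q - p - 1)

/-- The result of integrating out the odd variables in
`∫ dz dξ (1 - z z̄ - ξ ξ̄)^(ν + q - p - 1) Θ^* G`. -/
noncomputable def superIntegrand (ν : ℝ) (Θ : SuperHol p q) (G : (Fin p → ℂ) → Grassmann q)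
    (z : Fin p → ℂ) : ℂ :=
  berezin q (superWeight p q ν z * (Θ.starVal z * G z))

/-- The pairing
`(Θ | G) = Γ(ν) / (π^p Γ(ν + q - p)) ∫ dz dξ (1 - z z̄ - ξ ξ̄)^(ν + q - p - 1) Θ^* G`. -/
noncomputable def superPairing (ν : ℝ) (Θ : SuperHol p q) (G : (Fin p → ℂ) → Grassmann q) : ℂ :=
  ((Real.Gamma ν / (Real.pi ^ p * Real.Gamma (ν + q - p)) : ℝ) : ℂ) *
    ∫ z in unitBall p, superIntegrand ν Θ G z

/-- Membership in the super Bergman space: holomorphic coefficients on the ball (extended by zero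
to `ℂ^p`, so that equal functions on the ball are equal) and square integrability. -/
structure IsSuperBergman (ν : ℝ) (Ψ : SuperHol p q) : Prop where
  holo : ∀ M, DifferentiableOn ℂ (Ψ M) (unitBall p)
  support : ∀ M, ∀ z ∉ unitBall p, Ψ M z = 0
  integrable : IntegrableOn (superIntegrand ν Ψ Ψ.val) (unitBall p)

/-- The scalar weight belonging to the component `ξ_M`. -/
noncomputable def compWeight (p q : ℕ) (ν : ℝ) (M : Finset (Fin q)) (z : Fin p → ℂ) : ℝ :=
  (descPochhammer ℝ (q - M.card)).eval (ν + q - p - 1) *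
    (1 - ∑ k, ‖z k‖ ^ 2) ^ (ν + q - p - 1 - ((q - M.card : ℕ) : ℝ))

theorem superIntegrand_val (ν : ℝ) (Θ Φ : SuperHol p q) (z : Fin p → ℂ) :
    superIntegrand ν Θ Φ.val z =
      ∑ M, (compWeight p q ν M z : ℂ) * ((starRingEnd ℂ) (Θ M z) * Φ M z) := by
  simp only [superIntegrand, SuperHol.starVal, SuperHol.val, Finset.sum_mul, Finset.mul_sum,
    map_sum, smul_mul_assoc, mul_smul_comm, map_smul, superWeight, berezin_superPow, smul_eq_mul]
  refine Finset.sum_congr rfl fun M _ => ?_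
  rw [Finset.sum_eq_single M]
  · rw [if_pos rfl, compWeight]; ring
  · intro N _ h
    simp [h]
  · simp

theorem isOpen_unitBall (p : ℕ) : IsOpen (unitBall p) :=
  isOpen_lt (by fun_prop) continuous_const

theorem compWeight_pos {ν : ℝ} (hν : (p : ℝ) < ν) (M : Finset (Fin q)) {z : Fin p → ℂ}
    (hz : z ∈ unitBall p) : 0 < compWeight p q ν M z := by
  have hz' : 0 < 1 - ∑ k, ‖z k‖ ^ 2 := sub_pos.2 hz
  refine mul_pos (descPochhammer_pos ?_) (Real.rpow_pos_of_pos hz' _)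
  have : ((q - M.card : ℕ) : ℝ) ≤ q := by exact_mod_cast Nat.sub_le _ _
  linarith

theorem continuousOn_compWeight (ν : ℝ) (M : Finset (Fin q)) :
    ContinuousOn (compWeight p q ν M) (unitBall p) := by
  refine continuousOn_const.mul (ContinuousOn.rpow_const (by fun_prop) fun z hz => Or.inl ?_)
  exact (sub_pos.2 hz).ne'

theorem continuousOn_term (ν : ℝ) (M : Finset (Fin q)) {f g : (Fin p → ℂ) → ℂ}
    (hf : ContinuousOn f (unitBall p)) (hg : ContinuousOn g (unitBall p)) :
    ContinuousOn (fun z => (compWeight p q ν M z : ℂ) * ((starRingEnd ℂ) (f z) * g z))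
      (unitBall p) := by
  have h1 := continuousOn_compWeight (p := p) ν M
  have h2 : ContinuousOn (fun z => (starRingEnd ℂ) (f z)) (unitBall p) :=
    Complex.continuous_conj.comp_continuousOn hf
  exact (Complex.continuous_ofReal.comp_continuousOn h1).mul (h2.mul hg)

theorem term_self (w : ℝ) (a : ℂ) :
    (w : ℂ) * ((starRingEnd ℂ) a * a) = ((w * ‖a‖ ^ 2 : ℝ) : ℂ) := by
  rw [← Complex.normSq_eq_conj_mul_self, Complex.normSq_eq_norm_sq]; push_cast; ring

theorem integrableOn_self_iff {ν : ℝ} (hν : (p : ℝ) < ν) {Ψ : SuperHol p q}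
    (h : ∀ M, ContinuousOn (Ψ M) (unitBall p)) :
    IntegrableOn (superIntegrand ν Ψ Ψ.val) (unitBall p) ↔
      ∀ M, IntegrableOn (fun z => compWeight p q ν M z * ‖Ψ M z‖ ^ 2) (unitBall p) := by
  have hm : MeasurableSet (unitBall p) := (isOpen_unitBall p).measurableSet
  have e : superIntegrand ν Ψ Ψ.val =
      fun z => ((∑ M, compWeight p q ν M z * ‖Ψ M z‖ ^ 2 : ℝ) : ℂ) := by
    funext z
    rw [superIntegrand_val]; push_cast
    refine Finset.sum_congr rfl fun M _ => ?_
    rw [term_self]; push_cast; rfl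
  rw [e]
  constructor
  · intro hi M
    have hi' : IntegrableOn (fun z => ∑ M, compWeight p q ν M z * ‖Ψ M z‖ ^ 2) (unitBall p) := by
      have := hi.re
      simp only [RCLike.re_eq_complex_re, Complex.ofReal_re] at this
      exact this
    refine Integrable.mono' hi' ?_ ?_
    · exact ((continuousOn_compWeight ν M).mul ((h M).norm.pow 2)).aestronglyMeasurable hm
    · refine (ae_restrict_iff' hm).2 (Filter.Eventually.of_forall fun z hz => ?_)
      have hp : ∀ N, 0 ≤ compWeight p q ν N z * ‖Ψ N z‖ ^ 2 := fun N =>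
        mul_nonneg (compWeight_pos hν N hz).le (sq_nonneg _)
      rw [Real.norm_of_nonneg (hp M)]
      exact Finset.single_le_sum (f := fun N => compWeight p q ν N z * ‖Ψ N z‖ ^ 2)
        (fun N _ => hp N) (Finset.mem_univ M)
  · intro hi
    exact (integrable_finsetSum Finset.univ fun M _ => hi M).ofReal

theorem IsSuperBergman.comp {ν : ℝ} (hν : (p : ℝ) < ν) {Ψ : SuperHol p q}
    (h : IsSuperBergman ν Ψ) (M : Finset (Fin q)) :
    IntegrableOn (fun z => compWeight p q ν M z * ‖Ψ M z‖ ^ 2) (unitBall p) :=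
  (integrableOn_self_iff hν fun M => (h.holo M).continuousOn).1 h.integrable M

theorem IsSuperBergman.integrable_term {ν : ℝ} (hν : (p : ℝ) < ν) {Θ Φ : SuperHol p q}
    (hΘ : IsSuperBergman ν Θ) (hΦ : IsSuperBergman ν Φ) (M : Finset (Fin q)) :
    IntegrableOn (fun z => (compWeight p q ν M z : ℂ) * ((starRingEnd ℂ) (Θ M z) * Φ M z))
      (unitBall p) := by
  have hm : MeasurableSet (unitBall p) := (isOpen_unitBall p).measurableSet
  refine Integrable.mono' ((hΘ.comp hν M).add (hΦ.comp hν M)) ?_ ?_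
  · exact (continuousOn_term ν M (hΘ.holo M).continuousOn
      (hΦ.holo M).continuousOn).aestronglyMeasurable hm
  · refine (ae_restrict_iff' hm).2 (Filter.Eventually.of_forall fun z hz => ?_)
    have hw := (compWeight_pos hν M hz).le
    simp only [norm_mul, Complex.norm_real, Real.norm_of_nonneg hw, RCLike.norm_conj, Pi.add_apply]
    rw [← mul_add]
    refine mul_le_mul_of_nonneg_left ?_ hw
    nlinarith [sq_nonneg (‖Θ M z‖ - ‖Φ M z‖), sq_nonneg ‖Θ M z‖, sq_nonneg ‖Φ M z‖]

theorem IsSuperBergman.integrable_pair {ν : ℝ} (hν : (p : ℝ) < ν) {Θ Φ : SuperHol p q}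
    (hΘ : IsSuperBergman ν Θ) (hΦ : IsSuperBergman ν Φ) :
    IntegrableOn (superIntegrand ν Θ Φ.val) (unitBall p) := by
  have e : superIntegrand ν Θ Φ.val = fun z =>
      ∑ M, (compWeight p q ν M z : ℂ) * ((starRingEnd ℂ) (Θ M z) * Φ M z) :=
    funext fun z => superIntegrand_val ν Θ Φ z
  rw [e]
  exact integrable_finsetSum Finset.univ fun M _ => hΘ.integrable_term hν hΦ M

theorem superIntegrand_add_right (ν : ℝ) (Θ Φ Φ' : SuperHol p q) (z : Fin p → ℂ) :
    superIntegrand ν Θ (Φ + Φ').val z =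
      superIntegrand ν Θ Φ.val z + superIntegrand ν Θ Φ'.val z := by
  simp only [superIntegrand_val, Pi.add_apply, mul_add, Finset.sum_add_distrib]

theorem superIntegrand_add_left (ν : ℝ) (Θ Θ' Φ : SuperHol p q) (z : Fin p → ℂ) :
    superIntegrand ν (Θ + Θ') Φ.val z =
      superIntegrand ν Θ Φ.val z + superIntegrand ν Θ' Φ.val z := by
  simp only [superIntegrand_val, Pi.add_apply, map_add, mul_add, add_mul, Finset.sum_add_distrib]

theorem superIntegrand_smul_right (ν : ℝ) (c : ℂ) (Θ Φ : SuperHol p q) (z : Fin p → ℂ) :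
    superIntegrand ν Θ (c • Φ).val z = c * superIntegrand ν Θ Φ.val z := by
  simp only [superIntegrand_val, Pi.smul_apply, smul_eq_mul, Finset.mul_sum]
  exact Finset.sum_congr rfl fun M _ => by ring

theorem superIntegrand_smul_left (ν : ℝ) (c : ℂ) (Θ Φ : SuperHol p q) (z : Fin p → ℂ) :
    superIntegrand ν (c • Θ) Φ.val z = (starRingEnd ℂ) c * superIntegrand ν Θ Φ.val z := by
  simp only [superIntegrand_val, Pi.smul_apply, smul_eq_mul, Finset.mul_sum, map_mul]
  exact Finset.sum_congr rfl fun M _ => by ring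

theorem superIntegrand_conj (ν : ℝ) (Θ Φ : SuperHol p q) (z : Fin p → ℂ) :
    (starRingEnd ℂ) (superIntegrand ν Φ Θ.val z) = superIntegrand ν Θ Φ.val z := by
  simp only [superIntegrand_val, map_sum, map_mul, Complex.conj_conj, Complex.conj_ofReal]
  exact Finset.sum_congr rfl fun M _ => by ring

theorem superConst_pos {ν : ℝ} (hν : (p : ℝ) < ν) :
    0 < Real.Gamma ν / (Real.pi ^ p * Real.Gamma (ν + q - p)) := by
  have h0 : (0 : ℝ) ≤ p := Nat.cast_nonneg p
  have h1 : (0 : ℝ) ≤ q := Nat.cast_nonneg q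
  exact div_pos (Real.Gamma_pos_of_pos (by linarith))
    (mul_pos (pow_pos Real.pi_pos _) (Real.Gamma_pos_of_pos (by linarith)))

/-- The super Bergman space `H²_ν(𝔹^{p|q})` as a space of functions. -/
def superBergmanSubmodule (p q : ℕ) (ν : ℝ) (hν : (p : ℝ) < ν) :
    Submodule ℂ (SuperHol p q) where
  carrier := {Ψ | IsSuperBergman ν Ψ}
  add_mem' := by
    intro a b ha hb
    refine ⟨fun M => (ha.holo M).add (hb.holo M), fun M z hz => ?_, ?_⟩
    · simp [ha.support M z hz, hb.support M z hz]
    · have e : superIntegrand ν (a + b) (a + b).val = fun z =>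
          (superIntegrand ν a a.val z + superIntegrand ν b a.val z) +
          (superIntegrand ν a b.val z + superIntegrand ν b b.val z) := by
        funext z
        rw [superIntegrand_add_right, superIntegrand_add_left, superIntegrand_add_left]
      rw [e]
      exact ((ha.integrable_pair hν ha).add (hb.integrable_pair hν ha)).add
        ((ha.integrable_pair hν hb).add (hb.integrable_pair hν hb))
  zero_mem' := by
    refine ⟨fun M => differentiableOn_const 0, fun M z _ => rfl, ?_⟩
    have e : superIntegrand ν (0 : SuperHol p q) (0 : SuperHol p q).val = fun _ => 0 := by
      funext z; rw [superIntegrand_val]; simp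
    rw [e]
    exact integrableOn_zero
  smul_mem' := by
    intro c a ha
    refine ⟨fun M => (ha.holo M).const_smul c, fun M z hz => ?_, ?_⟩
    · simp [ha.support M z hz]
    · have e : superIntegrand ν (c • a) (c • a).val = fun z =>
          c * ((starRingEnd ℂ) c * superIntegrand ν a a.val z) := by
        funext z
        rw [superIntegrand_smul_right, superIntegrand_smul_left]
      rw [e]
      exact (Integrable.const_mul (Integrable.const_mul ha.integrable _) _)

/-- The super Bergman space `H²_ν(𝔹^{p|q})`, `ν > p`; it carries the norm and inner product of
`superPairing` and not the topology of pointwise convergence. -/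
def SuperBergman (p q : ℕ) (ν : ℝ) (hν : (p : ℝ) < ν) : Type :=
  superBergmanSubmodule p q ν hν

noncomputable instance (p q : ℕ) (ν : ℝ) (hν : (p : ℝ) < ν) :
    AddCommGroup (SuperBergman p q ν hν) :=
  inferInstanceAs (AddCommGroup (superBergmanSubmodule p q ν hν))

noncomputable instance (p q : ℕ) (ν : ℝ) (hν : (p : ℝ) < ν) :
    Module ℂ (SuperBergman p q ν hν) :=
  inferInstanceAs (Module ℂ (superBergmanSubmodule p q ν hν))

/-- The coefficient functions of an element of the super Bergman space. -/
def SuperBergman.coeff {ν : ℝ} {hν : (p : ℝ) < ν} (Ψ : SuperBergman p q ν hν) : SuperHol p q :=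
  Subtype.val Ψ

theorem SuperBergman.isSuperBergman {ν : ℝ} {hν : (p : ℝ) < ν} (Ψ : SuperBergman p q ν hν) :
    IsSuperBergman ν Ψ.coeff :=
  Subtype.property Ψ

theorem superPairing_self_eq {ν : ℝ} (hν : (p : ℝ) < ν) {Ψ : SuperHol p q}
    (h : IsSuperBergman ν Ψ) :
    superPairing ν Ψ Ψ.val =
      ((Real.Gamma ν / (Real.pi ^ p * Real.Gamma (ν + q - p)) *
        ∑ M, ∫ z in unitBall p, compWeight p q ν M z * ‖Ψ M z‖ ^ 2 : ℝ) : ℂ) := by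
  rw [superPairing, Complex.ofReal_mul]
  congr 1
  rw [← integral_finsetSum _ fun M _ => h.comp hν M, ← integral_complex_ofReal]
  congr 1
  funext z
  rw [superIntegrand_val]; push_cast
  refine Finset.sum_congr rfl fun M _ => ?_
  rw [term_self]; push_cast; rfl

theorem compNorm_nonneg {ν : ℝ} (hν : (p : ℝ) < ν) (Ψ : SuperHol p q) (M : Finset (Fin q)) :
    0 ≤ ∫ z in unitBall p, compWeight p q ν M z * ‖Ψ M z‖ ^ 2 :=
  setIntegral_nonneg (isOpen_unitBall p).measurableSet fun _ hz =>
    mul_nonneg (compWeight_pos hν M hz).le (sq_nonneg _)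

theorem eq_zero_of_superPairing {ν : ℝ} (hν : (p : ℝ) < ν) {Ψ : SuperHol p q}
    (h : IsSuperBergman ν Ψ) (h0 : superPairing ν Ψ Ψ.val = 0) : Ψ = 0 := by
  have hm : MeasurableSet (unitBall p) := (isOpen_unitBall p).measurableSet
  rw [superPairing_self_eq hν h, Complex.ofReal_eq_zero, mul_eq_zero,
    or_iff_right (superConst_pos hν).ne',
    Finset.sum_eq_zero_iff_of_nonneg fun M _ => compNorm_nonneg hν Ψ M] at h0
  funext M z
  by_cases hz : z ∈ unitBall p
  · have h1 := h0 M (Finset.mem_univ M)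
    rw [setIntegral_eq_zero_iff_of_nonneg_ae ((ae_restrict_iff' hm).2
      (Filter.Eventually.of_forall fun z hz =>
        mul_nonneg (compWeight_pos hν M hz).le (sq_nonneg _))) (h.comp hν M)] at h1
    have h2 := Measure.eqOn_open_of_ae_eq h1 (isOpen_unitBall p)
      ((continuousOn_compWeight ν M).mul ((h.holo M).continuousOn.norm.pow 2)) continuousOn_const
    have h3 := h2 hz
    simpa [(compWeight_pos hν M hz).ne'] using h3
  · exact h.support M z hz

/-- The inner product `(Θ | Φ)` of the super Bergman space, conjugate linear in `Θ`. -/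
@[reducible]
noncomputable def superBergmanCore (p q : ℕ) (ν : ℝ) (hν : (p : ℝ) < ν) :
    InnerProductSpace.Core ℂ (SuperBergman p q ν hν) where
  inner Θ Φ := superPairing ν Θ.coeff Φ.coeff.val
  conj_inner_symm Θ Φ := by
    simp only [superPairing, map_mul, Complex.conj_ofReal, ← integral_conj, superIntegrand_conj]
  re_inner_nonneg Ψ := by
    rw [superPairing_self_eq hν Ψ.isSuperBergman]
    rw [RCLike.re_eq_complex_re, Complex.ofReal_re]
    exact mul_nonneg (superConst_pos hν).le
      (Finset.sum_nonneg fun M _ => compNorm_nonneg hν _ M)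
  add_left Θ Θ' Φ := by
    rw [superPairing, superPairing, superPairing, ← mul_add, ← integral_add
      (Θ.isSuperBergman.integrable_pair hν Φ.isSuperBergman)
      (Θ'.isSuperBergman.integrable_pair hν Φ.isSuperBergman)]
    congr 2
    funext z
    exact superIntegrand_add_left ν _ _ _ z
  smul_left Θ Φ c := by
    have e : ∀ z, superIntegrand ν (c • Θ).coeff Φ.coeff.val z =
        (starRingEnd ℂ) c * superIntegrand ν Θ.coeff Φ.coeff.val z :=
      superIntegrand_smul_left ν c _ _
    simp only [superPairing, e, integral_const_mul]
    ring
  definite Ψ h := Subtype.ext (eq_zero_of_superPairing hν Ψ.isSuperBergman h)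

noncomputable instance (p q : ℕ) (ν : ℝ) (hν : (p : ℝ) < ν) :
    NormedAddCommGroup (SuperBergman p q ν hν) :=
  (superBergmanCore p q ν hν).toNormedAddCommGroup

noncomputable instance (p q : ℕ) (ν : ℝ) (hν : (p : ℝ) < ν) :
    InnerProductSpace ℂ (SuperBergman p q ν hν) :=
  InnerProductSpace.ofCore (superBergmanCore p q ν hν).toCore

theorem SuperBergman.inner_eq {ν : ℝ} {hν : (p : ℝ) < ν} (Θ Φ : SuperBergman p q ν hν) :
    inner ℂ Θ Φ = superPairing ν Θ.coeff Φ.coeff.val := rfl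

end Space

section Toeplitz

variable {p q : ℕ}

/-- Bounded measurable super functions on the super ball. -/
def IsBoundedMeasurable (F : SuperFunction p q) : Prop :=
  ∀ I J, Measurable (fun z : unitBall p => F I J z) ∧ ∃ C : ℝ, ∀ z ∈ unitBall p, ‖F I J z‖ ≤ C

/-- The action `ξ_k ↦ s_k ξ_k`, `ξ̄_k ↦ s̄_k ξ̄_k` of the torus `𝕋^q` on the Grassmann algebra. -/
noncomputable def oddRotation (s : Fin q → Circle) : Grassmann q →ₐ[ℂ] Grassmann q :=
  ExteriorAlgebra.map (LinearMap.pi fun j : Fin q ⊕ Fin q =>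
    (Sum.elim (fun k => (s k : ℂ)) (fun k => (starRingEnd ℂ) (s k : ℂ)) j) •
      (LinearMap.proj j : (Fin q ⊕ Fin q → ℂ) →ₗ[ℂ] ℂ))

/-- Invariance of a super function under the quasi-elliptic group `𝕋^{p+q}` acting by
`(z, ξ) ↦ (t z, s ξ)`. -/
def IsQuasiElliptic (F : SuperFunction p q) : Prop :=
  ∀ (t : Fin p → Circle) (s : Fin q → Circle), ∀ z ∈ unitBall p,
    oddRotation s (F.val fun k => (t k : ℂ) * z k) = F.val z

/-- `T` is the super Toeplitz operator with symbol `F`: `T Ψ` is the orthogonal projection of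
`F Ψ` onto the super Bergman space, that is `T Ψ` belongs to this space and
`(Θ | T Ψ) = (Θ | F Ψ)` for all its elements `Θ`. -/
def IsSuperToeplitz {ν : ℝ} {hν : (p : ℝ) < ν} (F : SuperFunction p q)
    (T : SuperBergman p q ν hν →L[ℂ] SuperBergman p q ν hν) : Prop :=
  ∀ Θ Ψ : SuperBergman p q ν hν,
    IntegrableOn (superIntegrand ν Θ.coeff fun z => F.val z * Ψ.coeff.val z) (unitBall p) ∧
    inner ℂ Θ (T Ψ) = superPairing ν Θ.coeff fun z => F.val z * Ψ.coeff.val z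

/-- The density of the probability measure `μ_λ` on the unit ball, `λ > p`. -/
noncomputable def ballDensity (p : ℕ) (lam : ℝ) (z : Fin p → ℂ) : ℝ :=
  Real.Gamma lam / (Real.pi ^ p * Real.Gamma (lam - p)) *
    (1 - ∑ k, ‖z k‖ ^ 2) ^ (lam - p - 1)

/-- The entry with index `(M, n)` of the super Bargmann transform `R_{ν,(p|q)} Ψ`. -/
noncomputable def superBargmann (ν : ℝ) (Ψ : SuperHol p q) (M : Finset (Fin q))
    (n : Fin p → ℕ) : ℂ :=
  (((2 * Real.pi) ^ (-(p : ℝ) / 2) *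
    Real.sqrt ((2 * Real.pi) ^ p * Real.Gamma ((∑ k, n k : ℕ) + ν + M.card) /
      ((∏ k, (n k).factorial : ℕ) * Real.Gamma (ν + M.card))) : ℝ) : ℂ) *
    ∫ z in unitBall p, Ψ M z * (starRingEnd ℂ) (∏ k, z k ^ n k) *
      (ballDensity p (ν + M.card) z : ℂ)

/-- The inner product of `(ℓ²(ℤ_+^p))^{2^q}`, conjugate linear in `a`. -/
noncomputable def weightedInner (ν : ℝ)
    (a b : Finset (Fin q) → lp (fun _ : Fin p → ℕ => ℂ) 2) : ℂ :=
  ∑ M, ((Real.Gamma ν / Real.Gamma (ν + M.card) : ℝ) : ℂ) *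
    ∑' n, (starRingEnd ℂ) (a M n) * b M n

/-- The multiplier `γ_{F,ν}(n, M)`, where `F_I(r)` is the coefficient of `ξ_I ξ_I^*` in `F` at the
point `r` of the base of the ball. -/
noncomputable def multiplier (ν : ℝ) (F : SuperFunction p q) (n : Fin p → ℕ)
    (M : Finset (Fin q)) : ℂ :=
  (((2 : ℝ) ^ p * Real.Gamma ((∑ k, n k : ℕ) + ν + M.card) /
      (∏ k, (n k).factorial : ℕ) : ℝ) : ℂ) *
    ∑ K ∈ Finset.univ.filter (fun K => M ⊆ K),
      (((-1) ^ (K \ M).card / Real.Gamma (ν + K.card - p) : ℝ) : ℂ) *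
        ∫ r in ballBase p, F (K \ M) (K \ M) (fun k => (r k : ℂ)) *
          (((∏ k, r k ^ (2 * n k)) * (1 - ∑ k, r k ^ 2) ^ (ν + K.card - p - 1) * ∏ k, r k : ℝ) : ℂ)

end Toeplitz

end SuperBall

namespace SuperBall

/-! ### Fourier coefficients of one-variable holomorphic functions on circles. -/

section Circle

/-! Integrating out the odd variables splits the super pairing into a finite sum over `M` of scalar
weighted Bergman pairings. The component of ξ_M carries the weight (1-|z|²)^(ν+|M|-p-1), up to a
constant: the descending factorial produced by the Berezin integral is absorbed by Γ(ν+q-p)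
(`berezin_superPow`, `const_mul_compWeight`).

In each of these spaces the monomials z^n are a complete orthogonal system. On the torus through z,
a holomorphic f has Fourier coefficients a_n z^n, and none with a negative index (`torusCoeff_eq`,
`torusCoeff_of_neg`). The weight is constant on tori, so Parseval on each torus followed by
integration over the ball gives ‖f‖² = ∑ |a_n|² ‖z^n‖² (`lintegral_norm_sq_weight`), where the norms
of monomials are quotients of Gamma values (`lintegral_unitBall_moment`). The super Bargmann
transform is the sequence a_n ‖z^n‖ (`superBargmann_eq`), hence isometric. It is onto because a
square-summable sequence defines a power series converging on the ball (`summable_norm_monomial`,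
`differentiableOn_powerSeries`). Completeness is transported back from ℓ².

For a quasi-elliptic symbol, torus invariance kills F_{I,J} with I ≠ J and makes F_{I,I} a function
of the moduli. Inserting ξ_I ξ_I^* leaves the form diagonal in M: it vanishes if I meets M, and
otherwise replaces the weight of M by that of K = I ∪ M, with sign (-1)^|I|
(`berezin_superPow_diag`). On the ball the weight of K is at most a multiple of that of M, so (Θ |
FΨ) is a bounded form and Riesz representation gives the operator. Testing against z^n ξ_M isolates
the coefficient a_n times a radial integral, which polar coordinates turn into the multiplier
(`IsSuperToeplitz.taylorCoeff_eq`). All these operators, and their adjoints, are diagonal in the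
same orthogonal system, so they commute, and commutation survives norm closure. -/

theorem norm_fourier (n : ℤ) (y : UnitAddCircle) : ‖fourier n y‖ = 1 := Circle.norm_coe _

/-- Absolute summability allows termwise integration, and orthogonality of characters keeps the
single term k = m; there is none when m is negative. -/
theorem hasSum_fourierCoeff {a : ℕ → ℂ} (ha : Summable fun k => ‖a k‖) {h : UnitAddCircle → ℂ}
    (hh : ∀ y, HasSum (fun k : ℕ => a k * fourier (T := 1) (k : ℤ) y) (h y)) (m : ℤ) :
    fourierCoeff h m = if 0 ≤ m then a m.toNat else 0 := by
  have h1 : HasSum (fun k : ℕ => ∫ y : UnitAddCircle, fourier (-m) y • (a k * fourier (k : ℤ) y)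
      ∂AddCircle.haarAddCircle) (fourierCoeff h m) := by
    have hn : ∀ (n k : ℤ) (c : ℂ) (y : UnitAddCircle),
        ‖fourier n y • (c * fourier k y)‖ = ‖c‖ := by
      intro n k c y
      simp only [norm_smul, norm_mul, norm_fourier, one_mul, mul_one]
    have := hasSum_integral_of_summable_integral_norm (μ := AddCircle.haarAddCircle)
      (F := fun (k : ℕ) (y : UnitAddCircle) => fourier (-m) y • (a k * fourier (k : ℤ) y))
      (fun k => (Continuous.integrable_of_hasCompactSupport (by fun_prop)
        (HasCompactSupport.of_compactSpace _))) (by simp only [hn]; simpa using ha)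
    have e : fourierCoeff h m = ∫ y : UnitAddCircle, ∑' k : ℕ,
        fourier (-m) y • (a k * fourier (k : ℤ) y) ∂AddCircle.haarAddCircle := by
      refine integral_congr_ae (Filter.Eventually.of_forall fun y => ?_)
      exact ((hh y).const_smul (fourier (-m) y)).tsum_eq.symm
    rwa [e]
  have h2 : ∀ k : ℕ, (∫ y : UnitAddCircle, fourier (-m) y • (a k * fourier (k : ℤ) y)
      ∂AddCircle.haarAddCircle) = a k * Pi.single (M := fun _ => ℂ) (k : ℤ) 1 m := by
    intro k
    rw [← fourierCoeff_fourier (T := 1), fourierCoeff, ← integral_const_mul]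
    congr 1; funext y; simp only [smul_eq_mul]; ring
  simp only [h2] at h1
  refine h1.unique ?_
  split_ifs with hm
  · lift m to ℕ using hm
    rw [Int.toNat_natCast]
    convert hasSum_ite_eq m (a m) using 2 with k
    by_cases hk : k = m
    · simp [hk]
    · rw [Pi.single_eq_of_ne (by exact_mod_cast Ne.symm hk), if_neg hk, mul_zero]
  · convert hasSum_zero (α := ℂ) (β := ℕ) using 2 with k
    rw [Pi.single_eq_of_ne (by omega), mul_zero]

/-- The Taylor series at 0, restricted to the circle of radius ‖w‖, is already a Fourier series. The
point is that one sequence `c` serves every w, so each Fourier coefficient is a monomial in w. -/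
theorem exists_fourierCoeff_circle {g : ℂ → ℂ} {R : ℝ}
    (hg : DifferentiableOn ℂ g (Metric.ball 0 R)) :
    ∃ c : ℕ → ℂ, ∀ w : ℂ, ‖w‖ < R → ∀ m : ℤ,
      fourierCoeff (T := 1) (fun y => g (fourier 1 y * w)) m =
        if 0 ≤ m then c m.toNat * w ^ m.toNat else 0 := by
  refine ⟨fun k => (k.factorial : ℂ)⁻¹ * iteratedDeriv k g 0, fun w hw m => ?_⟩
  have hs : ∀ v : ℂ, ‖v‖ < R → HasSum (fun k : ℕ =>
      (k.factorial : ℂ)⁻¹ * iteratedDeriv k g 0 * v ^ k) (g v) := by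
    intro v hv
    have h0 : 0 < R := (norm_nonneg v).trans_lt hv
    have := Complex.hasSum_taylorSeries_on_ball (r := (⟨R, h0.le⟩ : NNReal)) hg (z := v) (by simpa using hv)
    refine this.congr_fun fun k => ?_
    simp only [sub_zero, smul_eq_mul]; ring
  rw [hasSum_fourierCoeff (a := fun k => (k.factorial : ℂ)⁻¹ * iteratedDeriv k g 0 * w ^ k)
    (hs w hw).summable.norm]
  intro y
  have := hs (fourier 1 y * w) (by rwa [norm_mul, norm_fourier, one_mul])
  convert this using 2 with k
  rw [mul_pow]
  have : (fourier (k : ℤ) y : ℂ) = fourier 1 y ^ k := by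
    rw [fourier_one, fourier_apply, natCast_zsmul, AddCircle.toCircle_nsmul]; simp
  rw [this]; ring

end Circle

/-! ### The torus acting on the ball, and averaging over it. -/

section Torus

variable {p : ℕ}

/-- The normalized Haar measure of the torus `𝕋^p`. -/
noncomputable def torusMeasure (p : ℕ) : Measure (UnitAddTorus (Fin p)) :=
  Measure.pi fun _ => AddCircle.haarAddCircle

instance : IsProbabilityMeasure (torusMeasure p) :=
  inferInstanceAs (IsProbabilityMeasure (Measure.pi fun _ : Fin p => AddCircle.haarAddCircle))

instance : (torusMeasure p).IsAddHaarMeasure :=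
  inferInstanceAs (Measure.pi fun _ : Fin p => (AddCircle.haarAddCircle (T := 1))).IsAddHaarMeasure

/-- The rotation of the coordinates by a point of the torus. -/
noncomputable def rot (x : UnitAddTorus (Fin p)) (z : Fin p → ℂ) : Fin p → ℂ :=
  fun k => fourier 1 (x k) * z k

theorem continuous_rot : Continuous fun y : UnitAddTorus (Fin p) × (Fin p → ℂ) => rot y.1 y.2 := by
  unfold rot; fun_prop

theorem norm_rot (x : UnitAddTorus (Fin p)) (z : Fin p → ℂ) (k : Fin p) :
    ‖rot x z k‖ = ‖z k‖ := by
  rw [rot, norm_mul, norm_fourier, one_mul]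

theorem rot_mem_unitBall {x : UnitAddTorus (Fin p)} {z : Fin p → ℂ} :
    rot x z ∈ unitBall p ↔ z ∈ unitBall p := by
  simp [unitBall, norm_rot]

theorem measurePreserving_rot (x : UnitAddTorus (Fin p)) :
    MeasurePreserving (rot x) volume volume := by
  refine volume_preserving_pi (f := fun (k : Fin p) (z : ℂ) => fourier 1 (x k) * z) fun k => ?_
  have := (rotation (AddCircle.toCircle (x k))).measurePreserving
  have e : (fun z : ℂ => fourier 1 (x k) * z) = rotation (AddCircle.toCircle (x k)) := by
    funext z; rw [rotation_apply, fourier_one]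
  rw [e]
  exact this

theorem measurePreserving_rot_unitBall (x : UnitAddTorus (Fin p)) :
    MeasurePreserving (rot x) (volume.restrict (unitBall p)) (volume.restrict (unitBall p)) := by
  have := (measurePreserving_rot x).restrict_preimage (isOpen_unitBall p).measurableSet
  convert this using 2
  ext z; exact rot_mem_unitBall.symm

/-- The shear (x, z) ↦ (x, xz) preserves the product measure because each rotation preserves
Lebesgue measure on the ball; averaging over rotations then reduces to Fubini. -/
theorem measurePreserving_rot_prod :
    MeasurePreserving (fun y : UnitAddTorus (Fin p) × (Fin p → ℂ) => (y.1, rot y.1 y.2))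
      ((torusMeasure p).prod (volume.restrict (unitBall p)))
      ((torusMeasure p).prod (volume.restrict (unitBall p))) :=
  (MeasurePreserving.id _).skew_product continuous_rot.measurable
    (Filter.Eventually.of_forall fun x => (measurePreserving_rot_unitBall x).map_eq)

/-- This version needs no integrability, so it can be used to decide whether a holomorphic function
has finite norm. -/
theorem lintegral_unitBall_rot {G : (Fin p → ℂ) → ENNReal}
    (hG : AEMeasurable G (volume.restrict (unitBall p))) :
    ∫⁻ z in unitBall p, G z = ∫⁻ z in unitBall p, ∫⁻ x, G (rot x z) ∂torusMeasure p := by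
  have h1 : AEMeasurable (fun y : UnitAddTorus (Fin p) × (Fin p → ℂ) => G y.2)
      ((torusMeasure p).prod (volume.restrict (unitBall p))) := hG.comp_snd
  have hq := Measure.quasiMeasurePreserving_snd.comp
    (measurePreserving_rot_prod (p := p)).quasiMeasurePreserving
  have h2 : AEMeasurable (fun y : UnitAddTorus (Fin p) × (Fin p → ℂ) => G (rot y.1 y.2))
      ((torusMeasure p).prod (volume.restrict (unitBall p))) :=
    hG.comp_quasiMeasurePreserving hq
  rw [← lintegral_prod_symm _ h2]
  have e : ∫⁻ y, G (rot y.1 y.2) ∂((torusMeasure p).prod (volume.restrict (unitBall p))) =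
      ∫⁻ y, G y.2 ∂((torusMeasure p).prod (volume.restrict (unitBall p))) := by
    conv_rhs => rw [← measurePreserving_rot_prod.map_eq]
    rw [lintegral_map' (by rw [measurePreserving_rot_prod.map_eq]; exact h1)
      measurePreserving_rot_prod.measurable.aemeasurable]
  rw [e, lintegral_prod_symm _ h1]
  simp

theorem integral_unitBall_rot {G : (Fin p → ℂ) → ℂ} (hG : IntegrableOn G (unitBall p)) :
    ∫ z in unitBall p, G z = ∫ z in unitBall p, ∫ x, G (rot x z) ∂torusMeasure p := by
  have h1 : Integrable (fun y : UnitAddTorus (Fin p) × (Fin p → ℂ) => G y.2)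
      ((torusMeasure p).prod (volume.restrict (unitBall p))) := hG.comp_snd _
  have h2 : Integrable (fun y : UnitAddTorus (Fin p) × (Fin p → ℂ) => G (rot y.1 y.2))
      ((torusMeasure p).prod (volume.restrict (unitBall p))) :=
    measurePreserving_rot_prod.integrable_comp_of_integrable h1
  have e : ∫ y, G (rot y.1 y.2) ∂((torusMeasure p).prod (volume.restrict (unitBall p))) =
      ∫ y, G y.2 ∂((torusMeasure p).prod (volume.restrict (unitBall p))) := by
    conv_rhs => rw [← measurePreserving_rot_prod.map_eq]
    rw [integral_map measurePreserving_rot_prod.measurable.aemeasurable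
      (by rw [measurePreserving_rot_prod.map_eq]; exact h1.1)]
  rw [← integral_prod_symm _ h2, e, integral_prod_symm _ h1]
  simp

end Torus

/-! ### Taylor coefficients of holomorphic functions on the ball, and Parseval on tori. -/

section Coefficients

variable {p : ℕ}

-- Parseval for the class of `h` in L² of the torus, translated back to pointwise integrals of the
-- continuous representative.
open UnitAddTorus in
theorem hasSum_sq_torusMeasure {h : UnitAddTorus (Fin p) → ℂ} (hh : Continuous h) :
    HasSum (fun n : Fin p → ℤ => ‖∫ x, mFourier (-n) x * h x ∂torusMeasure p‖ ^ 2)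
      (∫ x, ‖h x‖ ^ 2 ∂torusMeasure p) := by
  let F : C(UnitAddTorus (Fin p), ℂ) := ⟨h, hh⟩
  have h1 := hasSum_sq_mFourierCoeff (F.toLp 2 (torusMeasure p) ℂ)
  have h2 : ∀ n, mFourierCoeff (F.toLp 2 (torusMeasure p) ℂ) n =
      ∫ x, mFourier (-n) x * h x ∂torusMeasure p := mFourierCoeff_toLp F
  have h3 : ∫ x, ‖F.toLp 2 (torusMeasure p) ℂ x‖ ^ 2 ∂torusMeasure p =
      ∫ x, ‖h x‖ ^ 2 ∂torusMeasure p := by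
    refine integral_congr_ae ?_
    filter_upwards [ContinuousMap.coeFn_toLp (p := 2) (𝕜 := ℂ) (torusMeasure p) F] with x hx
    rw [hx]; rfl
  rw [← h3]
  simp only [← h2]
  exact h1

theorem mFourier_add_single (n : Fin p → ℤ) (x : UnitAddTorus (Fin p)) (j : Fin p)
    (y : UnitAddCircle) :
    UnitAddTorus.mFourier n (x + Pi.single j y) = UnitAddTorus.mFourier n x * fourier (n j) y := by
  have h : ∏ i, fourier (n i) ((Pi.single j y : UnitAddTorus (Fin p)) i) = fourier (n j) y := by
    rw [Finset.prod_eq_single j]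
    · rw [Pi.single_eq_same]
    · intro i _ hi
      rw [Pi.single_eq_of_ne hi, fourier_eval_zero]
    · simp
  simp only [UnitAddTorus.mFourier, ContinuousMap.coe_mk]
  rw [← h, ← Finset.prod_mul_distrib]
  refine Finset.prod_congr rfl fun i _ => ?_
  simp only [fourier_apply, Pi.add_apply, smul_add, AddCircle.toCircle_add, Circle.coe_mul]

theorem rot_add_single_update (x : UnitAddTorus (Fin p)) (j : Fin p) (y : UnitAddCircle)
    (z : Fin p → ℂ) (w : ℂ) :
    rot (x + Pi.single j y) (Function.update z j w) =
      Function.update (rot x z) j (fourier 1 y * (fourier 1 (x j) * w)) := by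
  funext k
  by_cases hk : k = j
  · subst hk
    simp only [rot, Pi.add_apply, Pi.single_eq_same, Function.update_self, fourier_one,
      AddCircle.toCircle_add, Circle.coe_mul]
    ring
  · simp [rot, hk]

theorem update_mem_unitBall {z : Fin p → ℂ} {j : Fin p} {w : ℂ} :
    Function.update z j w ∈ unitBall p ↔
      ‖w‖ < Real.sqrt (1 - ∑ k ∈ Finset.univ.erase j, ‖z k‖ ^ 2) := by
  rw [Real.lt_sqrt (norm_nonneg _), unitBall, Set.mem_ofPred_eq,
    ← Finset.add_sum_erase _ _ (Finset.mem_univ j), lt_sub_iff_add_lt, Function.update_self]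
  have : ∑ k ∈ Finset.univ.erase j, ‖Function.update z j w k‖ ^ 2 =
      ∑ k ∈ Finset.univ.erase j, ‖z k‖ ^ 2 := by
    refine Finset.sum_congr rfl fun k hk => ?_
    rw [Function.update_of_ne (Finset.ne_of_mem_erase hk)]
  rw [this]

/-- The Fourier coefficients of a function on the torus through `z`. -/
noncomputable def torusCoeff (f : (Fin p → ℂ) → ℂ) (z : Fin p → ℂ) (n : Fin p → ℤ) : ℂ :=
  ∫ x, UnitAddTorus.mFourier (-n) x * f (rot x z) ∂torusMeasure p

theorem continuous_comp_rot {f : (Fin p → ℂ) → ℂ} (hf : ContinuousOn f (unitBall p))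
    {z : Fin p → ℂ} (hz : z ∈ unitBall p) : Continuous fun x => f (rot x z) := by
  refine hf.comp_continuous (continuous_rot.comp (by fun_prop : Continuous fun x => (x, z)))
    fun x => rot_mem_unitBall.2 hz

/-- Haar measure is invariant under translation along the j-th axis, so averaging over these
translations changes nothing. It exposes a one-variable Fourier coefficient inside the torus
integral. -/
theorem integral_torus_eq_integral_single {H : UnitAddTorus (Fin p) → ℂ} (hH : Continuous H)
    (j : Fin p) :
    ∫ x, H x ∂torusMeasure p =
      ∫ x, ∫ y : UnitAddCircle, H (x + Pi.single j y) ∂AddCircle.haarAddCircle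
        ∂torusMeasure p := by
  have hc : Continuous fun a : UnitAddTorus (Fin p) × UnitAddCircle =>
      H (a.1 + Pi.single j a.2) := by
    refine hH.comp (continuous_fst.add ?_)
    exact (continuous_single j).comp continuous_snd
  rw [integral_integral_swap (hc.integrable_of_hasCompactSupport
    (HasCompactSupport.of_compactSpace _))]
  simp [integral_add_right_eq_self]

/-- Freezing all variables but the j-th leaves a holomorphic function on a disc of radius `R`, to
which the circle result applies for every rotation x of the frozen variables. `R` does not depend on
x since rotations preserve moduli. -/
theorem exists_torusCoeff_update {f : (Fin p → ℂ) → ℂ} (hf : DifferentiableOn ℂ f (unitBall p))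
    (z : Fin p → ℂ) (j : Fin p) (n : Fin p → ℤ) :
    ∃ C : ℂ, ∀ w, Function.update z j w ∈ unitBall p →
      torusCoeff f (Function.update z j w) n =
        if 0 ≤ n j then C * w ^ (n j).toNat else 0 := by
  set R := Real.sqrt (1 - ∑ k ∈ Finset.univ.erase j, ‖z k‖ ^ 2) with hR
  have hd : ∀ x : UnitAddTorus (Fin p),
      DifferentiableOn ℂ (fun ζ => f (Function.update (rot x z) j ζ)) (Metric.ball 0 R) := by
    intro x
    refine hf.comp (t := unitBall p) (f := fun ζ => Function.update (rot x z) j ζ) ?_ ?_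
    · exact fun ζ _ => (hasFDerivAt_update (𝕜 := ℂ) (rot x z) ζ).differentiableAt.differentiableWithinAt
    · intro ζ hζ
      rw [update_mem_unitBall]
      simp only [norm_rot]
      exact mem_ball_zero_iff.1 hζ
  choose c hc using fun x => exists_fourierCoeff_circle (hd x)
  -- The constant averages the Taylor coefficients of the slices over the torus; the factor `fourier
  -- 1 (x j)` comes from the slice being evaluated at the rotated point.
  refine ⟨∫ x, UnitAddTorus.mFourier (-n) x *
    (c x (n j).toNat * fourier 1 (x j) ^ (n j).toNat) ∂torusMeasure p, fun w hw => ?_⟩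
  have hw' : ‖w‖ < R := update_mem_unitBall.1 hw
  rw [torusCoeff, integral_torus_eq_integral_single (H := fun x => UnitAddTorus.mFourier (-n) x *
    f (rot x (Function.update z j w))) ((ContinuousMap.continuous _).mul
    (continuous_comp_rot hf.continuousOn hw)) j]
  have e : ∀ x : UnitAddTorus (Fin p), (∫ y : UnitAddCircle,
      UnitAddTorus.mFourier (-n) (x + Pi.single j y) *
        f (rot (x + Pi.single j y) (Function.update z j w)) ∂AddCircle.haarAddCircle) =
      UnitAddTorus.mFourier (-n) x * (if 0 ≤ n j then c x (n j).toNat *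
        (fourier 1 (x j) * w) ^ (n j).toNat else 0) := by
    intro x
    rw [← hc x _ (by rwa [norm_mul, norm_fourier, one_mul]), fourierCoeff, ← integral_const_mul]
    congr 1
    funext y
    rw [mFourier_add_single, rot_add_single_update, smul_eq_mul, mul_assoc]
    rfl
  simp only [e]
  split_ifs with h
  -- Pulling out the power of w is valid without integrability, so nothing has to be known about how
  -- the chosen coefficients depend on x.
  · rw [← integral_mul_const]
    congr 1
    funext x
    ring
  · simp

theorem torusCoeff_of_neg {f : (Fin p → ℂ) → ℂ} (hf : DifferentiableOn ℂ f (unitBall p))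
    {z : Fin p → ℂ} (hz : z ∈ unitBall p) {n : Fin p → ℤ} {j : Fin p} (hj : n j < 0) :
    torusCoeff f z n = 0 := by
  obtain ⟨C, hC⟩ := exists_torusCoeff_update hf z j n
  have := hC (z j) (by rwa [Function.update_eq_self])
  rwa [Function.update_eq_self, if_neg (not_le.2 hj)] at this

/-- The unknown constant of the slice formula is eliminated by comparing two values; the
cross-multiplied form avoids dividing by a coordinate that may vanish. -/
theorem torusCoeff_update {f : (Fin p → ℂ) → ℂ} (hf : DifferentiableOn ℂ f (unitBall p))
    {z : Fin p → ℂ} (hz : z ∈ unitBall p) (n : Fin p → ℕ) (j : Fin p) {w : ℂ}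
    (hw : Function.update z j w ∈ unitBall p) :
    z j ^ n j * torusCoeff f (Function.update z j w) (fun k => n k) =
      w ^ n j * torusCoeff f z (fun k => n k) := by
  obtain ⟨C, hC⟩ := exists_torusCoeff_update hf z j (fun k => n k)
  have h1 := hC (z j) (by rwa [Function.update_eq_self])
  rw [Function.update_eq_self] at h1
  rw [hC w hw, h1]
  simp only [Nat.cast_nonneg, if_true, Int.toNat_natCast]
  ring

/-- Coordinates are exchanged one at a time, which is why every mixture of z and w must lie in the
ball. -/
theorem torusCoeff_piecewise {f : (Fin p → ℂ) → ℂ} (hf : DifferentiableOn ℂ f (unitBall p))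
    {z w : Fin p → ℂ} (h : ∀ S : Finset (Fin p), S.piecewise w z ∈ unitBall p)
    (n : Fin p → ℕ) (S : Finset (Fin p)) :
    (∏ k ∈ S, z k ^ n k) * torusCoeff f (S.piecewise w z) (fun k => n k) =
      (∏ k ∈ S, w k ^ n k) * torusCoeff f z (fun k => n k) := by
  induction S using Finset.induction_on with
  | empty => simp
  | insert j S hj ih =>
    have h1 := torusCoeff_update hf (h S) n j (w := w j)
      (by rw [← Finset.piecewise_insert]; exact h _)
    rw [Finset.piecewise_eq_of_notMem _ _ _ hj, ← Finset.piecewise_insert] at h1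
    rw [Finset.prod_insert hj, Finset.prod_insert hj]
    linear_combination (∏ k ∈ S, z k ^ n k) * h1 + w j ^ n j * ih

theorem mul_torusCoeff {f : (Fin p → ℂ) → ℂ} (hf : DifferentiableOn ℂ f (unitBall p))
    {z w : Fin p → ℂ} (h : ∀ S : Finset (Fin p), S.piecewise w z ∈ unitBall p)
    (n : Fin p → ℕ) :
    (∏ k, z k ^ n k) * torusCoeff f w (fun k => n k) =
      (∏ k, w k ^ n k) * torusCoeff f z (fun k => n k) := by
  simpa using torusCoeff_piecewise hf h n Finset.univ

theorem mem_unitBall_of_le {z w : Fin p → ℂ} (hz : z ∈ unitBall p) (h : ∀ k, ‖w k‖ ≤ ‖z k‖) :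
    w ∈ unitBall p :=
  (Finset.sum_le_sum fun k _ => pow_le_pow_left₀ (norm_nonneg _) (h k) 2).trans_lt hz

theorem norm_inv_natCast_add_one : ‖((p + 1 : ℂ)⁻¹)‖ = (p + 1 : ℝ)⁻¹ := by
  rw [norm_inv]
  exact_mod_cast congrArg _ (Complex.norm_natCast (p + 1))

/-- The base point for `taylorCoeff`: all coordinates are nonzero, so no monomial vanishes there,
and p/(p+1)² < 1 for every p, zero included. -/
theorem const_mem_unitBall : (fun _ => (p + 1 : ℂ)⁻¹) ∈ unitBall p := by
  have h0 : (0 : ℝ) ≤ p := Nat.cast_nonneg p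
  simp only [unitBall, Set.mem_ofPred_eq, norm_inv_natCast_add_one, Finset.sum_const,
    Finset.card_univ, Fintype.card_fin, nsmul_eq_mul, inv_pow]
  rw [← div_eq_mul_inv, div_lt_one (by positivity)]
  nlinarith

theorem norm_le_one_of_mem_unitBall {z : Fin p → ℂ} (hz : z ∈ unitBall p) (k : Fin p) :
    ‖z k‖ ≤ 1 := by
  have : ‖z k‖ ^ 2 ≤ ∑ k, ‖z k‖ ^ 2 :=
    Finset.single_le_sum (f := fun k => ‖z k‖ ^ 2) (fun _ _ => sq_nonneg _) (Finset.mem_univ k)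
  have h2 : ∑ k, ‖z k‖ ^ 2 < 1 := hz
  nlinarith [norm_nonneg (z k)]

/-- The Taylor coefficients at the origin of a holomorphic function on the ball, read off from the
torus through a fixed point. -/
noncomputable def taylorCoeff (f : (Fin p → ℂ) → ℂ) (n : Fin p → ℕ) : ℂ :=
  torusCoeff f (fun _ => (p + 1 : ℂ)⁻¹) (fun k => n k) / ∏ k : Fin p, (p + 1 : ℂ)⁻¹ ^ n k

theorem torusCoeff_eq {f : (Fin p → ℂ) → ℂ} (hf : DifferentiableOn ℂ f (unitBall p))
    {z : Fin p → ℂ} (hz : z ∈ unitBall p) (n : Fin p → ℕ) :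
    torusCoeff f z (fun k => n k) = taylorCoeff f n * ∏ k, z k ^ n k := by
  -- If the monomial vanishes at z, the slice formula in a variable with z_j^(n_j) = 0 already gives
  -- zero. Otherwise the monomial can be cancelled at the end.
  rcases eq_or_ne (∏ k, z k ^ n k) 0 with h0 | h0
  · rw [h0, mul_zero]
    obtain ⟨j, _, hj⟩ := Finset.prod_eq_zero_iff.1 h0
    obtain ⟨C, hC⟩ := exists_torusCoeff_update hf z j (fun k => n k)
    have := hC (z j) (by rwa [Function.update_eq_self])
    rwa [Function.update_eq_self, if_pos (by positivity), Int.toNat_natCast, hj, mul_zero] at this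
  set s : ℂ := (p + 1 : ℂ)⁻¹ with hs
  have hs0 : s ≠ 0 := inv_ne_zero (by exact_mod_cast Nat.succ_ne_zero p)
  have hs1 : ∏ k, s ^ n k ≠ 0 := Finset.prod_ne_zero_iff.2 fun _ _ => pow_ne_zero _ hs0
  have hn : ‖s‖ ≤ 1 := by
    rw [hs, norm_inv_natCast_add_one]
    exact inv_le_one_of_one_le₀ (le_add_of_nonneg_left (Nat.cast_nonneg p))
  -- Mixtures of z with the base point may leave the ball. The comparison goes through the point
  -- s·z, which is dominated coordinatewise both by z and by the base point (s, …, s).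
  have h1 := mul_torusCoeff hf (z := z) (w := fun k => s * z k) (fun S => by
    refine mem_unitBall_of_le hz fun k => ?_
    by_cases hk : k ∈ S
    · rw [Finset.piecewise_eq_of_mem _ _ _ hk, norm_mul]
      exact mul_le_of_le_one_left (norm_nonneg _) hn
    · rw [Finset.piecewise_eq_of_notMem _ _ _ hk]) n
  have h2 := mul_torusCoeff hf (z := fun _ => s) (w := fun k => s * z k) (fun S => by
    refine mem_unitBall_of_le const_mem_unitBall fun k => ?_
    by_cases hk : k ∈ S
    · rw [Finset.piecewise_eq_of_mem _ _ _ hk, norm_mul]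
      exact mul_le_of_le_one_right (norm_nonneg _) (norm_le_one_of_mem_unitBall hz k)
    · rw [Finset.piecewise_eq_of_notMem _ _ _ hk]) n
  simp only [mul_pow, Finset.prod_mul_distrib] at h1 h2
  rw [mul_assoc] at h2
  have h3 := mul_left_cancel₀ hs1 h2
  rw [h3, mul_left_comm, mul_assoc] at h1
  rw [taylorCoeff, div_mul_eq_mul_div, eq_div_iff hs1]
  refine mul_left_cancel₀ h0 ?_
  linear_combination -h1

/-- Parseval on the torus through z, the sum over ℤ^p shrinking to ℕ^p because coefficients with a
negative index vanish. -/
theorem hasSum_norm_sq_taylorCoeff {f : (Fin p → ℂ) → ℂ} (hf : DifferentiableOn ℂ f (unitBall p))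
    {z : Fin p → ℂ} (hz : z ∈ unitBall p) :
    HasSum (fun n : Fin p → ℕ => ‖taylorCoeff f n * ∏ k, z k ^ n k‖ ^ 2)
      (∫ x, ‖f (rot x z)‖ ^ 2 ∂torusMeasure p) := by
  have h := hasSum_sq_torusMeasure (continuous_comp_rot hf.continuousOn hz)
  have hi : Function.Injective fun (n : Fin p → ℕ) (k : Fin p) => (n k : ℤ) :=
    fun a b hab => funext fun k => Nat.cast_injective (R := ℤ) (congrFun hab k)
  rw [← hi.hasSum_iff] at h
  · refine h.congr_fun fun n => ?_
    rw [← torusCoeff_eq hf hz]; rfl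
  · intro m hm
    have : ∃ j, m j < 0 := by
      by_contra! hc
      exact hm ⟨fun k => (m k).toNat, funext fun k => Int.toNat_of_nonneg (hc k)⟩
    obtain ⟨j, hj⟩ := this
    have := torusCoeff_of_neg hf hz hj
    rw [torusCoeff] at this
    rw [this]; simp

theorem lintegral_torus_enorm_sq {f : (Fin p → ℂ) → ℂ} (hf : DifferentiableOn ℂ f (unitBall p))
    {z : Fin p → ℂ} (hz : z ∈ unitBall p) :
    ∫⁻ x, ENNReal.ofReal (‖f (rot x z)‖ ^ 2) ∂torusMeasure p =
      ∑' n : Fin p → ℕ, ENNReal.ofReal (‖taylorCoeff f n‖ ^ 2) *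
        ENNReal.ofReal (∏ k, ‖z k‖ ^ (2 * n k)) := by
  have h := hasSum_norm_sq_taylorCoeff hf hz
  have hc := continuous_comp_rot hf.continuousOn hz
  rw [← ofReal_integral_eq_lintegral_ofReal (f := fun x => ‖f (rot x z)‖ ^ 2) ((hc.norm.pow 2).integrable_of_hasCompactSupport
    (HasCompactSupport.of_compactSpace _)) (Filter.Eventually.of_forall fun _ => sq_nonneg _),
    ← h.tsum_eq, ENNReal.ofReal_tsum_of_nonneg (fun _ => sq_nonneg _) h.summable]
  congr 1
  funext n
  rw [← ENNReal.ofReal_mul (sq_nonneg _), norm_mul, mul_pow, norm_prod, ← Finset.prod_pow]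
  simp only [norm_pow, ← pow_mul, mul_comm]

end Coefficients

/-! ### Moments of the weight on the ball. -/

section Moments

variable {p : ℕ}

theorem lintegral_exp_mul_rpow {a : ℝ} (ha : 0 < a) :
    ∫⁻ x in Set.Ioi (0 : ℝ), ENNReal.ofReal (Real.exp (-x) * x ^ (a - 1)) =
      ENNReal.ofReal (Real.Gamma a) := by
  rw [Real.Gamma_eq_integral ha, ofReal_integral_eq_lintegral_ofReal
    (Real.GammaIntegral_convergent ha)]
  refine (ae_restrict_iff' measurableSet_Ioi).2 (Filter.Eventually.of_forall fun x hx => ?_)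
  exact mul_nonneg (Real.exp_nonneg _) (Real.rpow_nonneg (le_of_lt hx) _)

theorem lintegral_exp_mul_sub_rpow {a : ℝ} (ha : 0 < a) (t : ℝ) :
    ∫⁻ s in Set.Ioi t, ENNReal.ofReal (Real.exp (-s) * (s - t) ^ (a - 1)) =
      ENNReal.ofReal (Real.exp (-t) * Real.Gamma a) := by
  rw [ENNReal.ofReal_mul (Real.exp_nonneg _), ← lintegral_exp_mul_rpow ha,
    ← lintegral_const_mul' _ _ ENNReal.ofReal_ne_top,
    ← lintegral_indicator measurableSet_Ioi, ← lintegral_indicator measurableSet_Ioi,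
    ← lintegral_add_right_eq_self _ t]
  congr 1
  funext x
  by_cases hx : 0 < x
  · rw [Set.indicator_of_mem (by simpa using hx), Set.indicator_of_mem (by simpa using hx),
      ← ENNReal.ofReal_mul (Real.exp_nonneg _), add_sub_cancel_right, neg_add, Real.exp_add]
    congr 1; ring
  · rw [Set.indicator_of_notMem (by simpa using hx), Set.indicator_of_notMem (by simpa using hx)]

theorem integral_norm_pow_mul_exp (n : ℕ) :
    ∫ z : ℂ, ‖z‖ ^ (2 * n) * Real.exp (-‖z‖ ^ 2) = Real.pi * n.factorial := by
  have := Complex.integral_rpow_mul_exp_neg_rpow (p := 2) (q := (2 * n : ℕ)) (by norm_num)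
    (by have : (0 : ℝ) ≤ (2 * n : ℕ) := Nat.cast_nonneg _
        linarith)
  simp only [Real.rpow_natCast, Real.rpow_two] at this
  rw [this]
  have e : ((2 * n : ℕ) + 2 : ℝ) / 2 = n + 1 := by push_cast; ring
  rw [e, Real.Gamma_nat_eq_factorial]; ring

/-- The integral of a non-integrable function is 0 by convention, whereas this one was computed to
be positive. -/
theorem integrable_norm_pow_mul_exp (n : ℕ) :
    Integrable fun z : ℂ => ‖z‖ ^ (2 * n) * Real.exp (-‖z‖ ^ 2) := by
  by_contra h
  have := integral_norm_pow_mul_exp n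
  rw [integral_undef h] at this
  have h2 : 0 < Real.pi * n.factorial := by positivity
  exact h2.ne this

theorem lintegral_gaussian_moment (n : Fin p → ℕ) :
    ∫⁻ z : Fin p → ℂ, ENNReal.ofReal (∏ k, ‖z k‖ ^ (2 * n k)) *
      ENNReal.ofReal (Real.exp (-∑ k, ‖z k‖ ^ 2)) =
      ENNReal.ofReal (Real.pi ^ p * ∏ k, ((n k).factorial : ℝ)) := by
  have h1 := integral_fintype_prod_volume_eq_prod
    (fun (k : Fin p) (z : ℂ) => ‖z‖ ^ (2 * n k) * Real.exp (-‖z‖ ^ 2))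
  have h2 : Integrable fun z : Fin p → ℂ =>
      ∏ k, (‖z k‖ ^ (2 * n k) * Real.exp (-‖z k‖ ^ 2)) :=
    Integrable.fintype_prod (f := fun (k : Fin p) (z : ℂ) => ‖z‖ ^ (2 * n k) *
      Real.exp (-‖z‖ ^ 2)) fun k => integrable_norm_pow_mul_exp (n k)
  simp only [integral_norm_pow_mul_exp, Finset.prod_mul_distrib, Finset.prod_const,
    Finset.card_univ, Fintype.card_fin] at h1
  rw [← h1, ofReal_integral_eq_lintegral_ofReal (by simpa only [Finset.prod_mul_distrib] using h2)
    (Filter.Eventually.of_forall fun z => by positivity)]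
  congr 1
  funext z
  rw [← ENNReal.ofReal_mul (by positivity), ← Finset.sum_neg_distrib, Real.exp_sum]

theorem lintegral_smul_pi_complex {r : ℝ} (hr : 0 < r) {F : (Fin p → ℂ) → ENNReal}
    (hF : Measurable F) :
    ∫⁻ z, F z = ENNReal.ofReal (r ^ (2 * p)) * ∫⁻ z, F (r • z) := by
  have h := Measure.map_addHaar_smul (volume : Measure (Fin p → ℂ)) hr.ne'
  have hd : Module.finrank ℝ (Fin p → ℂ) = 2 * p := by
    simp [Module.finrank_pi_fintype, mul_comm]
  rw [← lintegral_map hF (measurable_const_smul r), h, lintegral_smul_measure, hd, smul_eq_mul,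
    ← mul_assoc, ← ENNReal.ofReal_mul (by positivity), abs_of_pos (by positivity),
    mul_inv_cancel₀ (by positivity), ENNReal.ofReal_one, one_mul]

/-- Substituting √s·z contributes s^|n| from the monomial, s^p from the volume (real dimension 2p)
and s^(a-1) from the weight. -/
theorem lintegral_ball_scale {a : ℝ} (n : Fin p → ℕ) {s : ℝ} (hs : 0 < s) :
    ∫⁻ z in {z : Fin p → ℂ | ∑ k, ‖z k‖ ^ 2 < s}, ENNReal.ofReal (∏ k, ‖z k‖ ^ (2 * n k)) *
      ENNReal.ofReal ((s - ∑ k, ‖z k‖ ^ 2) ^ (a - 1)) =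
    ENNReal.ofReal (s ^ (((∑ k, n k : ℕ) : ℝ) + p + a - 1)) *
      ∫⁻ z in unitBall p, ENNReal.ofReal (∏ k, ‖z k‖ ^ (2 * n k)) *
        ENNReal.ofReal ((1 - ∑ k, ‖z k‖ ^ 2) ^ (a - 1)) := by
  have hm : MeasurableSet {z : Fin p → ℂ | ∑ k, ‖z k‖ ^ 2 < s} :=
    (isOpen_lt (by fun_prop) continuous_const).measurableSet
  rw [← lintegral_indicator hm, ← lintegral_indicator (isOpen_unitBall p).measurableSet,
    lintegral_smul_pi_complex (Real.sqrt_pos.2 hs)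
      ((by fun_prop : Measurable _).indicator hm),
    ← lintegral_const_mul' _ _ ENNReal.ofReal_ne_top,
    ← lintegral_const_mul' _ _ ENNReal.ofReal_ne_top]
  congr 1
  funext z
  have hq : ∑ k, ‖(Real.sqrt s • z) k‖ ^ 2 = s * ∑ k, ‖z k‖ ^ 2 := by
    rw [Finset.mul_sum]
    refine Finset.sum_congr rfl fun k _ => ?_
    rw [Pi.smul_apply, norm_smul, mul_pow, Real.norm_of_nonneg (Real.sqrt_nonneg _),
      Real.sq_sqrt hs.le]
  have hg : ∏ k, ‖(Real.sqrt s • z) k‖ ^ (2 * n k) =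
      s ^ (∑ k, n k) * ∏ k, ‖z k‖ ^ (2 * n k) := by
    rw [← Finset.prod_pow_eq_pow_sum, ← Finset.prod_mul_distrib]
    refine Finset.prod_congr rfl fun k _ => ?_
    rw [Pi.smul_apply, norm_smul, mul_pow, Real.norm_of_nonneg (Real.sqrt_nonneg _),
      pow_mul (Real.sqrt s), Real.sq_sqrt hs.le]
  by_cases hz : ∑ k, ‖z k‖ ^ 2 < 1
  · have hz' : 0 ≤ 1 - ∑ k, ‖z k‖ ^ 2 := by linarith
    rw [Set.indicator_of_mem (by
        rw [Set.mem_ofPred_eq, hq]; exact mul_lt_of_lt_one_right hs hz),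
      Set.indicator_of_mem (show z ∈ unitBall p from hz), hq, hg,
      ← ENNReal.ofReal_mul (by positivity), ← ENNReal.ofReal_mul (by positivity),
      ← ENNReal.ofReal_mul (by positivity), ← ENNReal.ofReal_mul (by positivity)]
    congr 1
    have e1 : s - s * ∑ k, ‖z k‖ ^ 2 = s * (1 - ∑ k, ‖z k‖ ^ 2) := by ring
    have e2 : ((∑ k, n k : ℕ) : ℝ) + p + a - 1 = ((∑ k, n k : ℕ) : ℝ) + ((p : ℝ) + (a - 1)) := by
      ring
    rw [e1, Real.mul_rpow hs.le hz', e2, Real.rpow_add hs, Real.rpow_add hs, Real.rpow_natCast,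
      Real.rpow_natCast, pow_mul (Real.sqrt s), Real.sq_sqrt hs.le]
    ring
  · rw [Set.indicator_of_notMem (by
        rw [Set.mem_ofPred_eq, hq, not_lt]; exact le_mul_of_one_le_right hs.le (not_lt.1 hz)),
      Set.indicator_of_notMem (show z ∉ unitBall p from hz), mul_zero, mul_zero]

/-- Integrate |z^n|² e^(-s) (s-|z|²)^(a-1) over |z|² < s in two orders. With s first, Γ(a) times a
Gaussian moment π^p n! appears; with z first, scaling leaves Γ(|n|+p+a) times the wanted integral.
-/
theorem lintegral_unitBall_moment {a : ℝ} (ha : 0 < a) (n : Fin p → ℕ) :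
    ∫⁻ z in unitBall p, ENNReal.ofReal (∏ k, ‖z k‖ ^ (2 * n k)) *
        ENNReal.ofReal ((1 - ∑ k, ‖z k‖ ^ 2) ^ (a - 1)) =
      ENNReal.ofReal (Real.pi ^ p * (∏ k, ((n k).factorial : ℝ)) * Real.Gamma a /
        Real.Gamma (((∑ k, n k : ℕ) : ℝ) + p + a)) := by
  set I := ∫⁻ z in unitBall p, ENNReal.ofReal (∏ k, ‖z k‖ ^ (2 * n k)) *
        ENNReal.ofReal ((1 - ∑ k, ‖z k‖ ^ 2) ^ (a - 1)) with hI
  set N : ℝ := ((∑ k, n k : ℕ) : ℝ) + p + a with hN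
  have hN0 : 0 < N := by positivity
  let K : (Fin p → ℂ) → ℝ → ENNReal := fun z s =>
    Set.indicator {x : (Fin p → ℂ) × ℝ | ∑ k, ‖x.1 k‖ ^ 2 < x.2}
      (fun x => ENNReal.ofReal (∏ k, ‖x.1 k‖ ^ (2 * n k)) *
        ENNReal.ofReal (Real.exp (-x.2) * (x.2 - ∑ k, ‖x.1 k‖ ^ 2) ^ (a - 1))) (z, s)
  have hK : Measurable (Function.uncurry K) := by
    have hm : MeasurableSet {x : (Fin p → ℂ) × ℝ | ∑ k, ‖x.1 k‖ ^ 2 < x.2} :=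
      (isOpen_lt (by fun_prop) (by fun_prop)).measurableSet
    exact (by fun_prop : Measurable _).indicator hm
  have h1 : ∀ z, ∫⁻ s, K z s = ENNReal.ofReal (∏ k, ‖z k‖ ^ (2 * n k)) *
      ENNReal.ofReal (Real.exp (-∑ k, ‖z k‖ ^ 2)) * ENNReal.ofReal (Real.Gamma a) := by
    intro z
    rw [mul_assoc, ← ENNReal.ofReal_mul (Real.exp_nonneg _), ← lintegral_exp_mul_sub_rpow ha,
      ← lintegral_const_mul' _ _ ENNReal.ofReal_ne_top, ← lintegral_indicator measurableSet_Ioi]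
    rfl
  have h2 : ∀ s, ∫⁻ z, K z s = (Set.Ioi (0 : ℝ)).indicator
      (fun s => ENNReal.ofReal (Real.exp (-s) * s ^ (N - 1)) * I) s := by
    intro s
    by_cases hs : 0 < s
    · rw [Set.indicator_of_mem (by exact hs), ENNReal.ofReal_mul (Real.exp_nonneg _), mul_assoc,
        ← lintegral_ball_scale n hs, ← lintegral_const_mul' _ _ ENNReal.ofReal_ne_top,
        ← lintegral_indicator (isOpen_lt (by fun_prop) continuous_const).measurableSet]
      congr 1
      funext z
      by_cases hz : ∑ k, ‖z k‖ ^ 2 < s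
      · rw [Set.indicator_of_mem (by exact hz)]
        simp only [K]
        rw [Set.indicator_of_mem (by exact hz), ENNReal.ofReal_mul (Real.exp_nonneg _)]
        ring
      · rw [Set.indicator_of_notMem (by exact hz)]
        exact Set.indicator_of_notMem (by exact hz) _
    · rw [Set.indicator_of_notMem (by exact hs)]
      have : ∀ z, K z s = 0 := fun z => by
        refine Set.indicator_of_notMem ?_ _
        have : 0 ≤ ∑ k, ‖z k‖ ^ 2 := Finset.sum_nonneg fun _ _ => sq_nonneg _
        simp only [Set.mem_ofPred_eq]; linarith
      simp [this]
  have h3 := lintegral_lintegral_swap (μ := volume) (ν := volume) hK.aemeasurable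
  simp only [h1, h2] at h3
  rw [lintegral_mul_const' _ _ ENNReal.ofReal_ne_top, lintegral_gaussian_moment,
    lintegral_indicator measurableSet_Ioi, lintegral_mul_const _ (by fun_prop),
    lintegral_exp_mul_rpow hN0, ← ENNReal.ofReal_mul (by positivity)] at h3
  have hG := Real.Gamma_pos_of_pos hN0
  rw [ENNReal.ofReal_div_of_pos hG, h3, mul_comm, ENNReal.mul_div_cancel_right]
  · simpa using hG
  · exact ENNReal.ofReal_ne_top

end Moments

/-! ### The weighted Bergman norm in terms of Taylor coefficients. -/

section Component

variable {p : ℕ}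

/-- The integral of `|z^n|² (1 - |z|²)^(a - 1)` over the ball. -/
noncomputable def moment (p : ℕ) (a : ℝ) (n : Fin p → ℕ) : ℝ :=
  Real.pi ^ p * (∏ k, ((n k).factorial : ℝ)) * Real.Gamma a /
    Real.Gamma (((∑ k, n k : ℕ) : ℝ) + p + a)

theorem moment_pos {a : ℝ} (ha : 0 < a) (n : Fin p → ℕ) : 0 < moment p a n := by
  have h1 := Real.Gamma_pos_of_pos ha
  have h2 : 0 < Real.Gamma (((∑ k, n k : ℕ) : ℝ) + p + a) :=
    Real.Gamma_pos_of_pos (by positivity)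
  unfold moment
  positivity

theorem one_sub_pos {z : Fin p → ℂ} (hz : z ∈ unitBall p) : 0 < 1 - ∑ k, ‖z k‖ ^ 2 :=
  sub_pos.2 hz

theorem measurableSet_unitBall : MeasurableSet (unitBall p) := (isOpen_unitBall p).measurableSet

theorem moment_integrand_nonneg (a : ℝ) (n : Fin p → ℕ) :
    0 ≤ᵐ[volume.restrict (unitBall p)] fun z : Fin p → ℂ =>
      (∏ k, ‖z k‖ ^ (2 * n k)) * (1 - ∑ k, ‖z k‖ ^ 2) ^ (a - 1) :=
  (ae_restrict_iff' measurableSet_unitBall).2 (Filter.Eventually.of_forall fun z hz =>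
    mul_nonneg (by positivity) (Real.rpow_nonneg (one_sub_pos hz).le _))

theorem lintegral_moment_integrand {a : ℝ} (ha : 0 < a) (n : Fin p → ℕ) :
    ∫⁻ z in unitBall p, ENNReal.ofReal ((∏ k, ‖z k‖ ^ (2 * n k)) *
      (1 - ∑ k, ‖z k‖ ^ 2) ^ (a - 1)) = ENNReal.ofReal (moment p a n) := by
  rw [moment, ← lintegral_unitBall_moment ha]
  congr 1
  funext z
  rw [ENNReal.ofReal_mul (by positivity)]

theorem integrableOn_moment {a : ℝ} (ha : 0 < a) (n : Fin p → ℕ) :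
    IntegrableOn (fun z : Fin p → ℂ => (∏ k, ‖z k‖ ^ (2 * n k)) *
      (1 - ∑ k, ‖z k‖ ^ 2) ^ (a - 1)) (unitBall p) := by
  refine ⟨(by fun_prop : Measurable _).aestronglyMeasurable, ?_⟩
  rw [hasFiniteIntegral_iff_ofReal (moment_integrand_nonneg a n), lintegral_moment_integrand ha]
  exact ENNReal.ofReal_lt_top

theorem integral_moment {a : ℝ} (ha : 0 < a) (n : Fin p → ℕ) :
    ∫ z in unitBall p, (∏ k, ‖z k‖ ^ (2 * n k)) * (1 - ∑ k, ‖z k‖ ^ 2) ^ (a - 1) =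
      moment p a n := by
  rw [integral_eq_lintegral_of_nonneg_ae (moment_integrand_nonneg a n)
    (integrableOn_moment ha n).1, lintegral_moment_integrand ha,
    ENNReal.toReal_ofReal (moment_pos ha n).le]

/-- The weight is constant on tori: average over the torus, apply Parseval there, and integrate
termwise by Tonelli. As an identity in `ENNReal` it yields both the norm formula and the criterion
for finite norm. -/
theorem lintegral_norm_sq_weight {f : (Fin p → ℂ) → ℂ}
    (hf : DifferentiableOn ℂ f (unitBall p)) {a : ℝ} (ha : 0 < a) :
    ∫⁻ z in unitBall p, ENNReal.ofReal ((1 - ∑ k, ‖z k‖ ^ 2) ^ (a - 1) * ‖f z‖ ^ 2) =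
      ∑' n, ENNReal.ofReal (‖taylorCoeff f n‖ ^ 2 * moment p a n) := by
  have hm : AEMeasurable f (volume.restrict (unitBall p)) :=
    hf.continuousOn.aemeasurable measurableSet_unitBall
  have hG : AEMeasurable (fun z : Fin p → ℂ => ENNReal.ofReal
      ((1 - ∑ k, ‖z k‖ ^ 2) ^ (a - 1) * ‖f z‖ ^ 2)) (volume.restrict (unitBall p)) :=
    ((by fun_prop : Measurable fun z : Fin p → ℂ =>
      (1 - ∑ k, ‖z k‖ ^ 2) ^ (a - 1)).aemeasurable.mul (hm.norm.pow_const 2)).ennreal_ofReal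
  rw [lintegral_unitBall_rot hG]
  simp only [ENNReal.ofReal_mul (sq_nonneg _), ← lintegral_moment_integrand ha,
    ← lintegral_const_mul' _ _ ENNReal.ofReal_ne_top]
  rw [← lintegral_tsum fun n => by fun_prop]
  refine setLIntegral_congr_fun measurableSet_unitBall fun z hz => ?_
  simp only [norm_rot, ENNReal.ofReal_mul (Real.rpow_nonneg (one_sub_pos hz).le _)]
  rw [lintegral_const_mul' _ _ ENNReal.ofReal_ne_top, lintegral_torus_enorm_sq hf hz,
    ← ENNReal.tsum_mul_left]
  congr 1
  funext n
  rw [ENNReal.ofReal_mul (by positivity)]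
  ring

theorem weight_norm_sq_nonneg (a : ℝ) (f : (Fin p → ℂ) → ℂ) :
    0 ≤ᵐ[volume.restrict (unitBall p)] fun z : Fin p → ℂ =>
      (1 - ∑ k, ‖z k‖ ^ 2) ^ (a - 1) * ‖f z‖ ^ 2 :=
  (ae_restrict_iff' measurableSet_unitBall).2 (Filter.Eventually.of_forall fun _ hz =>
    mul_nonneg (Real.rpow_nonneg (one_sub_pos hz).le _) (sq_nonneg _))

theorem aestronglyMeasurable_weight_norm_sq (a : ℝ) {f : (Fin p → ℂ) → ℂ}
    (hf : DifferentiableOn ℂ f (unitBall p)) :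
    AEStronglyMeasurable (fun z : Fin p → ℂ => (1 - ∑ k, ‖z k‖ ^ 2) ^ (a - 1) * ‖f z‖ ^ 2)
      (volume.restrict (unitBall p)) := by
  have hm : AEMeasurable f (volume.restrict (unitBall p)) :=
    hf.continuousOn.aemeasurable measurableSet_unitBall
  exact ((by fun_prop : Measurable fun z : Fin p → ℂ =>
    (1 - ∑ k, ‖z k‖ ^ 2) ^ (a - 1)).aemeasurable.mul (hm.norm.pow_const 2)).aestronglyMeasurable

theorem hasSum_taylorCoeff_moment {f : (Fin p → ℂ) → ℂ}
    (hf : DifferentiableOn ℂ f (unitBall p)) {a : ℝ} (ha : 0 < a)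
    (hi : IntegrableOn (fun z => (1 - ∑ k, ‖z k‖ ^ 2) ^ (a - 1) * ‖f z‖ ^ 2) (unitBall p)) :
    HasSum (fun n => ‖taylorCoeff f n‖ ^ 2 * moment p a n)
      (∫ z in unitBall p, (1 - ∑ k, ‖z k‖ ^ 2) ^ (a - 1) * ‖f z‖ ^ 2) := by
  have h0 : ∀ n, 0 ≤ ‖taylorCoeff f n‖ ^ 2 * moment p a n := fun n =>
    mul_nonneg (sq_nonneg _) (moment_pos ha n).le
  have h1 := lintegral_norm_sq_weight hf ha
  have h2 := (hasFiniteIntegral_iff_ofReal (weight_norm_sq_nonneg a f)).1 hi.2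
  rw [h1] at h2
  have hs : Summable fun n => ‖taylorCoeff f n‖ ^ 2 * moment p a n := by
    have := ENNReal.summable_toReal h2.ne
    simpa only [ENNReal.toReal_ofReal (h0 _)] using this
  rw [integral_eq_lintegral_of_nonneg_ae (weight_norm_sq_nonneg a f) hi.1, h1,
    ← ENNReal.ofReal_tsum_of_nonneg h0 hs, ENNReal.toReal_ofReal (tsum_nonneg h0)]
  exact hs.hasSum

theorem integrableOn_weight_norm_sq {f : (Fin p → ℂ) → ℂ}
    (hf : DifferentiableOn ℂ f (unitBall p)) {a : ℝ} (ha : 0 < a)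
    (hs : Summable fun n => ‖taylorCoeff f n‖ ^ 2 * moment p a n) :
    IntegrableOn (fun z => (1 - ∑ k, ‖z k‖ ^ 2) ^ (a - 1) * ‖f z‖ ^ 2) (unitBall p) := by
  refine ⟨aestronglyMeasurable_weight_norm_sq a hf, ?_⟩
  rw [hasFiniteIntegral_iff_ofReal (weight_norm_sq_nonneg a f), lintegral_norm_sq_weight hf ha,
    ← ENNReal.ofReal_tsum_of_nonneg (fun n => mul_nonneg (sq_nonneg _) (moment_pos ha n).le) hs]
  exact ENNReal.ofReal_lt_top

theorem conj_prod_rot (x : UnitAddTorus (Fin p)) (z : Fin p → ℂ) (n : Fin p → ℕ) :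
    (starRingEnd ℂ) (∏ k, rot x z k ^ n k) =
      UnitAddTorus.mFourier (-fun k => (n k : ℤ)) x * (starRingEnd ℂ) (∏ k, z k ^ n k) := by
  rw [UnitAddTorus.mFourier_neg, ← map_mul, UnitAddTorus.mFourier, ContinuousMap.coe_mk,
    ← Finset.prod_mul_distrib]
  congr 1
  refine Finset.prod_congr rfl fun k _ => ?_
  rw [rot, mul_pow, fourier_one, fourier_apply, natCast_zsmul, AddCircle.toCircle_nsmul,
    Circle.coe_pow]

theorem mul_conj_prod_pow (z : Fin p → ℂ) (n : Fin p → ℕ) :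
    (∏ k, z k ^ n k) * (starRingEnd ℂ) (∏ k, z k ^ n k) =
      ((∏ k, ‖z k‖ ^ (2 * n k) : ℝ) : ℂ) := by
  rw [Complex.mul_conj, Complex.normSq_eq_norm_sq, norm_prod, ← Finset.prod_pow]
  simp only [norm_pow, ← pow_mul, mul_comm]

/-- Integration against a monomial and a torus invariant function picks a Taylor coefficient. -/
theorem integral_mul_conj_monomial {f φ : (Fin p → ℂ) → ℂ}
    (hf : DifferentiableOn ℂ f (unitBall p)) (n : Fin p → ℕ)
    (hφ : ∀ x, ∀ z ∈ unitBall p, φ (rot x z) = φ z)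
    (hi : IntegrableOn (fun z => f z * (starRingEnd ℂ) (∏ k, z k ^ n k) * φ z) (unitBall p)) :
    ∫ z in unitBall p, f z * (starRingEnd ℂ) (∏ k, z k ^ n k) * φ z =
      taylorCoeff f n * ∫ z in unitBall p, ((∏ k, ‖z k‖ ^ (2 * n k) : ℝ) : ℂ) * φ z := by
  rw [integral_unitBall_rot hi, ← integral_const_mul]
  refine setIntegral_congr_fun measurableSet_unitBall fun z hz => ?_
  -- Under rotation the conjugate monomial picks up the character of index -n, so the inner torus
  -- integral is exactly a Fourier coefficient of f.
  have e : ∀ x : UnitAddTorus (Fin p),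
      f (rot x z) * (starRingEnd ℂ) (∏ k, rot x z k ^ n k) * φ (rot x z) =
      ((starRingEnd ℂ) (∏ k, z k ^ n k) * φ z) *
        (UnitAddTorus.mFourier (-fun k => (n k : ℤ)) x * f (rot x z)) := by
    intro x
    rw [conj_prod_rot, hφ x z hz]; ring
  simp only [e]
  rw [integral_const_mul, ← torusCoeff, torusCoeff_eq hf hz, ← mul_conj_prod_pow]
  ring

end Component

/-! ### Power series with square-summable coefficients. -/

section Series

/-- Weierstrass' theorem: Cauchy's estimate converts the uniform bounds on the terms into summable
bounds on their derivatives on a smaller ball. -/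
theorem differentiableOn_tsum_of_bound {ι E : Type*} [NormedAddCommGroup E] [NormedSpace ℂ E]
    {U : Set E} (hU : IsOpen U) {F : ι → E → ℂ} (hF : ∀ i, DifferentiableOn ℂ (F i) U)
    {u : ι → ℝ} (hu : Summable u) (hb : ∀ i, ∀ x ∈ U, ‖F i x‖ ≤ u i) :
    DifferentiableOn ℂ (fun x => ∑' i, F i x) U := by
  intro x hx
  obtain ⟨ε, hε, hεU⟩ := Metric.isOpen_iff.1 hU x hx
  have hsub : ∀ y ∈ Metric.ball x (ε / 2), Metric.ball y (ε / 2) ⊆ U := fun y hy =>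
    (Metric.ball_subset_ball' (by
      have : dist y x < ε / 2 := hy
      linarith)).trans hεU
  have hball : Metric.ball x (ε / 2) ⊆ U := (Metric.ball_subset_ball (by linarith)).trans hεU
  have hx0 : x ∈ Metric.ball x (ε / 2) := Metric.mem_ball_self (half_pos hε)
  let _ : NormedSpace ℝ E := NormedSpace.restrictScalars ℝ ℂ E
  -- On a ball of radius ε/2 around y each term stays within u + u of its value at y, whence the
  -- derivative bound (u + u)/(ε/2).
  refine (hasFDerivAt_tsum_of_isPreconnected (u := fun i => (u i + u i) / (ε / 2))
    (f := F) (f' := fun i y => fderiv ℂ (F i) y) ((hu.add hu).div_const _)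
    Metric.isOpen_ball (convex_ball x (ε / 2)).isPreconnected ?_ ?_ hx0
    (hu.of_norm_bounded fun i => hb i x hx) hx0).differentiableAt.differentiableWithinAt
  · exact fun i y hy => ((hF i).differentiableAt (hU.mem_nhds (hball hy))).hasFDerivAt
  · intro i y hy
    refine Complex.norm_fderiv_le_div_of_mapsTo_ball ((hF i).mono (hsub y hy)) ?_ (half_pos hε)
    intro w hw
    rw [mem_closedBall_iff_norm]
    exact (norm_sub_le _ _).trans (add_le_add (hb i w (hsub y hy hw)) (hb i y (hball hy)))

variable {p : ℕ}

/-- The multinomial theorem: within one total degree the Gamma factor is constant. -/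
theorem sum_piAntidiag_gamma (lam : ℝ) (x : Fin p → ℝ) (m : ℕ) :
    ∑ n ∈ Finset.univ.piAntidiag m, Real.Gamma (((∑ k, n k : ℕ) : ℝ) + lam) /
      (∏ k, ((n k).factorial : ℝ)) * ∏ k, x k ^ n k =
      Real.Gamma (m + lam) / m.factorial * (∑ k, x k) ^ m := by
  rw [Finset.sum_pow_eq_sum_piAntidiag, Finset.mul_sum]
  refine Finset.sum_congr rfl fun n hn => ?_
  have hm : ∑ k, n k = m := (Finset.mem_piAntidiag.1 hn).1
  have h1 : (∏ k, ((n k).factorial : ℝ)) * (Nat.multinomial Finset.univ n : ℝ) = m.factorial := by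
    have := Nat.multinomial_spec Finset.univ n
    rw [hm] at this
    exact_mod_cast this
  have h2 : (∏ k, ((n k).factorial : ℝ)) ≠ 0 := by positivity
  have h3 : (m.factorial : ℝ) ≠ 0 := by positivity
  rw [hm]
  field_simp
  rw [← h1]; ring

theorem summable_gamma_pow {lam : ℝ} (hl : 0 < lam) {X : ℝ} (h0 : 0 ≤ X) (h1 : X < 1) :
    Summable fun m : ℕ => Real.Gamma (m + lam) / m.factorial * X ^ m := by
  -- The ratio test needs nonzero terms, so X = 0 is treated apart.
  rcases h0.eq_or_lt with rfl | h0
  · refine summable_of_ne_finset_zero (s := {0}) fun m hm => ?_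
    rw [zero_pow (by simpa using hm), mul_zero]
  have hpos : ∀ m : ℕ, 0 < Real.Gamma (m + lam) / m.factorial * X ^ m := fun m => by
    have := Real.Gamma_pos_of_pos (by positivity : 0 < (m : ℝ) + lam)
    positivity
  refine summable_of_ratio_test_tendsto_lt_one h1
    (Filter.Eventually.of_forall fun m => (hpos m).ne') ?_
  have e : ∀ m : ℕ, ‖Real.Gamma ((m + 1 : ℕ) + lam) / (m + 1).factorial * X ^ (m + 1)‖ /
      ‖Real.Gamma (m + lam) / m.factorial * X ^ m‖ = X * (1 + (lam - 1) / (m + 1)) := by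
    intro m
    rw [Real.norm_of_nonneg (hpos m).le, Real.norm_of_nonneg (hpos (m + 1)).le]
    have hml : (0 : ℝ) < m + lam := by positivity
    have hg := (Real.Gamma_pos_of_pos hml).ne'
    have : ((m + 1 : ℕ) : ℝ) + lam = m + lam + 1 := by push_cast; ring
    rw [this, Real.Gamma_add_one hml.ne', Nat.factorial_succ]
    push_cast
    have h3 : (m.factorial : ℝ) ≠ 0 := by positivity
    have h4 : (m : ℝ) + 1 ≠ 0 := by positivity
    field_simp
    ring
  simp only [e]
  have h2 : Filter.Tendsto (fun m : ℕ => X * (1 + (lam - 1) / ((m : ℝ) + 1))) Filter.atTop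
      (nhds (X * (1 + 0))) := by
    refine tendsto_const_nhds.mul (tendsto_const_nhds.add ?_)
    exact tendsto_const_nhds.div_atTop
      (Filter.tendsto_atTop_add_const_right _ _ tendsto_natCast_atTop_atTop)
  simpa using h2

theorem summable_of_sum_piAntidiag {F : (Fin p → ℕ) → ℝ} (hpos : ∀ n, 0 ≤ F n) {h : ℕ → ℝ}
    (hs : Summable h) (hu : ∀ m, ∑ n ∈ Finset.univ.piAntidiag m, F n = h m) : Summable F := by
  refine summable_of_sum_le (c := ∑' m, h m) hpos fun u => ?_
  rw [← Finset.sum_fiberwise_of_maps_to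
    (fun n hn => Finset.mem_image_of_mem (fun n : Fin p → ℕ => ∑ k, n k) hn)]
  have h0 : ∀ m, 0 ≤ h m := fun m => hu m ▸ Finset.sum_nonneg fun n _ => hpos n
  have h1 := hs.sum_le_tsum (u.image fun n : Fin p → ℕ => ∑ k, n k) fun m _ => h0 m
  refine (Finset.sum_le_sum fun m _ => ?_).trans h1
  rw [← hu]
  refine Finset.sum_le_sum_of_subset_of_nonneg (fun n hn => ?_) fun n _ _ => hpos n
  rw [Finset.mem_piAntidiag]
  exact ⟨(Finset.mem_filter.1 hn).2, fun _ _ => Finset.mem_univ _⟩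

theorem summable_multinomial_gamma {lam : ℝ} (hl : 0 < lam) {x : Fin p → ℝ} (h0 : ∀ k, 0 ≤ x k)
    (h1 : ∑ k, x k < 1) :
    Summable fun n : Fin p → ℕ => Real.Gamma (((∑ k, n k : ℕ) : ℝ) + lam) /
      (∏ k, ((n k).factorial : ℝ)) * ∏ k, x k ^ n k := by
  refine summable_of_sum_piAntidiag (fun n => ?_)
    (summable_gamma_pow hl (Finset.sum_nonneg fun k _ => h0 k) h1) (sum_piAntidiag_gamma lam x)
  have h2 := Real.Gamma_pos_of_pos (by positivity : 0 < ((∑ k, n k : ℕ) : ℝ) + lam)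
  have h3 : 0 ≤ ∏ k, x k ^ n k := Finset.prod_nonneg fun k _ => pow_nonneg (h0 k) _
  positivity

/-- |c_n| |z^n| ≤ |c_n|² m_n + |z^n|²/m_n with m_n the moment. The second series is the diagonal of
the reproducing kernel, summable on the whole ball by the multinomial expansion. -/
theorem summable_norm_monomial {a : ℝ} (ha : 0 < a) {c : (Fin p → ℕ) → ℂ}
    (hc : Summable fun n => ‖c n‖ ^ 2 * moment p a n) {z : Fin p → ℂ} (hz : z ∈ unitBall p) :
    Summable fun n => ‖c n‖ * ∏ k, ‖z k‖ ^ n k := by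
  have h1 := summable_multinomial_gamma (lam := p + a) (by positivity)
    (x := fun k => ‖z k‖ ^ 2) (fun k => sq_nonneg _) hz
  have hG : 0 < Real.pi ^ p * Real.Gamma a := mul_pos (by positivity) (Real.Gamma_pos_of_pos ha)
  refine Summable.of_nonneg_of_le (fun n => by positivity) (fun n => ?_)
    ((hc.add (h1.mul_left (Real.pi ^ p * Real.Gamma a)⁻¹)))
  have hm := moment_pos ha n
  have e : (Real.pi ^ p * Real.Gamma a)⁻¹ * (Real.Gamma (((∑ k, n k : ℕ) : ℝ) + (p + a)) /
      (∏ k, ((n k).factorial : ℝ)) * ∏ k, (‖z k‖ ^ 2) ^ n k) =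
      (∏ k, ‖z k‖ ^ n k) ^ 2 / moment p a n := by
    have h2 : (∏ k, ((n k).factorial : ℝ)) ≠ 0 := by positivity
    rw [moment, ← Finset.prod_pow, add_assoc]
    have h3 : ∏ k, (‖z k‖ ^ 2) ^ n k = ∏ k, (‖z k‖ ^ n k) ^ 2 :=
      Finset.prod_congr rfl fun k _ => by rw [← pow_mul, ← pow_mul, mul_comm]
    have h4 := Real.Gamma_pos_of_pos (by positivity : 0 < ((∑ k, n k : ℕ) : ℝ) + (p + a))
    have h5 := Real.Gamma_pos_of_pos ha
    rw [h3]
    field_simp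
  rw [e]
  have hP : 0 ≤ ∏ k, ‖z k‖ ^ n k := by positivity
  generalize ∏ k, ‖z k‖ ^ n k = P at hP ⊢
  generalize moment p a n = m at hm ⊢
  have h5 : ‖c n‖ * P = (‖c n‖ * Real.sqrt m) * (P / Real.sqrt m) := by
    have := (Real.sqrt_pos.2 hm).ne'
    field_simp
  have h6 : P ^ 2 / m = (P / Real.sqrt m) ^ 2 := by rw [div_pow, Real.sq_sqrt hm.le]
  have h7 : ‖c n‖ ^ 2 * m = (‖c n‖ * Real.sqrt m) ^ 2 := by rw [mul_pow, Real.sq_sqrt hm.le]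
  rw [h5, h6, h7]
  nlinarith [sq_nonneg (‖c n‖ * Real.sqrt m - P / Real.sqrt m),
    sq_nonneg (‖c n‖ * Real.sqrt m), sq_nonneg (P / Real.sqrt m)]

/-- The power series with coefficients `c`. -/
noncomputable def powerSeries (c : (Fin p → ℕ) → ℂ) (z : Fin p → ℂ) : ℂ :=
  ∑' n, c n * ∏ k, z k ^ n k

theorem differentiable_monomial (n : Fin p → ℕ) :
    Differentiable ℂ fun z : Fin p → ℂ => ∏ k, z k ^ n k := by
  induction (Finset.univ : Finset (Fin p)) using Finset.cons_induction with
  | empty => simp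
  | cons j s hj ih =>
    simp only [Finset.prod_cons]
    exact ((differentiable_apply j).pow _).mul ih

theorem differentiableOn_powerSeries {c : (Fin p → ℕ) → ℂ}
    (hc : ∀ z ∈ unitBall p, Summable fun n => ‖c n‖ * ∏ k, ‖z k‖ ^ n k) :
    DifferentiableOn ℂ (powerSeries c) (unitBall p) := by
  intro z hz
  -- Enlarging every modulus by a small δ keeps the point in the ball. The series at the enlarged
  -- point dominates the given one on the polydisc of radius δ about z, which is the sup-norm ball.
  have hcont : Continuous fun t : ℝ => ∑ k, (‖z k‖ + t) ^ 2 := by fun_prop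
  have hev : ∀ᶠ t in nhds (0 : ℝ), ∑ k, (‖z k‖ + t) ^ 2 < 1 :=
    hcont.continuousAt.eventually_lt continuousAt_const
      (by simpa using (show ∑ k, ‖z k‖ ^ 2 < 1 from hz))
  obtain ⟨δ, hδ, hlt⟩ : ∃ δ : ℝ, 0 < δ ∧ ∑ k, (‖z k‖ + δ) ^ 2 < 1 := by
    obtain ⟨ε, hε, h⟩ := Metric.eventually_nhds_iff.1 hev
    refine ⟨ε / 2, half_pos hε, h ?_⟩
    rw [Real.dist_eq, sub_zero, abs_of_pos (half_pos hε)]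
    linarith
  have hn : ∀ k, ‖((‖z k‖ + δ : ℝ) : ℂ)‖ = ‖z k‖ + δ := fun k => by
    rw [Complex.norm_real, Real.norm_of_nonneg (by positivity)]
  have hs := hc (fun k => ((‖z k‖ + δ : ℝ) : ℂ)) (by
    simp only [unitBall, Set.mem_ofPred_eq, hn]; exact hlt)
  simp only [hn] at hs
  have := differentiableOn_tsum_of_bound (U := Metric.ball z δ) Metric.isOpen_ball
    (F := fun (n : Fin p → ℕ) (z : Fin p → ℂ) => c n * ∏ k, z k ^ n k)
    (fun n => ((differentiable_monomial n).const_mul (c n)).differentiableOn) hs (fun n w hw => by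
      rw [norm_mul, norm_prod]
      refine mul_le_mul_of_nonneg_left (Finset.prod_le_prod (fun _ _ => norm_nonneg _)
        fun k _ => ?_) (norm_nonneg _)
      rw [norm_pow]
      refine pow_le_pow_left₀ (norm_nonneg _) ?_ _
      have h1 : ‖w - z‖ < δ := by simpa [dist_eq_norm] using hw
      have h2 := norm_le_pi_norm (w - z) k
      have h3 := norm_sub_norm_le (w k) (z k)
      rw [Pi.sub_apply] at h2
      linarith)
  exact ((this z (Metric.mem_ball_self hδ)).differentiableAt
    (Metric.ball_mem_nhds z hδ)).differentiableWithinAt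

theorem integral_mFourier (m : Fin p → ℤ) :
    ∫ x, UnitAddTorus.mFourier m x ∂torusMeasure p = if m = 0 then 1 else 0 := by
  have h := integral_fintype_prod_eq_prod (𝕜 := ℂ)
    (μ := fun _ : Fin p => AddCircle.haarAddCircle (T := 1))
    (fun (k : Fin p) (y : UnitAddCircle) => (fourier (m k) y : ℂ))
  have h1 : ∀ k : ℤ, ∫ y : UnitAddCircle, (fourier k y : ℂ) ∂AddCircle.haarAddCircle =
      if k = 0 then 1 else 0 := by
    intro k
    have := congrFun (fourierCoeff_fourier (T := 1) k) 0
    rw [fourierCoeff] at this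
    simp only [neg_zero, fourier_zero, one_smul] at this
    rw [this, Pi.single_apply]
    simp only [eq_comm]
  simp only [h1] at h
  refine h.trans ?_
  rw [Finset.prod_ite_zero]
  simp [funext_iff]

theorem prod_rot_pow (x : UnitAddTorus (Fin p)) (z : Fin p → ℂ) (n : Fin p → ℕ) :
    ∏ k, rot x z k ^ n k = UnitAddTorus.mFourier (fun k => (n k : ℤ)) x * ∏ k, z k ^ n k := by
  rw [UnitAddTorus.mFourier, ContinuousMap.coe_mk, ← Finset.prod_mul_distrib]
  refine Finset.prod_congr rfl fun k _ => ?_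
  rw [rot, mul_pow, fourier_one, fourier_apply, natCast_zsmul, AddCircle.toCircle_nsmul,
    Circle.coe_pow]

theorem norm_mFourier_apply (n : Fin p → ℤ) (x : UnitAddTorus (Fin p)) :
    ‖UnitAddTorus.mFourier n x‖ = 1 := by
  simp only [UnitAddTorus.mFourier, ContinuousMap.coe_mk, norm_prod, norm_fourier,
    Finset.prod_const_one]

/-- Termwise integration over the torus through the base point, where the series converges
absolutely, followed by orthogonality of characters. -/
theorem taylorCoeff_powerSeries {c : (Fin p → ℕ) → ℂ}
    (hc : ∀ z ∈ unitBall p, Summable fun n => ‖c n‖ * ∏ k, ‖z k‖ ^ n k) (n : Fin p → ℕ) :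
    taylorCoeff (powerSeries c) n = c n := by
  set z : Fin p → ℂ := fun _ => (p + 1 : ℂ)⁻¹ with hz
  have hzB : z ∈ unitBall p := const_mem_unitBall
  have hz0 : ∏ k, z k ^ n k ≠ 0 := Finset.prod_ne_zero_iff.2 fun _ _ =>
    pow_ne_zero _ (inv_ne_zero (by exact_mod_cast Nat.succ_ne_zero p))
  have hs : Summable fun m => ‖c m * ∏ k, z k ^ m k‖ := by
    simpa only [norm_mul, norm_prod, norm_pow] using hc z hzB
  rw [taylorCoeff, div_eq_iff hz0]
  have h := hasSum_integral_of_summable_integral_norm (μ := torusMeasure p)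
    (F := fun (m : Fin p → ℕ) x => UnitAddTorus.mFourier (-fun k => (n k : ℤ)) x *
      (c m * ∏ k, rot x z k ^ m k))
    (fun m => (Continuous.integrable_of_hasCompactSupport (by unfold rot; fun_prop)
        (HasCompactSupport.of_compactSpace _)))
    (by
      simp only [prod_rot_pow, norm_mul, norm_mFourier_apply, one_mul]
      simpa using hs)
  have e1 : (∫ x, ∑' m, UnitAddTorus.mFourier (-fun k => (n k : ℤ)) x *
      (c m * ∏ k, rot x z k ^ m k) ∂torusMeasure p) =
      torusCoeff (powerSeries c) z (fun k => n k) := by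
    rw [torusCoeff]
    congr 1
    funext x
    rw [tsum_mul_left]; rfl
  have e2 : ∀ m : Fin p → ℕ, (∫ x, UnitAddTorus.mFourier (-fun k => (n k : ℤ)) x *
      (c m * ∏ k, rot x z k ^ m k) ∂torusMeasure p) =
      if m = n then c n * ∏ k, z k ^ n k else 0 := by
    intro m
    have : ∀ x, UnitAddTorus.mFourier (-fun k => (n k : ℤ)) x * (c m * ∏ k, rot x z k ^ m k) =
        UnitAddTorus.mFourier ((-fun k => (n k : ℤ)) + fun k => (m k : ℤ)) x *
          (c m * ∏ k, z k ^ m k) := fun x => by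
      rw [prod_rot_pow, UnitAddTorus.mFourier_add]; ring
    simp only [this]
    rw [integral_mul_const, integral_mFourier]
    have : ((-fun k => (n k : ℤ)) + fun k => (m k : ℤ)) = 0 ↔ m = n := by
      simp only [funext_iff, Pi.add_apply, Pi.neg_apply, Pi.zero_apply]
      exact forall_congr' fun k => by omega
    simp only [this]
    split_ifs with h
    · rw [h, one_mul]
    · rw [zero_mul]
  rw [e1] at h
  simp only [e2] at h
  exact h.unique (hasSum_ite_eq n _)

end Series

/-! ### Grassmann computations and the shape of quasi-elliptic symbols. -/

section OddVariables

variable {q : ℕ}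

theorem prod_pr_commute (l : List (Fin q)) (x : Grassmann q) : Commute (l.map pr).prod x := by
  induction l with
  | nil => exact Commute.one_left x
  | cons i l ih => simpa using (pr_commute i x).mul_left ih

/-- Each nested pair ξ_i ξ̄_i equals -ξ̄_i ξ_i, and the products ξ̄_i ξ_i are central. This is the
source of the sign in the multiplier. -/
theorem xiProd_mul_xiStar_list (l : List (Fin q)) :
    (l.map xi).prod * (l.reverse.map xiBar).prod = (-1 : ℂ) ^ l.length • (l.map pr).prod := by
  induction l with
  | nil => simp
  | cons i l ih =>
    have h : xi i * (l.map pr).prod * xiBar i = -(pr i * (l.map pr).prod) := by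
      rw [mul_assoc, (prod_pr_commute l _).eq, ← mul_assoc, ← neg_xi_mul, neg_mul, neg_neg]
    simp only [List.reverse_cons, List.map_append, List.prod_append, List.map_cons, List.map_nil,
      List.prod_cons, List.prod_nil, mul_one, List.length_cons]
    calc xi i * (l.map xi).prod * ((l.reverse.map xiBar).prod * xiBar i)
        = xi i * ((l.map xi).prod * (l.reverse.map xiBar).prod) * xiBar i := by
          simp only [mul_assoc]
      _ = _ := by
          rw [ih, mul_smul_comm, smul_mul_assoc, h, pow_succ, mul_neg_one, neg_smul, smul_neg]

theorem xiProd_mul_xiStar (I : Finset (Fin q)) :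
    xiProd I * xiStar I = (-1 : ℂ) ^ I.card • ((I.sort (· ≤ ·)).map pr).prod := by
  rw [xiProd, xiStar, xiProd_mul_xiStar_list, Finset.length_sort]

/-- If I meets M a generator is repeated and the product is zero; otherwise the two diagonal
products merge into that of I ∪ M. -/
theorem berezin_pow_pr_mul (k : ℕ) (I M N : Finset (Fin q)) :
    berezin q (negXiXiBar q ^ k * (((I.sort (· ≤ ·)).map pr).prod * (xiStar M * xiProd N))) =
      if M = N ∧ Disjoint I M ∧ k + (I ∪ M).card = q then (k.factorial : ℂ) else 0 := by
  by_cases hMN : M = N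
  · subst hMN
    rw [xiStar_mul_xiProd, ← List.prod_append, ← List.map_append]
    by_cases hd : Disjoint I M
    · have hn : (I.sort (· ≤ ·) ++ M.sort (· ≤ ·)).Nodup := by
        rw [List.nodup_append]
        refine ⟨Finset.sort_nodup _ _, Finset.sort_nodup _ _, fun a ha b hb => ?_⟩
        exact Finset.disjoint_iff_ne.1 hd a (by simpa using ha) b (by simpa using hb)
      rw [berezin_pow_pr_prod _ _ hn, Finset.card_union_of_disjoint hd]
      simp [hd]
    · rw [pr_prod_eq_word, word_eq_zero, mul_zero, map_zero, if_neg (by tauto)]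
      intro hn
      obtain ⟨i, hI, hM⟩ := Finset.not_disjoint_iff.1 hd
      rw [List.flatMap_append, List.nodup_append] at hn
      exact hn.2.2 (Sum.inl i) (by simpa using hI) (Sum.inl i) (by simpa using hM) rfl
  · rw [berezin_pow_off _ _ _ _ hMN, if_neg (by tauto)]

/-- Inserting ξ_I ξ_I^* makes the component M see the weight belonging to I ∪ M: the odd variables
of I are already used up, so the expansion of the power contributes fewer of them. -/
theorem berezin_superPow_diag (x a : ℝ) (I M N : Finset (Fin q)) :
    berezin q (superPow q x a * (xiStar M * (xiProd I * xiStar I * xiProd N))) =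
      if M = N ∧ Disjoint I M then (-1 : ℂ) ^ I.card *
        (((descPochhammer ℝ (q - (I ∪ M).card)).eval a *
          x ^ (a - ((q - (I ∪ M).card : ℕ) : ℝ)) : ℝ) : ℂ)
      else 0 := by
  have e : xiStar M * (xiProd I * xiStar I * xiProd N) =
      (-1 : ℂ) ^ I.card • (((I.sort (· ≤ ·)).map pr).prod * (xiStar M * xiProd N)) := by
    rw [xiProd_mul_xiStar, smul_mul_assoc, mul_smul_comm, ← mul_assoc,
      ← (prod_pr_commute _ (xiStar M)).eq, mul_assoc]
  rw [e, superPow, Finset.sum_mul, map_sum]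
  simp only [mul_smul_comm, smul_mul_assoc, map_smul, berezin_pow_pr_mul, smul_eq_mul]
  have hK : (I ∪ M).card ≤ q := by simpa using Finset.card_le_univ (I ∪ M)
  split_ifs with h
  · rw [Finset.sum_eq_single (q - (I ∪ M).card)]
    · rw [if_pos ⟨h.1, h.2, by omega⟩]
      have : ((q - (I ∪ M).card).factorial : ℂ) ≠ 0 := by exact_mod_cast Nat.factorial_ne_zero _
      push_cast
      field_simp
    · intro k _ hk
      rw [if_neg (by omega), mul_zero, mul_zero]
    · intro hn
      exact absurd (Finset.mem_range.2 (by omega)) hn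
  · refine Finset.sum_eq_zero fun k _ => ?_
    rw [if_neg (by tauto), mul_zero, mul_zero]

theorem gen_mul_gen (j k : Fin q ⊕ Fin q) : (gen j * gen k : Grassmann q) = -(gen k * gen j) :=
  eq_neg_of_add_eq_zero_left (ExteriorAlgebra.ι_add_mul_swap (R := ℂ)
    (Pi.single j 1 : Fin q ⊕ Fin q → ℂ) (Pi.single k 1))

theorem word_perm {v w : List (Fin q ⊕ Fin q)} (h : v.Perm w) :
    word v = word w ∨ word v = -word w := by
  induction h with
  | nil => exact Or.inl rfl
  | cons x _ ih =>
    simp only [word, List.map_cons, List.prod_cons] at ih ⊢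
    rcases ih with ih | ih <;> simp [ih]
  | swap x y l =>
    right
    simp only [word, List.map_cons, List.prod_cons]
    rw [← mul_assoc, gen_mul_gen, neg_mul, mul_assoc]
  | trans _ _ ih1 ih2 =>
    rcases ih1 with ih1 | ih1 <;> rcases ih2 with ih2 | ih2 <;> simp [ih1, ih2]

theorem berezin_word_ne_zero {w : List (Fin q ⊕ Fin q)} (hn : w.Nodup) (hw : ∀ j, j ∈ w) :
    berezin q (word w) ≠ 0 := by
  set v : List (Fin q ⊕ Fin q) := (List.finRange q).flatMap fun i => [Sum.inr i, Sum.inl i]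
  have hv : berezin q (word v) = 1 := by
    rw [← pr_prod_eq_word, berezin_pr_prod _ (List.nodup_finRange q), if_pos (by simp)]
  have hnv : v.Nodup := by
    by_contra h
    rw [word_eq_zero v h, map_zero] at hv
    exact zero_ne_one hv
  have hp : w.Perm v := (List.perm_ext_iff_of_nodup hn hnv).2 fun j => by
    rcases j with j | j <;> simp [hw, v]
  rcases word_perm hp with h | h <;> simp [h, hv]

/-- The generators complementary to those of `ξ_I ξ_J^*`. -/
noncomputable def complWord (I J : Finset (Fin q)) : List (Fin q ⊕ Fin q) :=
  (Iᶜ.sort (· ≤ ·)).map Sum.inl ++ (Jᶜ.sort (· ≤ ·)).map Sum.inr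

theorem xiProd_mul_xiStar_eq_word (I J : Finset (Fin q)) :
    xiProd I * xiStar J =
      word ((I.sort (· ≤ ·)).map Sum.inl ++ (J.sort (· ≤ ·)).reverse.map Sum.inr) := by
  rw [xiProd_eq_word, xiStar_eq_word, word_append]

theorem berezin_complWord_self (I J : Finset (Fin q)) :
    berezin q (word (complWord I J) * (xiProd I * xiStar J)) ≠ 0 := by
  rw [xiProd_mul_xiStar_eq_word, ← word_append]
  apply berezin_word_ne_zero
  · have hl : Function.Injective (Sum.inl : Fin q → Fin q ⊕ Fin q) := Sum.inl_injective
    have hr : Function.Injective (Sum.inr : Fin q → Fin q ⊕ Fin q) := Sum.inr_injective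
    simp only [complWord, List.nodup_append, List.nodup_map_iff hl, List.nodup_map_iff hr,
      Finset.sort_nodup, List.nodup_reverse, List.mem_append, List.mem_map, Finset.mem_sort,
      List.mem_reverse, Finset.mem_compl]
    aesop
  · intro j
    rcases j with j | j <;> simp [complWord] <;> tauto

theorem berezin_complWord_of_ne {I J I' J' : Finset (Fin q)} (h : ¬(I' = I ∧ J' = J)) :
    berezin q (word (complWord I J) * (xiProd I' * xiStar J')) = 0 := by
  rw [xiProd_mul_xiStar_eq_word, ← word_append]
  have hc : (∃ i, i ∈ I' ∧ i ∉ I) ∨ (∃ i, i ∉ I' ∧ i ∈ I) ∨ (∃ i, i ∈ J' ∧ i ∉ J) ∨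
      ∃ i, i ∉ J' ∧ i ∈ J := by
    by_contra! hc
    obtain ⟨h1, h2, h3, h4⟩ := hc
    refine h ⟨Finset.ext fun i => ⟨h1 i, fun hi => ?_⟩, Finset.ext fun i => ⟨h3 i, fun hi => ?_⟩⟩
    · by_contra hn; exact h2 i hn hi
    · by_contra hn; exact h4 i hn hi
  rcases hc with ⟨i, hi, hi'⟩ | ⟨i, hi, hi'⟩ | ⟨i, hi, hi'⟩ | ⟨i, hi, hi'⟩
  · rw [word_eq_zero, map_zero]
    intro hn
    exact (List.nodup_append.1 hn).2.2 (Sum.inl i) (by simp [complWord, hi']) (Sum.inl i)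
      (by simp [hi]) rfl
  · exact berezin_eq_zero (Sum.inl i) _ (pd_word _ _ (by simp [complWord, hi, hi']))
  · rw [word_eq_zero, map_zero]
    intro hn
    exact (List.nodup_append.1 hn).2.2 (Sum.inr i) (by simp [complWord, hi']) (Sum.inr i)
      (by simp [hi]) rfl
  · exact berezin_eq_zero (Sum.inr i) _ (pd_word _ _ (by simp [complWord, hi, hi']))

/-- Linear independence of the ξ_I ξ_J^*: multiplying by the complementary word and taking the
Berezin integral is a nonzero multiple of the dual functional, since any other pair (I', J') has a
repeated or a missing generator. -/
theorem eq_of_sum_smul_xi_eq {a b : Finset (Fin q) → Finset (Fin q) → ℂ}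
    (h : ∑ I, ∑ J, a I J • (xiProd I * xiStar J) = ∑ I, ∑ J, b I J • (xiProd I * xiStar J)) :
    a = b := by
  have key : ∀ (c : Finset (Fin q) → Finset (Fin q) → ℂ) (I J : Finset (Fin q)),
      berezin q (word (complWord I J) * ∑ I, ∑ J, c I J • (xiProd I * xiStar J)) =
        c I J * berezin q (word (complWord I J) * (xiProd I * xiStar J)) := by
    intro c I J
    simp only [Finset.mul_sum, map_sum, mul_smul_comm, map_smul, smul_eq_mul]
    rw [Finset.sum_eq_single I, Finset.sum_eq_single J]
    · intro J' _ hJ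
      rw [berezin_complWord_of_ne (by tauto), mul_zero]
    · simp
    · intro I' _ hI
      refine Finset.sum_eq_zero fun J' _ => ?_
      rw [berezin_complWord_of_ne (by tauto), mul_zero]
    · simp
  funext I J
  have h1 := key a I J
  rw [h, key b I J] at h1
  exact (mul_right_cancel₀ (berezin_complWord_self I J) h1).symm

theorem oddRotation_xi (s : Fin q → Circle) (i : Fin q) :
    oddRotation s (xi i) = (s i : ℂ) • xi i := by
  rw [oddRotation, xi, gen, ExteriorAlgebra.map_apply_ι, ← map_smul]
  congr 1
  funext j
  by_cases hj : j = Sum.inl i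
  · subst hj; simp
  · simp [hj]

theorem oddRotation_xiBar (s : Fin q → Circle) (i : Fin q) :
    oddRotation s (xiBar i) = (starRingEnd ℂ) (s i : ℂ) • xiBar i := by
  rw [oddRotation, xiBar, gen, ExteriorAlgebra.map_apply_ι, ← map_smul]
  congr 1
  funext j
  by_cases hj : j = Sum.inr i
  · subst hj; simp
  · simp [hj]

theorem oddRotation_xiProd (s : Fin q → Circle) (I : Finset (Fin q)) :
    oddRotation s (xiProd I) = (∏ i ∈ I, (s i : ℂ)) • xiProd I := by
  have h : ∀ l : List (Fin q), oddRotation s (l.map xi).prod =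
      (l.map fun i => (s i : ℂ)).prod • (l.map xi).prod := by
    intro l
    induction l with
    | nil => simp
    | cons i l ih =>
      simp only [List.map_cons, List.prod_cons, map_mul, ih, oddRotation_xi, smul_mul_assoc,
        mul_smul_comm, smul_smul]
      rw [mul_comm]
  rw [xiProd, h, ← List.prod_toFinset _ (Finset.sort_nodup _ _), Finset.sort_toFinset]

theorem oddRotation_xiStar (s : Fin q → Circle) (J : Finset (Fin q)) :
    oddRotation s (xiStar J) = (∏ i ∈ J, (starRingEnd ℂ) (s i : ℂ)) • xiStar J := by
  have h : ∀ l : List (Fin q), oddRotation s (l.map xiBar).prod =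
      (l.map fun i => (starRingEnd ℂ) (s i : ℂ)).prod • (l.map xiBar).prod := by
    intro l
    induction l with
    | nil => simp
    | cons i l ih =>
      simp only [List.map_cons, List.prod_cons, map_mul, ih, oddRotation_xiBar, smul_mul_assoc,
        mul_smul_comm, smul_smul]
      rw [mul_comm]
  rw [xiStar, h, ← List.prod_toFinset _ (List.nodup_reverse.2 (Finset.sort_nodup _ _)),
    List.toFinset_reverse, Finset.sort_toFinset]

variable {p : ℕ}

theorem oddRotation_val (s : Fin q → Circle) (F : SuperFunction p q) (z : Fin p → ℂ) :
    oddRotation s (F.val z) = ∑ I, ∑ J, (F I J z * ((∏ i ∈ I, (s i : ℂ)) *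
      ∏ i ∈ J, (starRingEnd ℂ) (s i : ℂ))) • (xiProd I * xiStar J) := by
  simp only [SuperFunction.val, map_sum, map_smul, map_mul, oddRotation_xiProd, oddRotation_xiStar,
    smul_mul_assoc, mul_smul_comm, smul_smul]
  refine Finset.sum_congr rfl fun I _ => Finset.sum_congr rfl fun J _ => ?_
  rw [mul_comm (∏ i ∈ J, _)]

theorem IsQuasiElliptic.coeff_eq {F : SuperFunction p q} (hF : IsQuasiElliptic F)
    (t : Fin p → Circle) (s : Fin q → Circle) {z : Fin p → ℂ} (hz : z ∈ unitBall p)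
    (I J : Finset (Fin q)) :
    F I J (fun k => (t k : ℂ) * z k) * ((∏ i ∈ I, (s i : ℂ)) *
      ∏ i ∈ J, (starRingEnd ℂ) (s i : ℂ)) = F I J z := by
  have h := hF t s z hz
  rw [oddRotation_val] at h
  exact congrFun (congrFun (eq_of_sum_smul_xi_eq h) I) J

theorem IsQuasiElliptic.rotate {F : SuperFunction p q} (hF : IsQuasiElliptic F)
    (t : Fin p → Circle) {z : Fin p → ℂ} (hz : z ∈ unitBall p) (I J : Finset (Fin q)) :
    F I J (fun k => (t k : ℂ) * z k) = F I J z := by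
  simpa using hF.coeff_eq t (fun _ => 1) hz I J

theorem IsQuasiElliptic.off_diagonal {F : SuperFunction p q} (hF : IsQuasiElliptic F)
    {z : Fin p → ℂ} (hz : z ∈ unitBall p) {I J : Finset (Fin q)} (hIJ : I ≠ J) :
    F I J z = 0 := by
  obtain ⟨i, hi⟩ : ∃ i, (i ∈ I ∧ i ∉ J) ∨ (i ∉ I ∧ i ∈ J) := by
    by_contra! hc
    exact hIJ (Finset.ext fun i => ⟨(hc i).1, fun hJ => by
      by_contra hI; exact (hc i).2 hI hJ⟩)
  -- Rotating only ξ_i by -1, with i in exactly one of I and J, changes the sign of the coefficient,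
  -- which invariance says is unchanged.
  have h := hF.coeff_eq (fun _ => 1) (fun k => if k = i then Circle.exp Real.pi else 1) hz I J
  have e : ∀ k, (((if k = i then Circle.exp Real.pi else 1 : Circle)) : ℂ) =
      if k = i then -1 else 1 := fun k => by
    split_ifs <;> simp
  simp only [e, apply_ite (starRingEnd ℂ), map_neg, map_one, Finset.prod_ite_eq', Circle.coe_one,
    one_mul] at h
  have h2 : F I J z * (-1) = F I J z := by
    rcases hi with ⟨h1, h2⟩ | ⟨h1, h2⟩ <;> simpa [h1, h2] using h
  have h3 : (2 : ℂ) * F I J z = 0 := by linear_combination -h2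
  simpa using h3

theorem IsQuasiElliptic.val_eq {F : SuperFunction p q} (hF : IsQuasiElliptic F)
    {z : Fin p → ℂ} (hz : z ∈ unitBall p) :
    F.val z = ∑ I, F I I z • (xiProd I * xiStar I) := by
  rw [SuperFunction.val]
  refine Finset.sum_congr rfl fun I _ => ?_
  rw [Finset.sum_eq_single I]
  · intro J _ hJ
    rw [hF.off_diagonal hz hJ.symm, zero_smul]
  · simp

theorem IsQuasiElliptic.superIntegrand_eq {F : SuperFunction p q} (hF : IsQuasiElliptic F)
    (ν : ℝ) (Θ Ψ : SuperHol p q) {z : Fin p → ℂ} (hz : z ∈ unitBall p) :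
    superIntegrand ν Θ (fun z => F.val z * Ψ.val z) z =
      ∑ M, ∑ K ∈ Finset.univ.filter (fun K => M ⊆ K), (-1 : ℂ) ^ (K \ M).card *
        (F (K \ M) (K \ M) z * ((compWeight p q ν K z : ℂ) *
          ((starRingEnd ℂ) (Θ M z) * Ψ M z))) := by
  simp only [superIntegrand, hF.val_eq hz, SuperHol.starVal, SuperHol.val, Finset.sum_mul,
    Finset.mul_sum, map_sum, smul_mul_assoc, mul_smul_comm, map_smul, superWeight,
    berezin_superPow_diag, smul_eq_mul]
  refine Finset.sum_congr rfl fun M _ => ?_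
  rw [Finset.sum_comm, Finset.sum_eq_single M]
  · have e : ∀ K ∈ Finset.univ.filter (fun K => M ⊆ K), (K \ M) ∪ M = K := fun K hK =>
      Finset.sdiff_union_of_subset (Finset.mem_filter.1 hK).2
    rw [← Finset.sum_filter_add_sum_filter_not Finset.univ (fun I => Disjoint I M),
      Finset.sum_eq_zero (s := Finset.univ.filter fun I => ¬Disjoint I M), add_zero]
    -- Sets I disjoint from M correspond to supersets K of M through K = I ∪ M and I = K \ M.
    · refine Finset.sum_nbij' (fun I => I ∪ M) (fun K => K \ M) ?_ ?_ ?_ e ?_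
      · intro I _; simp
      · intro K _; simp [Finset.sdiff_disjoint]
      · intro I hI
        exact Finset.union_sdiff_cancel_right (Finset.mem_filter.1 hI).2
      · intro I hI
        have hd := (Finset.mem_filter.1 hI).2
        rw [if_pos ⟨rfl, hd⟩, Finset.union_sdiff_cancel_right hd, compWeight]
        ring
    · intro I hI
      rw [if_neg (fun h => (Finset.mem_filter.1 hI).2 h.2)]
      simp
  · intro N _ hN
    refine Finset.sum_eq_zero fun I _ => ?_
    rw [if_neg (fun h => hN h.1)]
    simp
  · simp

end OddVariables

/-! ### Polar coordinates in each complex variable. -/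

section Polar

variable {p : ℕ}

/-- Separating the tuple of radii from the tuple of angles, the angles contribute the volume (2π)^p.
No integrability of `g` is required, as the product formula holds unconditionally. -/
theorem integral_pi_polar (g : (Fin p → ℝ) → ℂ) :
    ∫ x in Set.univ.pi fun _ : Fin p => Complex.polarCoord.target, g (fun k => (x k).1) =
      (2 * Real.pi : ℝ) ^ p * ∫ r in Set.univ.pi fun _ : Fin p => Set.Ioi (0 : ℝ), g r := by
  have hmp := volume_measurePreserving_arrowProdEquivProdArrow ℝ ℝ (Fin p)
  have hset : (Set.univ.pi fun _ : Fin p => Complex.polarCoord.target) =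
      (MeasurableEquiv.arrowProdEquivProdArrow ℝ ℝ (Fin p)) ⁻¹'
        ((Set.univ.pi fun _ : Fin p => Set.Ioi (0 : ℝ)) ×ˢ
          (Set.univ.pi fun _ : Fin p => Set.Ioo (-Real.pi) Real.pi)) := by
    ext x
    simp only [Complex.polarCoord_target, Set.mem_pi, Set.mem_preimage, Set.mem_prod,
      Set.mem_univ, true_imp_iff]
    exact forall_and
  have h1 := hmp.setIntegral_preimage_emb
    (MeasurableEquiv.arrowProdEquivProdArrow ℝ ℝ (Fin p)).measurableEmbedding
    (fun y : (Fin p → ℝ) × (Fin p → ℝ) => g y.1 * (1 : ℂ))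
    ((Set.univ.pi fun _ : Fin p => Set.Ioi (0 : ℝ)) ×ˢ
          (Set.univ.pi fun _ : Fin p => Set.Ioo (-Real.pi) Real.pi))
  rw [← hset, Measure.volume_eq_prod, setIntegral_prod_mul (f := g) (g := fun _ => (1 : ℂ))] at h1
  have h2 : ∫ _ in Set.univ.pi fun _ : Fin p => Set.Ioo (-Real.pi) Real.pi, (1 : ℂ) =
      (2 * Real.pi : ℝ) ^ p := by
    rw [setIntegral_const, measureReal_def, Real.volume_pi_Ioo]
    have : Real.pi - -Real.pi = 2 * Real.pi := by ring
    rw [this, Finset.prod_const, ENNReal.toReal_pow, ENNReal.toReal_ofReal (by positivity)]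
    simp
  rw [h2, mul_comm] at h1
  rw [← h1]
  simp only [mul_one]
  rfl

theorem measurableSet_ballBase : MeasurableSet (ballBase p) := by
  have h : ballBase p = (⋂ k, {r : Fin p → ℝ | 0 ≤ r k}) ∩ {r | ∑ k, r k ^ 2 < 1} := by
    ext r; simp [ballBase]
  rw [h]
  refine (MeasurableSet.iInter fun k => ?_).inter ?_
  · exact measurableSet_le measurable_const (measurable_pi_apply k)
  · exact measurableSet_lt (by fun_prop) measurable_const

theorem ofReal_mem_unitBall {r : Fin p → ℝ} :
    (fun k => (r k : ℂ)) ∈ unitBall p ↔ ∑ k, r k ^ 2 < 1 := by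
  simp [unitBall]

/-- Polar coordinates in each variable for a function on the ball that depends on the moduli of
the variables only. -/
theorem integral_unitBall_polar {φ : (Fin p → ℂ) → ℂ}
    (hφ : ∀ (t : Fin p → Circle), ∀ z ∈ unitBall p, φ (fun k => (t k : ℂ) * z k) = φ z) :
    ∫ z in unitBall p, φ z = (2 * Real.pi : ℝ) ^ p *
      ∫ r in ballBase p, φ (fun k => (r k : ℂ)) * ((∏ k, r k : ℝ) : ℂ) := by
  rw [← integral_indicator measurableSet_unitBall, ← Complex.integral_comp_pi_polarCoord_symm]
  have e : ∀ x : Fin p → ℝ × ℝ, (∏ k, (x k).1) •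
      (unitBall p).indicator φ (fun k => Complex.polarCoord.symm (x k)) =
      (fun r : Fin p → ℝ => {r : Fin p → ℝ | ∑ k, r k ^ 2 < 1}.indicator
        (fun r => φ (fun k => (r k : ℂ)) * ((∏ k, r k : ℝ) : ℂ)) r) (fun k => (x k).1) := by
    intro x
    have hx : (fun k => Complex.polarCoord.symm (x k)) =
        fun k => (Circle.exp (x k).2 : ℂ) * ((x k).1 : ℂ) := by
      funext k
      rw [Complex.polarCoord_symm_apply, Circle.coe_exp, Complex.exp_mul_I]
      push_cast; ring
    have hm : (fun k => (Circle.exp (x k).2 : ℂ) * ((x k).1 : ℂ)) ∈ unitBall p ↔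
        ∑ k, (x k).1 ^ 2 < 1 := by
      simp [unitBall]
    rw [hx]
    by_cases h : ∑ k, (x k).1 ^ 2 < 1
    · rw [Set.indicator_of_mem (hm.2 h), hφ (fun k => Circle.exp (x k).2) (fun k => ((x k).1 : ℂ))
        (ofReal_mem_unitBall.2 h)]
      simp only
      rw [Set.indicator_of_mem (by exact h), Complex.real_smul, mul_comm]
    · rw [Set.indicator_of_notMem (fun h' => h (hm.1 h')), smul_zero]
      exact (Set.indicator_of_notMem (by exact h) _).symm
  simp only [e]
  rw [integral_pi_polar (fun r : Fin p → ℝ => {r : Fin p → ℝ | ∑ k, r k ^ 2 < 1}.indicator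
        (fun r => φ (fun k => (r k : ℂ)) * ((∏ k, r k : ℝ) : ℂ)) r)]
  congr 1
  have hm : MeasurableSet {r : Fin p → ℝ | ∑ k, r k ^ 2 < 1} :=
    measurableSet_lt (by fun_prop) measurable_const
  rw [setIntegral_indicator hm]
  symm
  -- Polar coordinates see only r_k > 0, whereas the base of the ball contains the faces r_k = 0;
  -- the Jacobian ∏ r_k vanishes on these.
  refine setIntegral_eq_of_subset_of_forall_sdiff_eq_zero measurableSet_ballBase ?_ ?_
  · rintro r ⟨h1, h2⟩
    exact ⟨fun k => le_of_lt (h1 k trivial), h2⟩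
  · rintro r ⟨⟨h1, h2⟩, h3⟩
    have : ∃ k, r k = 0 := by
      by_contra! hc
      exact h3 ⟨fun k _ => lt_of_le_of_ne (h1 k) (hc k).symm, h2⟩
    obtain ⟨k, hk⟩ := this
    rw [Finset.prod_eq_zero (Finset.mem_univ k) hk]
    simp

end Polar

/-! ### Comparison of the component weights. -/

section Weights

variable {p q : ℕ}

theorem descPochhammer_eval_mul_gamma (m : ℕ) (x : ℝ) (h : (m : ℝ) < x) :
    (descPochhammer ℝ m).eval (x - 1) * Real.Gamma (x - m) = Real.Gamma x := by
  induction m with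
  | zero => simp
  | succ m ih =>
    have hm : (m : ℝ) + 1 < x := by exact_mod_cast h
    rw [descPochhammer_succ_eval]
    have h1 : x - m = (x - (m + 1 : ℕ)) + 1 := by push_cast; ring
    have h2 : x - 1 - m = x - (m + 1 : ℕ) := by push_cast; ring
    rw [← ih (by linarith), h1, Real.Gamma_add_one (by push_cast; linarith), h2]
    ring

theorem shift_pos {ν : ℝ} (hν : (p : ℝ) < ν) (M : Finset (Fin q)) : 0 < ν + M.card - p := by
  have : (0 : ℝ) ≤ M.card := Nat.cast_nonneg _
  linarith

/-- The falling factorial in the component weight is Γ(ν+q-p)/Γ(ν+|M|-p), so q disappears and the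
scalar Bergman weight of parameter ν+|M| remains, normalized up to Γ(ν)/Γ(ν+|M|). -/
theorem const_mul_compWeight {ν : ℝ} (hν : (p : ℝ) < ν) (M : Finset (Fin q)) (z : Fin p → ℂ) :
    Real.Gamma ν / (Real.pi ^ p * Real.Gamma (ν + q - p)) * compWeight p q ν M z =
      Real.Gamma ν / (Real.pi ^ p * Real.Gamma (ν + M.card - p)) *
        (1 - ∑ k, ‖z k‖ ^ 2) ^ (ν + M.card - p - 1) := by
  have hM : M.card ≤ q := by simpa using Finset.card_le_univ M
  have hq : ((q - M.card : ℕ) : ℝ) = q - M.card := Nat.cast_sub hM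
  have hs := shift_pos hν M
  have h := descPochhammer_eval_mul_gamma (q - M.card) (ν + q - p) (by rw [hq]; linarith)
  have e : ν + q - p - ((q - M.card : ℕ) : ℝ) = ν + M.card - p := by rw [hq]; ring
  have e' : ν + q - p - 1 - ((q - M.card : ℕ) : ℝ) = ν + M.card - p - 1 := by rw [hq]; ring
  rw [e] at h
  rw [compWeight, e', ← h]
  have h1 := (Real.Gamma_pos_of_pos hs).ne'
  have h2 : (descPochhammer ℝ (q - M.card)).eval (ν + q - p - 1) ≠ 0 := by
    refine (descPochhammer_pos ?_).ne'
    rw [hq]; linarith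
  field_simp

theorem compWeight_rot (ν : ℝ) (M : Finset (Fin q)) (t : Fin p → Circle) (z : Fin p → ℂ) :
    compWeight p q ν M (fun k => (t k : ℂ) * z k) = compWeight p q ν M z := by
  have h : ∀ k, ‖(t k : ℂ)‖ = 1 := fun k => Circle.norm_coe (t k)
  simp only [compWeight, norm_mul, h, one_mul]

/-- A larger set gives a larger exponent of 1-|z|² ≤ 1. This is what keeps the form of a bounded
symbol bounded, although each component meets several weights. -/
theorem exists_compWeight_le {ν : ℝ} (hν : (p : ℝ) < ν) {M K : Finset (Fin q)} (h : M ⊆ K) :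
    ∃ C : ℝ, 0 ≤ C ∧ ∀ z ∈ unitBall p, compWeight p q ν K z ≤ C * compWeight p q ν M z := by
  have hc := superConst_pos (q := q) hν
  have hM := Real.Gamma_pos_of_pos (shift_pos hν M)
  have hK := Real.Gamma_pos_of_pos (shift_pos hν K)
  refine ⟨Real.Gamma (ν + M.card - p) / Real.Gamma (ν + K.card - p), by positivity,
    fun z hz => ?_⟩
  refine le_of_mul_le_mul_left ?_ hc
  rw [mul_left_comm, const_mul_compWeight hν, const_mul_compWeight hν]
  have hz0 := one_sub_pos hz
  have hz1 : 1 - ∑ k, ‖z k‖ ^ 2 ≤ 1 := by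
    have : 0 ≤ ∑ k, ‖z k‖ ^ 2 := Finset.sum_nonneg fun _ _ => sq_nonneg _
    linarith
  have hcard : (M.card : ℝ) ≤ K.card := by exact_mod_cast Finset.card_le_card h
  have hle := Real.rpow_le_rpow_of_exponent_ge hz0 hz1
    (show ν + M.card - p - 1 ≤ ν + K.card - p - 1 by linarith)
  have hG : 0 < Real.Gamma ν := Real.Gamma_pos_of_pos
    (lt_of_le_of_lt (Nat.cast_nonneg p) hν)
  calc _ ≤ Real.Gamma ν / (Real.pi ^ p * Real.Gamma (ν + K.card - p)) *
        (1 - ∑ k, ‖z k‖ ^ 2) ^ (ν + M.card - p - 1) :=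
        mul_le_mul_of_nonneg_left hle (by positivity)
    _ = _ := by field_simp

end Weights

/-! ### Boundedness of the form (Θ | FΨ). -/

section Form

variable {p q : ℕ}

theorem IsBoundedMeasurable.aestronglyMeasurable {F : SuperFunction p q}
    (hF : IsBoundedMeasurable F) (I J : Finset (Fin q)) :
    AEStronglyMeasurable (F I J) (volume.restrict (unitBall p)) := by
  rw [← map_comap_subtype_coe measurableSet_unitBall]
  refine AEStronglyMeasurable.mono_measure ?_ le_rfl
  rw [(MeasurableEmbedding.subtype_coe measurableSet_unitBall).aestronglyMeasurable_map_iff]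
  exact (hF I J).1.aestronglyMeasurable

/-- The product |Θ_M Ψ_M| is dominated by |Θ_M|² + |Ψ_M|² after replacing the weight of K by that of
M. The constant depends on the symbol and the sets only, and the additive bound is homogenized later
by scaling. -/
theorem exists_bound_term {F : SuperFunction p q} (hF : IsBoundedMeasurable F) {ν : ℝ}
    (hν : (p : ℝ) < ν) {M K : Finset (Fin q)} (h : M ⊆ K) :
    ∃ C : ℝ, 0 ≤ C ∧ ∀ Θ Ψ : SuperHol p q, IsSuperBergman ν Θ → IsSuperBergman ν Ψ →
      IntegrableOn (fun z => F (K \ M) (K \ M) z * ((compWeight p q ν K z : ℂ) *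
          ((starRingEnd ℂ) (Θ M z) * Ψ M z))) (unitBall p) ∧
      ‖∫ z in unitBall p, F (K \ M) (K \ M) z * ((compWeight p q ν K z : ℂ) *
          ((starRingEnd ℂ) (Θ M z) * Ψ M z))‖ ≤
        C * ((∫ z in unitBall p, compWeight p q ν M z * ‖Θ M z‖ ^ 2) +
          ∫ z in unitBall p, compWeight p q ν M z * ‖Ψ M z‖ ^ 2) := by
  obtain ⟨C₁, hC₁, h1⟩ := exists_compWeight_le hν h
  obtain ⟨C₂, h2⟩ := (hF (K \ M) (K \ M)).2
  have hC₂ : 0 ≤ C₂ := (norm_nonneg _).trans (h2 _ const_mem_unitBall)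
  refine ⟨C₂ * C₁, by positivity, fun Θ Ψ hΘ hΨ => ?_⟩
  have hb : ∀ᵐ z ∂volume.restrict (unitBall p),
      ‖F (K \ M) (K \ M) z * ((compWeight p q ν K z : ℂ) *
          ((starRingEnd ℂ) (Θ M z) * Ψ M z))‖ ≤
      C₂ * C₁ * (compWeight p q ν M z * ‖Θ M z‖ ^ 2 + compWeight p q ν M z * ‖Ψ M z‖ ^ 2) := by
    refine (ae_restrict_iff' measurableSet_unitBall).2 (Filter.Eventually.of_forall fun z hz => ?_)
    have hw := (compWeight_pos hν K hz).le
    have hw' := (compWeight_pos hν M hz).le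
    rw [norm_mul, norm_mul, norm_mul, Complex.norm_real, Real.norm_of_nonneg hw, RCLike.norm_conj,
      mul_assoc C₂, ← mul_add, ← mul_assoc C₁]
    refine mul_le_mul (h2 z hz) ?_ (by positivity) hC₂
    refine mul_le_mul (h1 z hz) ?_ (by positivity) (by positivity)
    nlinarith [sq_nonneg (‖Θ M z‖ - ‖Ψ M z‖), sq_nonneg ‖Θ M z‖, sq_nonneg ‖Ψ M z‖]
  have hi := ((hΘ.comp hν M).add (hΨ.comp hν M)).const_mul (C₂ * C₁)
  have hm := (hF.aestronglyMeasurable (K \ M) (K \ M)).mul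
    ((continuousOn_term ν K (hΘ.holo M).continuousOn
      (hΨ.holo M).continuousOn).aestronglyMeasurable measurableSet_unitBall)
  refine ⟨hi.mono' hm hb, ?_⟩
  rw [← integral_add (hΘ.comp hν M) (hΨ.comp hν M), ← integral_const_mul]
  exact norm_integral_le_of_norm_le hi hb

theorem integrableOn_form {F : SuperFunction p q} (hF : IsBoundedMeasurable F)
    (hQ : IsQuasiElliptic F) {ν : ℝ} (hν : (p : ℝ) < ν) {Θ Ψ : SuperHol p q}
    (hΘ : IsSuperBergman ν Θ) (hΨ : IsSuperBergman ν Ψ) :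
    IntegrableOn (superIntegrand ν Θ fun z => F.val z * Ψ.val z) (unitBall p) := by
  refine IntegrableOn.congr_fun ?_ (fun z hz => (hQ.superIntegrand_eq ν Θ Ψ hz).symm)
    measurableSet_unitBall
  refine integrable_finsetSum _ fun M _ => integrable_finsetSum _ fun K hK => ?_
  obtain ⟨C, _, hC⟩ := exists_bound_term hF hν (Finset.mem_filter.1 hK).2
  exact (hC Θ Ψ hΘ hΨ).1.const_mul _

theorem superPairing_form_eq {F : SuperFunction p q} (hF : IsBoundedMeasurable F)
    (hQ : IsQuasiElliptic F) {ν : ℝ} (hν : (p : ℝ) < ν) {Θ Ψ : SuperHol p q}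
    (hΘ : IsSuperBergman ν Θ) (hΨ : IsSuperBergman ν Ψ) :
    superPairing ν Θ (fun z => F.val z * Ψ.val z) =
      ((Real.Gamma ν / (Real.pi ^ p * Real.Gamma (ν + q - p)) : ℝ) : ℂ) *
        ∑ M, ∑ K ∈ Finset.univ.filter (fun K => M ⊆ K), (-1 : ℂ) ^ (K \ M).card *
          ∫ z in unitBall p, F (K \ M) (K \ M) z * ((compWeight p q ν K z : ℂ) *
            ((starRingEnd ℂ) (Θ M z) * Ψ M z)) := by
  have hi : ∀ M, ∀ K ∈ Finset.univ.filter (fun K => M ⊆ K),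
      IntegrableOn (fun z => (-1 : ℂ) ^ (K \ M).card * (F (K \ M) (K \ M) z *
        ((compWeight p q ν K z : ℂ) * ((starRingEnd ℂ) (Θ M z) * Ψ M z)))) (unitBall p) := by
    intro M K hK
    obtain ⟨C, _, hC⟩ := exists_bound_term hF hν (Finset.mem_filter.1 hK).2
    exact (hC Θ Ψ hΘ hΨ).1.const_mul _
  rw [superPairing, setIntegral_congr_fun measurableSet_unitBall
    (fun z hz => hQ.superIntegrand_eq ν Θ Ψ hz),
    integral_finsetSum _ fun M _ => integrable_finsetSum _ fun K hK => hi M K hK]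
  congr 1
  refine Finset.sum_congr rfl fun M _ => ?_
  rw [integral_finsetSum _ fun K hK => hi M K hK]
  exact Finset.sum_congr rfl fun K _ => integral_const_mul _ _

theorem exists_form_bound {F : SuperFunction p q} (hF : IsBoundedMeasurable F)
    (hQ : IsQuasiElliptic F) {ν : ℝ} (hν : (p : ℝ) < ν) :
    ∃ C : ℝ, 0 ≤ C ∧ ∀ Θ Ψ : SuperBergman p q ν hν,
      ‖superPairing ν Θ.coeff (fun z => F.val z * Ψ.coeff.val z)‖ ≤
        C * (‖Θ‖ ^ 2 + ‖Ψ‖ ^ 2) := by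
  -- Pairs with M not contained in K receive the constant 0 and an empty claim, so that constants
  -- can be chosen for all pairs at once.
  have hex : ∀ M K : Finset (Fin q), ∃ C : ℝ, 0 ≤ C ∧ (M ⊆ K →
      ∀ Θ Ψ : SuperBergman p q ν hν,
      ‖∫ z in unitBall p, F (K \ M) (K \ M) z * ((compWeight p q ν K z : ℂ) *
          ((starRingEnd ℂ) (Θ.coeff M z) * Ψ.coeff M z))‖ ≤
        C * ((∫ z in unitBall p, compWeight p q ν M z * ‖Θ.coeff M z‖ ^ 2) +
          ∫ z in unitBall p, compWeight p q ν M z * ‖Ψ.coeff M z‖ ^ 2)) := by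
    intro M K
    by_cases h : M ⊆ K
    · obtain ⟨C, h0, hC⟩ := exists_bound_term hF hν h
      exact ⟨C, h0, fun _ Θ Ψ => (hC _ _ Θ.isSuperBergman Ψ.isSuperBergman).2⟩
    · exact ⟨0, le_rfl, fun h' => absurd h' h⟩
  choose C hC0 hC using hex
  have hc := superConst_pos (q := q) hν
  set c := Real.Gamma ν / (Real.pi ^ p * Real.Gamma (ν + q - p)) with hcdef
  have hnorm : ∀ Θ : SuperBergman p q ν hν, ‖Θ‖ ^ 2 =
      c * ∑ M, ∫ z in unitBall p, compWeight p q ν M z * ‖Θ.coeff M z‖ ^ 2 := by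
    intro Θ
    have h1 : inner ℂ Θ Θ = _ := superPairing_self_eq hν Θ.isSuperBergman
    rw [inner_self_eq_norm_sq_to_K, ← hcdef] at h1
    exact Complex.ofReal_injective ((Complex.ofReal_pow _ _).trans h1)
  have hle : ∀ (Θ : SuperBergman p q ν hν) (M : Finset (Fin q)),
      c * ∫ z in unitBall p, compWeight p q ν M z * ‖Θ.coeff M z‖ ^ 2 ≤ ‖Θ‖ ^ 2 := by
    intro Θ M
    rw [hnorm]
    exact mul_le_mul_of_nonneg_left (Finset.single_le_sum
      (f := fun M => ∫ z in unitBall p, compWeight p q ν M z * ‖Θ.coeff M z‖ ^ 2)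
      (fun M _ => compNorm_nonneg hν _ M) (Finset.mem_univ M)) hc.le
  refine ⟨∑ M, ∑ K, C M K, Finset.sum_nonneg fun M _ => Finset.sum_nonneg fun K _ => hC0 M K,
    fun Θ Ψ => ?_⟩
  rw [superPairing_form_eq hF hQ hν Θ.isSuperBergman Ψ.isSuperBergman, norm_mul,
    Complex.norm_real, Real.norm_of_nonneg hc.le]
  refine (mul_le_mul_of_nonneg_left (norm_sum_le _ _) hc.le).trans ?_
  rw [Finset.mul_sum, Finset.sum_mul]
  refine Finset.sum_le_sum fun M _ => ?_
  refine (mul_le_mul_of_nonneg_left (norm_sum_le _ _) hc.le).trans ?_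
  rw [Finset.mul_sum, Finset.sum_mul]
  refine (Finset.sum_le_sum fun K hK => ?_).trans
    (Finset.sum_le_sum_of_subset_of_nonneg (Finset.filter_subset _ _) fun K _ _ => ?_)
  · rw [norm_mul, norm_pow, norm_neg, norm_one, one_pow, one_mul]
    refine (mul_le_mul_of_nonneg_left (hC M K (Finset.mem_filter.1 hK).2 Θ Ψ) hc.le).trans ?_
    rw [mul_left_comm, mul_add]
    exact mul_le_mul_of_nonneg_left (add_le_add (hle Θ M) (hle Ψ M)) (hC0 M K)
  · exact mul_nonneg (hC0 M K) (by positivity)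

end Form

/-! ### Linearity of Taylor coefficients, and the coefficients of monomials. -/

section Taylor

variable {p : ℕ}

theorem taylorCoeff_congr {f g : (Fin p → ℂ) → ℂ} (h : Set.EqOn f g (unitBall p))
    (n : Fin p → ℕ) : taylorCoeff f n = taylorCoeff g n := by
  rw [taylorCoeff, taylorCoeff, torusCoeff, torusCoeff]
  congr 2
  funext x
  rw [h (rot_mem_unitBall.2 const_mem_unitBall)]

theorem integrable_torus {f : (Fin p → ℂ) → ℂ} (hf : DifferentiableOn ℂ f (unitBall p))
    {z : Fin p → ℂ} (hz : z ∈ unitBall p) (n : Fin p → ℤ) :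
    Integrable (fun x => UnitAddTorus.mFourier n x * f (rot x z)) (torusMeasure p) :=
  Continuous.integrable_of_hasCompactSupport ((ContinuousMap.continuous _).mul
    (continuous_comp_rot hf.continuousOn hz)) (HasCompactSupport.of_compactSpace _)

theorem taylorCoeff_add {f g : (Fin p → ℂ) → ℂ} (hf : DifferentiableOn ℂ f (unitBall p))
    (hg : DifferentiableOn ℂ g (unitBall p)) (n : Fin p → ℕ) :
    taylorCoeff (f + g) n = taylorCoeff f n + taylorCoeff g n := by
  rw [taylorCoeff, taylorCoeff, taylorCoeff, ← add_div, torusCoeff, torusCoeff, torusCoeff,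
    ← integral_add (integrable_torus hf const_mem_unitBall _)
      (integrable_torus hg const_mem_unitBall _)]
  simp only [Pi.add_apply, mul_add]

theorem taylorCoeff_smul (c : ℂ) (f : (Fin p → ℂ) → ℂ) (n : Fin p → ℕ) :
    taylorCoeff (c • f) n = c * taylorCoeff f n := by
  rw [taylorCoeff, taylorCoeff, ← mul_div_assoc, torusCoeff, torusCoeff, ← integral_const_mul]
  simp only [Pi.smul_apply, smul_eq_mul, mul_left_comm]

theorem taylorCoeff_monomial (m n : Fin p → ℕ) :
    taylorCoeff (fun z => ∏ k, z k ^ m k) n = if n = m then 1 else 0 := by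
  have h : (fun z : Fin p → ℂ => ∏ k, z k ^ m k) = powerSeries (Pi.single m 1) := by
    funext z
    rw [powerSeries, tsum_eq_single m fun n hn => by rw [Pi.single_eq_of_ne hn, zero_mul],
      Pi.single_eq_same, one_mul]
  rw [h, taylorCoeff_powerSeries fun z _ => ?_, Pi.single_apply]
  refine summable_of_ne_finset_zero (s := {m}) fun n hn => ?_
  rw [Pi.single_eq_of_ne (by simpa using hn), norm_zero, zero_mul]

end Taylor

/-! ### Monomials in the super Bergman space. -/

section Monomials

variable {p q : ℕ}

theorem compWeight_eq {ν : ℝ} (hν : (p : ℝ) < ν) (M : Finset (Fin q)) :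
    ∃ D : ℝ, 0 < D ∧
      Real.Gamma ν / (Real.pi ^ p * Real.Gamma (ν + q - p)) * D =
        Real.Gamma ν / (Real.pi ^ p * Real.Gamma (ν + M.card - p)) ∧
      ∀ z : Fin p → ℂ, compWeight p q ν M z =
        D * (1 - ∑ k, ‖z k‖ ^ 2) ^ (ν + M.card - p - 1) := by
  have hc := superConst_pos (q := q) hν
  have hG : 0 < Real.Gamma ν := Real.Gamma_pos_of_pos (lt_of_le_of_lt (Nat.cast_nonneg p) hν)
  have hM := Real.Gamma_pos_of_pos (shift_pos hν M)
  refine ⟨(Real.Gamma ν / (Real.pi ^ p * Real.Gamma (ν + q - p)))⁻¹ *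
    (Real.Gamma ν / (Real.pi ^ p * Real.Gamma (ν + M.card - p))), by positivity,
    mul_inv_cancel_left₀ hc.ne' _, fun z => ?_⟩
  rw [mul_assoc, ← const_mul_compWeight hν, inv_mul_cancel_left₀ hc.ne']

/-- The super function `z^n ξ_M`. -/
noncomputable def monomialHol (M : Finset (Fin q)) (n : Fin p → ℕ) : SuperHol p q :=
  fun N z => if N = M then (unitBall p).indicator (fun z => ∏ k, z k ^ n k) z else 0

/-- Finite norm can be read off the Taylor coefficients, by the norm formula in each component. -/
theorem isSuperBergman_of_summable {ν : ℝ} (hν : (p : ℝ) < ν) {Ψ : SuperHol p q}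
    (hd : ∀ M, DifferentiableOn ℂ (Ψ M) (unitBall p)) (h0 : ∀ M, ∀ z ∉ unitBall p, Ψ M z = 0)
    (hs : ∀ M, Summable fun n => ‖taylorCoeff (Ψ M) n‖ ^ 2 * moment p (ν + M.card - p) n) :
    IsSuperBergman ν Ψ := by
  refine ⟨hd, h0, (integrableOn_self_iff hν fun M => (hd M).continuousOn).2 fun M => ?_⟩
  obtain ⟨D, _, _, hD⟩ := compWeight_eq (q := q) hν M
  simp only [hD, mul_assoc]
  exact (integrableOn_weight_norm_sq (hd M) (shift_pos hν M) (hs M)).const_mul D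

theorem IsSuperBergman.integrableOn_weight {ν : ℝ} (hν : (p : ℝ) < ν) {Ψ : SuperHol p q}
    (h : IsSuperBergman ν Ψ) (M : Finset (Fin q)) :
    IntegrableOn (fun z => (1 - ∑ k, ‖z k‖ ^ 2) ^ (ν + M.card - p - 1) * ‖Ψ M z‖ ^ 2)
      (unitBall p) := by
  obtain ⟨D, h0, _, hD⟩ := compWeight_eq (q := q) hν M
  have := (h.comp hν M).const_mul D⁻¹
  simp only [hD, ← mul_assoc, inv_mul_cancel₀ h0.ne', one_mul] at this
  exact this

theorem differentiableOn_monomialHol (M : Finset (Fin q)) (n : Fin p → ℕ) (N : Finset (Fin q)) :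
    DifferentiableOn ℂ (monomialHol M n N) (unitBall p) := by
  by_cases h : N = M
  · refine (differentiable_monomial n).differentiableOn.congr fun z hz => ?_
    rw [monomialHol, if_pos h, Set.indicator_of_mem hz]
  · refine (differentiableOn_const 0).congr fun z hz => ?_
    rw [monomialHol, if_neg h]

theorem taylorCoeff_monomialHol (M N : Finset (Fin q)) (m n : Fin p → ℕ) :
    taylorCoeff (monomialHol M m N) n = if N = M ∧ n = m then 1 else 0 := by
  by_cases h : N = M
  · rw [taylorCoeff_congr (g := fun z => ∏ k, z k ^ m k), taylorCoeff_monomial]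
    · simp [h]
    · intro z hz
      rw [monomialHol, if_pos h, Set.indicator_of_mem hz]
  · have : monomialHol M m N = (0 : ℂ) • (0 : (Fin p → ℂ) → ℂ) := by
      funext z; rw [monomialHol, if_neg h]; simp
    rw [this, taylorCoeff_smul, zero_mul, if_neg (by tauto)]

theorem isSuperBergman_monomialHol {ν : ℝ} (hν : (p : ℝ) < ν) (M : Finset (Fin q))
    (n : Fin p → ℕ) : IsSuperBergman ν (monomialHol M n) := by
  refine isSuperBergman_of_summable hν (differentiableOn_monomialHol M n) (fun N z hz => ?_)
    fun N => ?_
  · simp [monomialHol, hz]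
  · refine summable_of_ne_finset_zero (s := {n}) fun m hm => ?_
    rw [taylorCoeff_monomialHol, if_neg (fun h => hm (by simp [h.2]))]
    simp

/-- The element `z^n ξ_M` of the super Bergman space. -/
noncomputable def monomialBergman {ν : ℝ} (hν : (p : ℝ) < ν) (M : Finset (Fin q))
    (n : Fin p → ℕ) : SuperBergman p q ν hν :=
  ⟨monomialHol M n, isSuperBergman_monomialHol hν M n⟩

theorem coeff_monomialBergman {ν : ℝ} (hν : (p : ℝ) < ν) (M : Finset (Fin q))
    (n : Fin p → ℕ) : (monomialBergman hν M n).coeff = monomialHol M n := rfl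

theorem moment_eq (ν : ℝ) (M : Finset (Fin q)) (n : Fin p → ℕ) :
    moment p (ν + M.card - p) n = Real.pi ^ p * (∏ k, ((n k).factorial : ℝ)) *
      Real.Gamma (ν + M.card - p) / Real.Gamma ((∑ k, n k : ℕ) + ν + M.card) := by
  rw [moment]
  congr 2
  ring

/-- The integral of a torus invariant multiple of `conj(z^n) f`, where `f` is the component of an
element of the super Bergman space. -/
theorem integral_conj_monomial {f φ : (Fin p → ℂ) → ℂ} (hf : DifferentiableOn ℂ f (unitBall p))
    (hφ : ∀ (t : Fin p → Circle), ∀ z ∈ unitBall p, φ (fun k => (t k : ℂ) * z k) = φ z)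
    (M : Finset (Fin q)) (n : Fin p → ℕ)
    (hi : IntegrableOn (fun z => φ z * ((starRingEnd ℂ) (monomialHol M n M z) * f z))
      (unitBall p)) :
    ∫ z in unitBall p, φ z * ((starRingEnd ℂ) (monomialHol M n M z) * f z) =
      taylorCoeff f n *
        ∫ z in unitBall p, ((∏ k, ‖z k‖ ^ (2 * n k) : ℝ) : ℂ) * φ z := by
  have e : Set.EqOn (fun z => φ z * ((starRingEnd ℂ) (monomialHol M n M z) * f z))
      (fun z => f z * (starRingEnd ℂ) (∏ k, z k ^ n k) * φ z) (unitBall p) := by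
    intro z hz
    simp only [monomialHol, if_true, Set.indicator_of_mem hz]
    ring
  rw [setIntegral_congr_fun measurableSet_unitBall e]
  refine integral_mul_conj_monomial hf n (fun x z hz => ?_)
    (hi.congr_fun e measurableSet_unitBall)
  have := hφ (fun k => AddCircle.toCircle (x k)) z hz
  have hr : rot x z = fun k => (AddCircle.toCircle (x k) : ℂ) * z k := by
    funext k; rw [rot, fourier_one]
  rw [hr]
  exact this

theorem integral_moment_complex {a : ℝ} (ha : 0 < a) (n : Fin p → ℕ) :
    ∫ z : Fin p → ℂ in unitBall p, ((∏ k, ‖z k‖ ^ (2 * n k) : ℝ) : ℂ) *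
      (((1 - ∑ k, ‖z k‖ ^ 2) ^ (a - 1) : ℝ) : ℂ) = (moment p a n : ℂ) := by
  rw [← integral_moment ha, ← integral_complex_ofReal]
  congr 1
  funext z
  push_cast; rfl

theorem integral_monomial_mul {ν : ℝ} (hν : (p : ℝ) < ν) {Ψ : SuperHol p q}
    (h : IsSuperBergman ν Ψ) (M : Finset (Fin q)) (n : Fin p → ℕ) :
    ((Real.Gamma ν / (Real.pi ^ p * Real.Gamma (ν + q - p)) : ℝ) : ℂ) *
      ∫ z in unitBall p, (compWeight p q ν M z : ℂ) *
        ((starRingEnd ℂ) (monomialHol M n M z) * Ψ M z) =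
      ((Real.Gamma ν / (Real.pi ^ p * Real.Gamma (ν + M.card - p)) *
        moment p (ν + M.card - p) n : ℝ) : ℂ) * taylorCoeff (Ψ M) n := by
  rw [integral_conj_monomial (h.holo M) (fun t z _ => by rw [compWeight_rot])
    M n ((isSuperBergman_monomialHol hν M n).integrable_term hν h M)]
  obtain ⟨D, _, h1, hD⟩ := compWeight_eq (q := q) hν M
  rw [← h1]
  have e : ∀ z : Fin p → ℂ, ((∏ k, ‖z k‖ ^ (2 * n k) : ℝ) : ℂ) * (compWeight p q ν M z : ℂ) =
      (D : ℂ) * (((∏ k, ‖z k‖ ^ (2 * n k) : ℝ) : ℂ) *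
      (((1 - ∑ k, ‖z k‖ ^ 2) ^ (ν + M.card - p - 1) : ℝ) : ℂ)) := fun z => by
    rw [hD]; push_cast; ring
  simp only [e]
  rw [integral_const_mul, integral_moment_complex (shift_pos hν M)]
  push_cast
  ring

theorem gamma_shift_pos {ν : ℝ} (hν : (p : ℝ) < ν) (M : Finset (Fin q)) (n : Fin p → ℕ) :
    0 < Real.Gamma ((∑ k, n k : ℕ) + ν + M.card) := by
  have h0 : 0 < ν := lt_of_le_of_lt (Nat.cast_nonneg p) hν
  exact Real.Gamma_pos_of_pos (by positivity)

theorem gamma_card_pos {ν : ℝ} (hν : (p : ℝ) < ν) (M : Finset (Fin q)) :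
    0 < Real.Gamma (ν + M.card) := by
  have h0 : 0 < ν := lt_of_le_of_lt (Nat.cast_nonneg p) hν
  exact Real.Gamma_pos_of_pos (by positivity)

/-- Only the component M contributes, and there rotation invariance of the weight selects one Taylor
coefficient. Pairing with monomials therefore detects every coefficient, with a nonzero constant. -/
theorem inner_monomialBergman {ν : ℝ} (hν : (p : ℝ) < ν) (M : Finset (Fin q)) (n : Fin p → ℕ)
    (Ψ : SuperBergman p q ν hν) :
    inner ℂ (monomialBergman hν M n) Ψ =
      ((Real.Gamma ν * (∏ k, ((n k).factorial : ℝ)) /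
        Real.Gamma ((∑ k, n k : ℕ) + ν + M.card) : ℝ) : ℂ) * taylorCoeff (Ψ.coeff M) n := by
  have hΨ := Ψ.isSuperBergman
  have hm := isSuperBergman_monomialHol hν M n
  rw [SuperBergman.inner_eq, superPairing]
  simp only [superIntegrand_val, coeff_monomialBergman]
  rw [integral_finsetSum _ fun N _ => hm.integrable_term hν hΨ N, Finset.sum_eq_single M]
  · rw [integral_monomial_mul hν hΨ, moment_eq]
    congr 2
    have h1 := (Real.Gamma_pos_of_pos (shift_pos hν M)).ne'
    have h2 := (gamma_shift_pos hν M n).ne'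
    field_simp
  · intro N _ hN
    simp [monomialHol, hN]
  · simp

end Monomials

/-! ### Unitarity of the super Bargmann transform and completeness. -/

section Bargmann

variable {p q : ℕ}

/-- The norm of `z^n` in the weighted Bergman space with parameter `ν + |M|`. -/
noncomputable def monomialNorm (ν : ℝ) (M : Finset (Fin q)) (n : Fin p → ℕ) : ℝ :=
  Real.sqrt ((∏ k, ((n k).factorial : ℝ)) * Real.Gamma (ν + M.card) /
    Real.Gamma ((∑ k, n k : ℕ) + ν + M.card))

theorem monomialNorm_arg_pos {ν : ℝ} (hν : (p : ℝ) < ν) (M : Finset (Fin q)) (n : Fin p → ℕ) :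
    0 < (∏ k, ((n k).factorial : ℝ)) * Real.Gamma (ν + M.card) /
    Real.Gamma ((∑ k, n k : ℕ) + ν + M.card) := by
  have h1 := gamma_shift_pos hν M n
  have h2 := gamma_card_pos hν M
  positivity

theorem monomialNorm_pos {ν : ℝ} (hν : (p : ℝ) < ν) (M : Finset (Fin q)) (n : Fin p → ℕ) :
    0 < monomialNorm ν M n :=
  Real.sqrt_pos.2 (monomialNorm_arg_pos hν M n)

theorem monomialNorm_sq {ν : ℝ} (hν : (p : ℝ) < ν) (M : Finset (Fin q)) (n : Fin p → ℕ) :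
    monomialNorm ν M n ^ 2 = Real.Gamma (ν + M.card) /
      (Real.pi ^ p * Real.Gamma (ν + M.card - p)) * moment p (ν + M.card - p) n := by
  rw [monomialNorm, Real.sq_sqrt (monomialNorm_arg_pos hν M n).le, moment_eq]
  have h1 := (Real.Gamma_pos_of_pos (shift_pos hν M)).ne'
  have h2 := (gamma_shift_pos hν M n).ne'
  field_simp

/-- The powers of 2π cancel, and the prefactor of the transform is the reciprocal of the norm of
z^n. -/
theorem bargmann_constant {ν : ℝ} (hν : (p : ℝ) < ν) (M : Finset (Fin q)) (n : Fin p → ℕ) :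
    (2 * Real.pi) ^ (-(p : ℝ) / 2) *
      Real.sqrt ((2 * Real.pi) ^ p * Real.Gamma ((∑ k, n k : ℕ) + ν + M.card) /
        ((∏ k, (n k).factorial : ℕ) * Real.Gamma (ν + M.card))) * monomialNorm ν M n = 1 := by
  have hpi : (0 : ℝ) < 2 * Real.pi := by positivity
  have h1 : (2 * Real.pi) ^ (-(p : ℝ) / 2) = (Real.sqrt ((2 * Real.pi) ^ p))⁻¹ := by
    rw [Real.sqrt_eq_rpow, ← Real.rpow_natCast, ← Real.rpow_mul hpi.le, ← Real.rpow_neg hpi.le]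
    congr 1; ring
  have hG := gamma_shift_pos hν M n
  have hL := gamma_card_pos hν M
  rw [h1, monomialNorm, mul_div_assoc, Real.sqrt_mul (by positivity), inv_mul_cancel_left₀
    (Real.sqrt_pos.2 (by positivity)).ne', ← Real.sqrt_mul (by positivity)]
  rw [Nat.cast_prod, div_mul_div_comm, mul_comm, div_self, Real.sqrt_one]
  positivity

/-- The transform takes coefficients in the normalized monomials: integrating against z^n gives a_n
‖z^n‖², and the prefactor divides by ‖z^n‖. The ratio Γ(ν+|M|)/Γ(ν) passes from the super weight to
the probability density. -/
theorem superBargmann_eq {ν : ℝ} (hν : (p : ℝ) < ν) {Ψ : SuperHol p q}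
    (h : IsSuperBergman ν Ψ) (M : Finset (Fin q)) (n : Fin p → ℕ) :
    superBargmann ν Ψ M n = (monomialNorm ν M n : ℂ) * taylorCoeff (Ψ M) n := by
  have hG : Real.Gamma ν ≠ 0 :=
    (Real.Gamma_pos_of_pos (lt_of_le_of_lt (Nat.cast_nonneg p) hν)).ne'
  have e : ∫ z in unitBall p, Ψ M z * (starRingEnd ℂ) (∏ k, z k ^ n k) *
      (ballDensity p (ν + M.card) z : ℂ) =
      ((Real.Gamma (ν + M.card) / Real.Gamma ν : ℝ) : ℂ) *
        (((Real.Gamma ν / (Real.pi ^ p * Real.Gamma (ν + q - p)) : ℝ) : ℂ) *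
      ∫ z in unitBall p, (compWeight p q ν M z : ℂ) *
        ((starRingEnd ℂ) (monomialHol M n M z) * Ψ M z)) := by
    rw [← mul_assoc, ← integral_const_mul]
    refine setIntegral_congr_fun measurableSet_unitBall fun z hz => ?_
    simp only [monomialHol, if_true, Set.indicator_of_mem hz]
    have : ballDensity p (ν + M.card) z = Real.Gamma (ν + M.card) / Real.Gamma ν *
        (Real.Gamma ν / (Real.pi ^ p * Real.Gamma (ν + q - p)) * compWeight p q ν M z) := by
      rw [const_mul_compWeight hν, ballDensity]
      field_simp
    rw [this]
    push_cast
    ring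
  rw [superBargmann, e, integral_monomial_mul hν h, ← mul_assoc, ← mul_assoc]
  congr 1
  rw [← Complex.ofReal_mul, ← Complex.ofReal_mul]
  congr 1
  have hb := bargmann_constant hν M n
  have hm := monomialNorm_sq hν M n
  have e2 : Real.Gamma (ν + M.card) / Real.Gamma ν *
      (Real.Gamma ν / (Real.pi ^ p * Real.Gamma (ν + M.card - p)) *
        moment p (ν + M.card - p) n) = monomialNorm ν M n ^ 2 := by
    rw [hm]; field_simp
  rw [mul_assoc, e2, sq, ← mul_assoc, hb, one_mul]

theorem norm_lp_sq {ι : Type*} (f : lp (fun _ : ι => ℂ) 2) : ‖f‖ ^ 2 = ∑' n, ‖f n‖ ^ 2 := by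
  have := lp.norm_rpow_eq_tsum (p := 2) (by norm_num) f
  simpa using this

theorem memlp_two_iff {ι : Type*} (f : ι → ℂ) : Memℓp f 2 ↔ Summable fun n => ‖f n‖ ^ 2 := by
  rw [memℓp_gen_iff (by norm_num)]
  simp

theorem IsSuperBergman.hasSum_superBargmann {ν : ℝ} (hν : (p : ℝ) < ν) {Ψ : SuperHol p q}
    (h : IsSuperBergman ν Ψ) (M : Finset (Fin q)) :
    HasSum (fun n => ‖superBargmann ν Ψ M n‖ ^ 2)
      (Real.Gamma (ν + M.card) / (Real.pi ^ p * Real.Gamma (ν + M.card - p)) *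
        ∫ z in unitBall p, (1 - ∑ k, ‖z k‖ ^ 2) ^ (ν + M.card - p - 1) * ‖Ψ M z‖ ^ 2) := by
  refine ((hasSum_taylorCoeff_moment (h.holo M) (shift_pos hν M)
    (h.integrableOn_weight hν M)).mul_left _).congr_fun fun n => ?_
  rw [superBargmann_eq hν h, norm_mul, mul_pow, Complex.norm_real, Real.norm_eq_abs, sq_abs,
    monomialNorm_sq hν]
  ring

/-- The super Bargmann transform as a linear map. -/
noncomputable def bargmannLinear (p q : ℕ) {ν : ℝ} (hν : (p : ℝ) < ν) :
    SuperBergman p q ν hν →ₗ[ℂ] (Finset (Fin q) → lp (fun _ : Fin p → ℕ => ℂ) 2) where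
  toFun Ψ M := ⟨fun n => superBargmann ν Ψ.coeff M n,
    (memlp_two_iff _).2 (Ψ.isSuperBergman.hasSum_superBargmann hν M).summable⟩
  map_add' Θ Ψ := by
    funext M
    ext n
    change superBargmann ν (Θ + Ψ).coeff M n =
      superBargmann ν Θ.coeff M n + superBargmann ν Ψ.coeff M n
    rw [superBargmann_eq hν (Θ + Ψ).isSuperBergman, superBargmann_eq hν Θ.isSuperBergman,
      superBargmann_eq hν Ψ.isSuperBergman, ← mul_add,
      ← taylorCoeff_add (Θ.isSuperBergman.holo M) (Ψ.isSuperBergman.holo M)]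
    rfl
  map_smul' c Ψ := by
    funext M
    ext n
    change superBargmann ν (c • Ψ).coeff M n = c * superBargmann ν Ψ.coeff M n
    rw [superBargmann_eq hν (c • Ψ).isSuperBergman, superBargmann_eq hν Ψ.isSuperBergman,
      mul_left_comm]
    exact congrArg _ (taylorCoeff_smul c _ n)

theorem bargmannLinear_eq {ν : ℝ} (hν : (p : ℝ) < ν) (Ψ : SuperBergman p q ν hν)
    (M : Finset (Fin q)) (n : Fin p → ℕ) :
    bargmannLinear p q hν Ψ M n = (monomialNorm ν M n : ℂ) * taylorCoeff (Ψ.coeff M) n :=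
  superBargmann_eq hν Ψ.isSuperBergman M n

/-- Each component norm is a Bergman norm of parameter ν+|M|, computed by the coefficients; the
change of normalization is the weight Γ(ν)/Γ(ν+|M|). -/
theorem norm_sq_eq_sum {ν : ℝ} (hν : (p : ℝ) < ν) (Ψ : SuperBergman p q ν hν) :
    ‖Ψ‖ ^ 2 = ∑ M, Real.Gamma ν / Real.Gamma (ν + M.card) * ‖bargmannLinear p q hν Ψ M‖ ^ 2 := by
  have h1 : inner ℂ Ψ Ψ = _ := superPairing_self_eq hν Ψ.isSuperBergman
  rw [inner_self_eq_norm_sq_to_K] at h1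
  have h2 : ‖Ψ‖ ^ 2 = _ := Complex.ofReal_injective ((Complex.ofReal_pow _ _).trans h1)
  rw [h2, Finset.mul_sum]
  refine Finset.sum_congr rfl fun M _ => ?_
  obtain ⟨D, _, hD1, hD⟩ := compWeight_eq (q := q) hν M
  have h2 : ‖bargmannLinear p q hν Ψ M‖ ^ 2 = _ :=
    (norm_lp_sq _).trans (Ψ.isSuperBergman.hasSum_superBargmann hν M).tsum_eq
  simp only [hD, mul_assoc]
  rw [h2, integral_const_mul, ← mul_assoc, ← mul_assoc, hD1]
  congr 1
  have := (gamma_card_pos hν M).ne'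
  field_simp

theorem bargmannLinear_injective {ν : ℝ} (hν : (p : ℝ) < ν) :
    Function.Injective (bargmannLinear p q hν) := by
  rw [← LinearMap.ker_eq_bot, LinearMap.ker_eq_bot']
  intro Ψ h
  have := norm_sq_eq_sum hν Ψ
  rw [h] at this
  simpa using this

theorem bargmannLinear_surjective {ν : ℝ} (hν : (p : ℝ) < ν) :
    Function.Surjective (bargmannLinear p q hν) := by
  intro b
  -- Riesz–Fischer: the preimage is the power series whose coefficients are the prescribed entries
  -- divided by the norms of the monomials, extended by zero outside the ball.
  let c : Finset (Fin q) → (Fin p → ℕ) → ℂ := fun M n => b M n / monomialNorm ν M n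
  have hcs : ∀ M, Summable fun n => ‖c M n‖ ^ 2 * moment p (ν + M.card - p) n := by
    intro M
    have h1 := (memlp_two_iff _).1 (lp.memℓp (b M))
    have hG := gamma_card_pos hν M
    have hG' := Real.Gamma_pos_of_pos (shift_pos hν M)
    refine (h1.mul_left (Real.pi ^ p * Real.Gamma (ν + M.card - p) /
      Real.Gamma (ν + M.card))).congr fun n => ?_
    have hk := monomialNorm_sq hν M n
    have hk0 := (monomialNorm_pos hν M n).ne'
    have hm : moment p (ν + M.card - p) n = Real.pi ^ p * Real.Gamma (ν + M.card - p) /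
      Real.Gamma (ν + M.card) * monomialNorm ν M n ^ 2 := by rw [hk]; field_simp
    rw [hm, norm_div, div_pow, Complex.norm_real, Real.norm_eq_abs, sq_abs]
    field_simp
  have hcz : ∀ M, ∀ z ∈ unitBall p, Summable fun n => ‖c M n‖ * ∏ k, ‖z k‖ ^ n k :=
    fun M z hz => summable_norm_monomial (shift_pos hν M) (hcs M) hz
  let Ψ : SuperHol p q := fun M => (unitBall p).indicator (powerSeries (c M))
  have hE : ∀ M, Set.EqOn (Ψ M) (powerSeries (c M)) (unitBall p) := fun M z hz =>
    Set.indicator_of_mem hz _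
  have hT : ∀ M n, taylorCoeff (Ψ M) n = c M n := fun M n => by
    rw [taylorCoeff_congr (hE M), taylorCoeff_powerSeries (hcz M)]
  have hΨ : IsSuperBergman ν Ψ := by
    refine isSuperBergman_of_summable hν
      (fun M => (differentiableOn_powerSeries (hcz M)).congr fun z hz => hE M hz)
      (fun M z hz => Set.indicator_of_notMem hz _) fun M => ?_
    simp only [hT]
    exact hcs M
  refine ⟨⟨Ψ, hΨ⟩, ?_⟩
  funext M
  ext n
  change superBargmann ν Ψ M n = b M n
  rw [superBargmann_eq hν hΨ, hT]
  exact mul_div_cancel₀ _ (Complex.ofReal_ne_zero.2 (monomialNorm_pos hν M n).ne')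

/-- The super Bargmann transform as a linear equivalence. -/
noncomputable def bargmannEquiv (p q : ℕ) {ν : ℝ} (hν : (p : ℝ) < ν) :
    SuperBergman p q ν hν ≃ₗ[ℂ] (Finset (Fin q) → lp (fun _ : Fin p → ℕ => ℂ) 2) :=
  LinearEquiv.ofBijective (bargmannLinear p q hν)
    ⟨bargmannLinear_injective hν, bargmannLinear_surjective hν⟩

/-- The super Bargmann transform, normalized to an isometry onto a Hilbert sum. -/
noncomputable def bargmannIsometry (p q : ℕ) {ν : ℝ} (hν : (p : ℝ) < ν) :
    SuperBergman p q ν hν →ₗᵢ[ℂ]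
      PiLp 2 (fun _ : Finset (Fin q) => lp (fun _ : Fin p → ℕ => ℂ) 2) where
  toLinearMap := (WithLp.linearEquiv 2 ℂ
    (Finset (Fin q) → lp (fun _ : Fin p → ℕ => ℂ) 2)).symm.toLinearMap ∘ₗ
    LinearMap.pi fun M => ((Real.sqrt (Real.Gamma ν / Real.Gamma (ν + M.card)) : ℝ) : ℂ) •
      (LinearMap.proj M ∘ₗ bargmannLinear p q hν)
  norm_map' Ψ := by
    have hG : 0 < Real.Gamma ν := Real.Gamma_pos_of_pos (lt_of_le_of_lt (Nat.cast_nonneg p) hν)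
    rw [← sq_eq_sq₀ (norm_nonneg _) (norm_nonneg _), PiLp.norm_sq_eq_of_L2, norm_sq_eq_sum hν]
    refine Finset.sum_congr rfl fun M _ => ?_
    have hM := gamma_card_pos hν M
    change ‖((Real.sqrt (Real.Gamma ν / Real.Gamma (ν + M.card)) : ℝ) : ℂ) •
      bargmannLinear p q hν Ψ M‖ ^ 2 = _
    rw [norm_smul, mul_pow, Complex.norm_real, Real.norm_eq_abs, sq_abs,
      Real.sq_sqrt (by positivity)]

theorem bargmannIsometry_apply {ν : ℝ} (hν : (p : ℝ) < ν) (Ψ : SuperBergman p q ν hν)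
    (M : Finset (Fin q)) :
    bargmannIsometry p q hν Ψ M =
      ((Real.sqrt (Real.Gamma ν / Real.Gamma (ν + M.card)) : ℝ) : ℂ) •
        bargmannLinear p q hν Ψ M := rfl

theorem sqrt_ratio_ne_zero {ν : ℝ} (hν : (p : ℝ) < ν) (M : Finset (Fin q)) :
    ((Real.sqrt (Real.Gamma ν / Real.Gamma (ν + M.card)) : ℝ) : ℂ) ≠ 0 := by
  have hG : 0 < Real.Gamma ν := Real.Gamma_pos_of_pos (lt_of_le_of_lt (Nat.cast_nonneg p) hν)
  have hM := gamma_card_pos hν M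
  exact Complex.ofReal_ne_zero.2 (Real.sqrt_pos.2 (by positivity)).ne'

theorem bargmannIsometry_surjective {ν : ℝ} (hν : (p : ℝ) < ν) :
    Function.Surjective (bargmannIsometry p q hν) := by
  intro b
  obtain ⟨Ψ, hΨ⟩ := bargmannLinear_surjective hν fun M =>
    ((Real.sqrt (Real.Gamma ν / Real.Gamma (ν + M.card)) : ℝ) : ℂ)⁻¹ • b M
  refine ⟨Ψ, ?_⟩
  ext1 M
  rw [bargmannIsometry_apply, hΨ, smul_inv_smul₀ (sqrt_ratio_ne_zero hν M)]

/-- Completeness is inherited from the finite Hilbert sum of ℓ² spaces, through the surjective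
isometry. -/
theorem completeSpace_superBergman {ν : ℝ} (hν : (p : ℝ) < ν) :
    CompleteSpace (SuperBergman p q ν hν) :=
  (LinearIsometryEquiv.ofSurjective (bargmannIsometry p q hν)
    (bargmannIsometry_surjective hν)).toIsometryEquiv.completeSpace_iff.2 inferInstance

theorem weightedInner_bargmann {ν : ℝ} (hν : (p : ℝ) < ν) (Θ Ψ : SuperBergman p q ν hν) :
    weightedInner ν (bargmannLinear p q hν Θ) (bargmannLinear p q hν Ψ) = inner ℂ Θ Ψ := by
  have hG : 0 < Real.Gamma ν := Real.Gamma_pos_of_pos (lt_of_le_of_lt (Nat.cast_nonneg p) hν)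
  rw [← (bargmannIsometry p q hν).inner_map_map, PiLp.inner_apply, weightedInner]
  refine Finset.sum_congr rfl fun M _ => ?_
  have hM := gamma_card_pos hν M
  rw [bargmannIsometry_apply, bargmannIsometry_apply, inner_smul_left, inner_smul_right,
    Complex.conj_ofReal, ← mul_assoc, ← Complex.ofReal_mul, Real.mul_self_sqrt (by positivity),
    lp.inner_eq_tsum]
  congr 2
  funext n
  rw [RCLike.inner_apply, mul_comm]

end Bargmann

/-! ### Toeplitz operators, their multipliers and commutativity. -/

section Toeplitz

variable {p q : ℕ}

/-- For unit vectors the hypothesis reads ‖f x y‖ ≤ 2C; homogeneity gives the rest. -/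
theorem norm_le_of_quadratic_bound {E : Type*} [NormedAddCommGroup E] [NormedSpace ℂ E]
    (f : E →ₗ⋆[ℂ] E →ₗ[ℂ] ℂ) {C : ℝ}
    (h : ∀ x y, ‖f x y‖ ≤ C * (‖x‖ ^ 2 + ‖y‖ ^ 2)) (x y : E) :
    ‖f x y‖ ≤ 2 * C * ‖x‖ * ‖y‖ := by
  rcases eq_or_ne x 0 with rfl | hx
  · simp
  rcases eq_or_ne y 0 with rfl | hy
  · simp
  have hx' : 0 < ‖x‖ := norm_pos_iff.2 hx
  have hy' : 0 < ‖y‖ := norm_pos_iff.2 hy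
  have := h ((‖x‖⁻¹ : ℂ) • x) ((‖y‖⁻¹ : ℂ) • y)
  simp only [map_smulₛₗ, LinearMap.smul_apply, RingHom.id_apply, smul_eq_mul, norm_mul, norm_smul, map_inv₀, Complex.conj_ofReal,
    norm_inv, Complex.norm_real, norm_norm, inv_mul_cancel₀ hx'.ne', inv_mul_cancel₀ hy'.ne'] at this
  have h2 : ‖f x y‖ = ‖x‖ * (‖y‖ * (‖y‖⁻¹ * (‖x‖⁻¹ * ‖f x y‖))) := by field_simp
  rw [h2]
  have h3 : 2 * C * ‖x‖ * ‖y‖ = ‖x‖ * (‖y‖ * (2 * C)) := by ring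
  rw [h3]
  refine mul_le_mul_of_nonneg_left (mul_le_mul_of_nonneg_left ?_ hy'.le) hx'.le
  calc _ ≤ _ := this
    _ = _ := by ring

theorem superIntegrand_symbol_add_left (ν : ℝ) (Θ Θ' : SuperHol p q) (G : (Fin p → ℂ) → Grassmann q)
    (z : Fin p → ℂ) :
    superIntegrand ν (Θ + Θ') G z = superIntegrand ν Θ G z + superIntegrand ν Θ' G z := by
  simp only [superIntegrand, SuperHol.starVal, Pi.add_apply, map_add, add_smul,
    Finset.sum_add_distrib, add_mul, mul_add]

theorem superIntegrand_symbol_smul_left (ν : ℝ) (c : ℂ) (Θ : SuperHol p q)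
    (G : (Fin p → ℂ) → Grassmann q) (z : Fin p → ℂ) :
    superIntegrand ν (c • Θ) G z = (starRingEnd ℂ) c * superIntegrand ν Θ G z := by
  simp only [superIntegrand, SuperHol.starVal, Pi.smul_apply, smul_eq_mul, map_mul, mul_smul,
    ← Finset.smul_sum, smul_mul_assoc, mul_smul_comm, map_smul]

theorem superIntegrand_symbol_add_right (ν : ℝ) (F : SuperFunction p q) (Θ Ψ Ψ' : SuperHol p q)
    (z : Fin p → ℂ) :
    superIntegrand ν Θ (fun z => F.val z * (Ψ + Ψ').val z) z =
      superIntegrand ν Θ (fun z => F.val z * Ψ.val z) z +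
        superIntegrand ν Θ (fun z => F.val z * Ψ'.val z) z := by
  simp only [superIntegrand, SuperHol.val, Pi.add_apply, map_add, add_smul,
    Finset.sum_add_distrib, mul_add]

theorem superIntegrand_symbol_smul_right (ν : ℝ) (F : SuperFunction p q) (c : ℂ)
    (Θ Ψ : SuperHol p q) (z : Fin p → ℂ) :
    superIntegrand ν Θ (fun z => F.val z * (c • Ψ).val z) z =
      c * superIntegrand ν Θ (fun z => F.val z * Ψ.val z) z := by
  simp only [superIntegrand, SuperHol.val, Pi.smul_apply, smul_eq_mul, mul_smul,
    ← Finset.smul_sum, mul_smul_comm, map_smul]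

/-- The sesquilinear form `(Θ | F Ψ)`. -/
noncomputable def symbolForm {F : SuperFunction p q} (hF : IsBoundedMeasurable F)
    (hQ : IsQuasiElliptic F) {ν : ℝ} (hν : (p : ℝ) < ν) :
    SuperBergman p q ν hν →ₗ⋆[ℂ] SuperBergman p q ν hν →ₗ[ℂ] ℂ :=
  LinearMap.mk₂'ₛₗ (starRingEnd ℂ) (RingHom.id ℂ)
    (fun Θ Ψ => superPairing ν Θ.coeff fun z => F.val z * Ψ.coeff.val z)
    (fun Θ Θ' Ψ => by
      rw [superPairing, superPairing, superPairing, ← mul_add, ← integral_add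
        (integrableOn_form hF hQ hν Θ.isSuperBergman Ψ.isSuperBergman)
        (integrableOn_form hF hQ hν Θ'.isSuperBergman Ψ.isSuperBergman)]
      congr 2
      funext z
      exact superIntegrand_symbol_add_left ν _ _ _ z)
    (fun c Θ Ψ => by
      rw [superPairing, superPairing, smul_eq_mul, mul_left_comm, ← integral_const_mul ((starRingEnd ℂ) c)]
      congr 2
      funext z
      exact superIntegrand_symbol_smul_left ν c _ _ z)
    (fun Θ Ψ Ψ' => by
      rw [superPairing, superPairing, superPairing, ← mul_add, ← integral_add
        (integrableOn_form hF hQ hν Θ.isSuperBergman Ψ.isSuperBergman)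
        (integrableOn_form hF hQ hν Θ.isSuperBergman Ψ'.isSuperBergman)]
      congr 2
      funext z
      exact superIntegrand_symbol_add_right ν F _ _ _ z)
    (fun c Θ Ψ => by
      rw [superPairing, superPairing, smul_eq_mul, mul_left_comm, ← integral_const_mul ((RingHom.id ℂ) c)]
      congr 2
      funext z
      exact superIntegrand_symbol_smul_right ν F c _ _ z)

theorem exists_isSuperToeplitz {F : SuperFunction p q} (hF : IsBoundedMeasurable F)
    (hQ : IsQuasiElliptic F) {ν : ℝ} (hν : (p : ℝ) < ν) :
    ∃ T : SuperBergman p q ν hν →L[ℂ] SuperBergman p q ν hν, IsSuperToeplitz F T := by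
  have := completeSpace_superBergman (q := q) hν
  obtain ⟨C, _, hC⟩ := exists_form_bound hF hQ hν
  let B := (symbolForm hF hQ hν).mkContinuous₂ (2 * C)
    (norm_le_of_quadratic_bound (symbolForm hF hQ hν) hC)
  -- Riesz representation produces S with ⟨SΘ, Ψ⟩ = (Θ | FΨ). The Toeplitz operator acts on the
  -- second argument, hence the adjoint.
  refine ⟨(InnerProductSpace.continuousLinearMapOfBilin B).adjoint, fun Θ Ψ =>
    ⟨integrableOn_form hF hQ hν Θ.isSuperBergman Ψ.isSuperBergman, ?_⟩⟩
  rw [ContinuousLinearMap.adjoint_inner_right,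
    InnerProductSpace.continuousLinearMapOfBilin_apply]
  rfl

theorem IsSuperToeplitz.unique {ν : ℝ} {hν : (p : ℝ) < ν} {F : SuperFunction p q}
    {T T' : SuperBergman p q ν hν →L[ℂ] SuperBergman p q ν hν} (h : IsSuperToeplitz F T)
    (h' : IsSuperToeplitz F T') : T' = T := by
  ext1 Ψ
  exact ext_inner_left ℂ fun Θ => (h' Θ Ψ).2.trans (h Θ Ψ).2.symm

/-- The integrand depends on the moduli only; (2π)^p from the angles against π^p in the
normalization leaves the factor 2^p of the multiplier. -/
theorem integral_symbol_weight {ν : ℝ} (hν : (p : ℝ) < ν) {F : SuperFunction p q}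
    (hQ : IsQuasiElliptic F) (I K : Finset (Fin q)) (n : Fin p → ℕ) :
    ((Real.Gamma ν / (Real.pi ^ p * Real.Gamma (ν + q - p)) : ℝ) : ℂ) *
      ∫ z in unitBall p, ((∏ k, ‖z k‖ ^ (2 * n k) : ℝ) : ℂ) *
        (F I I z * (compWeight p q ν K z : ℂ)) =
      ((Real.Gamma ν * 2 ^ p / Real.Gamma (ν + K.card - p) : ℝ) : ℂ) *
        ∫ r in ballBase p, F I I (fun k => (r k : ℂ)) *
          (((∏ k, r k ^ (2 * n k)) * (1 - ∑ k, r k ^ 2) ^ (ν + K.card - p - 1) *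
            ∏ k, r k : ℝ) : ℂ) := by
  rw [integral_unitBall_polar (fun t z hz => ?_)]
  · obtain ⟨D, _, h1, hD⟩ := compWeight_eq (q := q) hν K
    have e : ∀ r ∈ ballBase p, ((∏ k, ‖(r k : ℂ)‖ ^ (2 * n k) : ℝ) : ℂ) *
        (F I I (fun k => (r k : ℂ)) * (compWeight p q ν K (fun k => (r k : ℂ)) : ℂ)) *
        ((∏ k, r k : ℝ) : ℂ) = (D : ℂ) * (F I I (fun k => (r k : ℂ)) *
          (((∏ k, r k ^ (2 * n k)) * (1 - ∑ k, r k ^ 2) ^ (ν + K.card - p - 1) *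
            ∏ k, r k : ℝ) : ℂ)) := by
      intro r hr
      have hn : ∀ k, ‖(r k : ℂ)‖ = r k := fun k => by
        rw [Complex.norm_real, Real.norm_of_nonneg (hr.1 k)]
      rw [hD]
      simp only [hn]
      push_cast
      ring
    rw [setIntegral_congr_fun measurableSet_ballBase e, integral_const_mul, ← mul_assoc,
      ← mul_assoc]
    congr 1
    rw [mul_right_comm, ← Complex.ofReal_mul, h1, ← Complex.ofReal_pow, ← Complex.ofReal_mul]
    congr 1
    have h2 := (Real.Gamma_pos_of_pos (shift_pos hν K)).ne'
    rw [mul_pow]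
    field_simp
  · have hn : ∀ k, ‖(t k : ℂ)‖ = 1 := fun k => Circle.norm_coe (t k)
    simp only [hQ.rotate t hz, compWeight_rot, norm_mul, hn, one_mul]

theorem IsSuperToeplitz.taylorCoeff_eq {ν : ℝ} {hν : (p : ℝ) < ν} {F : SuperFunction p q}
    (hF : IsBoundedMeasurable F) (hQ : IsQuasiElliptic F)
    {T : SuperBergman p q ν hν →L[ℂ] SuperBergman p q ν hν} (h : IsSuperToeplitz F T)
    (Ψ : SuperBergman p q ν hν) (M : Finset (Fin q)) (n : Fin p → ℕ) :
    taylorCoeff ((T Ψ).coeff M) n = multiplier ν F n M * taylorCoeff (Ψ.coeff M) n := by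
  have hG : 0 < Real.Gamma ν := Real.Gamma_pos_of_pos (lt_of_le_of_lt (Nat.cast_nonneg p) hν)
  have hS := gamma_shift_pos hν M n
  -- Testing the defining identity with z^n ξ_M: the left side is a known constant times the n-th
  -- coefficient of TΨ, and every term on the right contains the n-th coefficient of Ψ.
  have h1 := (h (monomialBergman hν M n) Ψ).2
  rw [inner_monomialBergman, superPairing_form_eq hF hQ hν
    (monomialBergman hν M n).isSuperBergman Ψ.isSuperBergman, coeff_monomialBergman,
    Finset.sum_eq_single M] at h1
  · have e : ∀ K ∈ Finset.univ.filter (fun K => M ⊆ K),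
        (∫ z in unitBall p, F (K \ M) (K \ M) z * ((compWeight p q ν K z : ℂ) *
            ((starRingEnd ℂ) (monomialHol M n M z) * Ψ.coeff M z))) =
        taylorCoeff (Ψ.coeff M) n * ∫ z in unitBall p, ((∏ k, ‖z k‖ ^ (2 * n k) : ℝ) : ℂ) *
          (F (K \ M) (K \ M) z * (compWeight p q ν K z : ℂ)) := by
      intro K hK
      obtain ⟨_, _, hb⟩ := exists_bound_term hF hν (Finset.mem_filter.1 hK).2
      have hi := (hb _ _ (isSuperBergman_monomialHol hν M n) Ψ.isSuperBergman).1
      simp only [← mul_assoc (F (K \ M) (K \ M) _)] at hi ⊢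
      exact integral_conj_monomial (φ := fun z => F (K \ M) (K \ M) z * (compWeight p q ν K z : ℂ))
        (Ψ.isSuperBergman.holo M)
        (fun t z hz => by rw [hQ.rotate t hz, compWeight_rot]) M n hi
    have hne : ((Real.Gamma ν * (∏ k, ((n k).factorial : ℝ)) /
        Real.Gamma ((∑ k, n k : ℕ) + ν + M.card) : ℝ) : ℂ) ≠ 0 :=
      Complex.ofReal_ne_zero.2 (by positivity)
    refine mul_left_cancel₀ hne (h1.trans ?_)
    rw [multiplier, ← mul_assoc, ← mul_assoc, ← Complex.ofReal_mul, Finset.mul_sum, Finset.mul_sum,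
      Finset.sum_mul]
    refine Finset.sum_congr rfl fun K hK => ?_
    rw [e K hK, mul_left_comm, mul_left_comm _ (taylorCoeff _ _), integral_symbol_weight hν hQ]
    have hc : Real.Gamma ν * (∏ k, ((n k).factorial : ℝ)) /
        Real.Gamma ((∑ k, n k : ℕ) + ν + M.card) *
        (2 ^ p * Real.Gamma ((∑ k, n k : ℕ) + ν + M.card) / (∏ k, (n k).factorial : ℕ)) =
        Real.Gamma ν * 2 ^ p := by
      rw [Nat.cast_prod]
      have : ∏ k, ((n k).factorial : ℝ) ≠ 0 := by positivity
      field_simp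
    rw [hc]
    push_cast
    ring
  · intro N _ hN
    simp [monomialHol, hN]
  · simp

theorem eq_of_taylorCoeff_eq {ν : ℝ} {hν : (p : ℝ) < ν} {Θ Ψ : SuperBergman p q ν hν}
    (h : ∀ M n, taylorCoeff (Θ.coeff M) n = taylorCoeff (Ψ.coeff M) n) : Θ = Ψ := by
  refine bargmannLinear_injective hν ?_
  funext M
  ext n
  rw [bargmannLinear_eq, bargmannLinear_eq, h]

/-- Operators that are diagonal with respect to the monomials. -/
def IsDiagonal {ν : ℝ} {hν : (p : ℝ) < ν}
    (A : SuperBergman p q ν hν →L[ℂ] SuperBergman p q ν hν)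
    (g : Finset (Fin q) → (Fin p → ℕ) → ℂ) : Prop :=
  ∀ Ψ M n, taylorCoeff ((A Ψ).coeff M) n = g M n * taylorCoeff (Ψ.coeff M) n

theorem IsDiagonal.commute {ν : ℝ} {hν : (p : ℝ) < ν}
    {A B : SuperBergman p q ν hν →L[ℂ] SuperBergman p q ν hν}
    {g h : Finset (Fin q) → (Fin p → ℕ) → ℂ} (hA : IsDiagonal A g) (hB : IsDiagonal B h) :
    A * B = B * A := by
  ext1 Ψ
  refine eq_of_taylorCoeff_eq fun M n => ?_
  change taylorCoeff ((A (B Ψ)).coeff M) n = taylorCoeff ((B (A Ψ)).coeff M) n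
  rw [hA, hB, hB, hA, mul_left_comm]

theorem IsDiagonal.apply_monomial {ν : ℝ} {hν : (p : ℝ) < ν}
    {A : SuperBergman p q ν hν →L[ℂ] SuperBergman p q ν hν}
    {g : Finset (Fin q) → (Fin p → ℕ) → ℂ} (hA : IsDiagonal A g) (M : Finset (Fin q))
    (n : Fin p → ℕ) : A (monomialBergman hν M n) = g M n • monomialBergman hν M n := by
  refine eq_of_taylorCoeff_eq fun N m => ?_
  rw [hA]
  refine Eq.trans ?_ (taylorCoeff_smul (g M n) (monomialHol M n N) m).symm
  rw [coeff_monomialBergman, taylorCoeff_monomialHol]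
  split_ifs with h
  · rw [h.1, h.2]
  · rw [mul_zero, mul_zero]

/-- The monomials are eigenvectors, so moving the adjoint across the pairing with a monomial yields
the conjugate eigenvalue. -/
theorem IsDiagonal.star_operator {ν : ℝ} {hν : (p : ℝ) < ν} [CompleteSpace (SuperBergman p q ν hν)]
    {A : SuperBergman p q ν hν →L[ℂ] SuperBergman p q ν hν}
    {g : Finset (Fin q) → (Fin p → ℕ) → ℂ} (hA : IsDiagonal A g) :
    IsDiagonal (star A) fun M n => (starRingEnd ℂ) (g M n) := by
  intro Ψ M n
  have hG : 0 < Real.Gamma ν := Real.Gamma_pos_of_pos (lt_of_le_of_lt (Nat.cast_nonneg p) hν)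
  have hS := gamma_shift_pos hν M n
  have hne : ((Real.Gamma ν * (∏ k, ((n k).factorial : ℝ)) /
        Real.Gamma ((∑ k, n k : ℕ) + ν + M.card) : ℝ) : ℂ) ≠ 0 :=
    Complex.ofReal_ne_zero.2 (by positivity)
  have h1 : inner ℂ (monomialBergman hν M n) (star A Ψ) =
      inner ℂ (A (monomialBergman hν M n)) Ψ := by
    rw [ContinuousLinearMap.star_eq_adjoint, ContinuousLinearMap.adjoint_inner_right]
  rw [hA.apply_monomial, inner_smul_left, inner_monomialBergman, inner_monomialBergman,
    mul_left_comm] at h1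
  exact mul_left_cancel₀ hne h1

/-- Generators that commute with one another and with each other's adjoints generate a commutative
star algebra, and continuity of multiplication extends this to the closure. -/
theorem commute_of_mem_topologicalClosure_adjoin {A : Type*} [Ring A] [Algebra ℂ A] [StarRing A]
    [StarModule ℂ A] [TopologicalSpace A] [IsTopologicalRing A] [ContinuousStar A] [T2Space A]
    {S : Set A} (h1 : ∀ a ∈ S, ∀ b ∈ S, a * b = b * a)
    (h2 : ∀ a ∈ S, ∀ b ∈ S, a * star b = star b * a) {a b : A}
    (ha : a ∈ (StarAlgebra.adjoin ℂ S).topologicalClosure)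
    (hb : b ∈ (StarAlgebra.adjoin ℂ S).topologicalClosure) : a * b = b * a := by
  let _ := StarSubalgebra.commRingTopologicalClosure (StarAlgebra.adjoin ℂ S)
    (StarAlgebra.isMulCommutative_adjoin ℂ h1 h2).is_comm.comm
  exact congrArg Subtype.val
    (mul_comm (⟨a, ha⟩ : (StarAlgebra.adjoin ℂ S).topologicalClosure) ⟨b, hb⟩)

end Toeplitz

end SuperBall

/-! ### The theorem assembled. -/

theorem mainTheorem1 (p q : ℕ) (hp : 1 ≤ p) (ν : ℝ) (hν : (p : ℝ) < ν) :
    ∃ (_ : CompleteSpace (SuperBall.SuperBergman p q ν hν))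
      (R : SuperBall.SuperBergman p q ν hν ≃ₗ[ℂ]
        (Finset (Fin q) → lp (fun _ : Fin p → ℕ => ℂ) 2)),
      (∀ Ψ M n, R Ψ M n = SuperBall.superBargmann ν Ψ.coeff M n) ∧
      (∀ Θ Ψ, SuperBall.weightedInner ν (R Θ) (R Ψ) = inner ℂ Θ Ψ) ∧
      (∀ F : SuperBall.SuperFunction p q,
        SuperBall.IsBoundedMeasurable F → SuperBall.IsQuasiElliptic F →
        ∃ T : SuperBall.SuperBergman p q ν hν →L[ℂ] SuperBall.SuperBergman p q ν hν,
          SuperBall.IsSuperToeplitz F T ∧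
          (∀ T', SuperBall.IsSuperToeplitz F T' → T' = T) ∧
          ∀ c M n, R (T (R.symm c)) M n = SuperBall.multiplier ν F n M * c M n) ∧
      (∀ A ∈ (StarAlgebra.adjoin ℂ
            {T : SuperBall.SuperBergman p q ν hν →L[ℂ] SuperBall.SuperBergman p q ν hν |
              ∃ F : SuperBall.SuperFunction p q, SuperBall.IsBoundedMeasurable F ∧
                SuperBall.IsQuasiElliptic F ∧ SuperBall.IsSuperToeplitz F T}).topologicalClosure,
        ∀ B ∈ (StarAlgebra.adjoin ℂ
            {T : SuperBall.SuperBergman p q ν hν →L[ℂ] SuperBall.SuperBergman p q ν hν |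
              ∃ F : SuperBall.SuperFunction p q, SuperBall.IsBoundedMeasurable F ∧
                SuperBall.IsQuasiElliptic F ∧ SuperBall.IsSuperToeplitz F T}).topologicalClosure,
          A * B = B * A) := by
  have hcs := SuperBall.completeSpace_superBergman (q := q) hν
  refine ⟨hcs, SuperBall.bargmannEquiv p q hν, fun Ψ M n => rfl,
    SuperBall.weightedInner_bargmann hν, fun F hF hQ => ?_, fun A hA B hB => ?_⟩
  · obtain ⟨T, hT⟩ := SuperBall.exists_isSuperToeplitz hF hQ hν
    refine ⟨T, hT, fun T' hT' => hT.unique hT', fun c M n => ?_⟩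
    -- Writing c as the transform of some Ψ reduces the multiplier claim to the action on Taylor
    -- coefficients, the norm of z^n being common to both sides.
    obtain ⟨Ψ, rfl⟩ := (SuperBall.bargmannEquiv p q hν).surjective c
    rw [LinearEquiv.symm_apply_apply]
    refine (SuperBall.bargmannLinear_eq hν (T Ψ) M n).trans ?_
    rw [hT.taylorCoeff_eq hF hQ, mul_left_comm]
    exact congrArg _ (SuperBall.bargmannLinear_eq hν Ψ M n).symm
  · have hD : ∀ T ∈ {T : SuperBall.SuperBergman p q ν hν →L[ℂ] SuperBall.SuperBergman p q ν hν |
        ∃ F : SuperBall.SuperFunction p q, SuperBall.IsBoundedMeasurable F ∧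
          SuperBall.IsQuasiElliptic F ∧ SuperBall.IsSuperToeplitz F T},
        ∃ g, SuperBall.IsDiagonal T g := by
      rintro T ⟨F, hF, hQ, hT⟩
      exact ⟨fun M n => SuperBall.multiplier ν F n M, hT.taylorCoeff_eq hF hQ⟩
    refine SuperBall.commute_of_mem_topologicalClosure_adjoin ?_ ?_ hA hB
    -- Both commutation conditions on the generators follow from simultaneous diagonality; the
    -- second also uses the conjugate multiplier of the adjoint.
    · intro a ha b hb
      obtain ⟨g, hg⟩ := hD a ha
      obtain ⟨h, hh⟩ := hD b hb
      exact hg.commute hh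
    · intro a ha b hb
      obtain ⟨g, hg⟩ := hD a ha
      obtain ⟨h, hh⟩ := hD b hb
      exact hg.commute hh.star_operator
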